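/- **Setting.** Kinds are $\kappa::=o\mid\kappa_1\to\kappa_2$, with order $\mathrm{ord}(o)=0$, $\mathrm{ord}(\kappa_1\to\kappa_2)=\max(\mathrm{ord}(\kappa_1)+1,\mathrm{ord}(\kappa_2))$, and $|\kappa|$ denotes the number of symbols of $\kappa$. A *higher-order game* consists of an NFA $A=(Q,T,\delta,q_0,Q_f)$, a word-generating recursion scheme $G$ (terminals: an end marker $\$:o$ and the letters $a:o\to o$ of $T$; finitely many kinded non-terminals $F:\kappa_1\to\dots\to\kappa_n\to o$, each with a finite non-empty list of rules $F=\lambda x_1\dots\lambda x_n.\,e_i$, $1\le i\le\ell_F$, where $e_i$ is a $\lambda$-free ground term over the terminals, the non-terminals and $x_1,\dots,x_n$; an initial non-terminal), and an owner, existential or universal, for each non-terminal. The *determinized scheme* has exactly one rule $F=\lambda x_1\dots\lambda x_n.\,\mathrm{op}_F\,e_1\cdots e_{\ell_F}$ per non-terminal, where $\mathrm{op}_F$ is a new terminal of kind $o\to\dots\to o$ with $\ell_F$ arguments. *Optimized model.* For a word $w\in T^*$ let $\mathrm{acc}(w)$ be the set of states from which $A$ accepts $w$. Positive Boolean formulas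 are built from atomic propositions and $\mathrm{true}$ by conjunction and disjunction, and are considered up to logical equivalence and ordered by implication. The ground domain $\mathcal D(o)$ consists of the formulas over $Q$ obtained from the positive Boolean formulas over the atomic propositions $\{\mathrm{acc}(w): w\in T^*\}$ by replacing each $\mathrm{acc}(w)$ by $\bigvee_{q\in\mathrm{acc}(w)}q$ (the empty disjunction being false). Further, $\mathcal D(\kappa_1\to\kappa_2)$ is the set of functions $\mathcal D(\kappa_1)\to\mathcal D(\kappa_2)$ that preserve meets of descending chains, ordered pointwise. The end marker $\$$ is interpreted by $\bigvee_{q\in Q_f} q$; the letter $a$ by the map that replaces each $q$ in a formula by $\bigvee\{p : p\xrightarrow{a}q\}$; and $\mathrm{op}_F$ by $\ell_F$-ary disjunction if the existential player owns $F$, and by $\ell_F$-ary conjunction if the universal player does. Let $\mathrm{rhs}$ be the map on valuations of the non-terminals (assigning to each $F:\kappa$ an element of $\mathcal D(\kappa)$) that sends $\nu$ to $F\mapsto$ the value under $\nu$ of the right-hand side for $F$ in the determinized scheme. The *optimized semantics* is $\sigma=\bigsqcap_{i\in\mathbb N}\mathrm{rhs}^i(\top)$. *Computation.* Let $\exp_0(n)=n$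 and $\exp_{j+1}(n)=2^{\exp_j(n)}$. Games are encoded as binary words in a fixed standard way (numbers in unary); $\|\mathcal G\|$ is the length of the code of the game $\mathcal G$. A ground element is represented by a formula in conjunctive normal form, an element $f$ of $\mathcal D(\kappa_1\to\kappa_2)$ by a table of pairs (representation of $d$, representation of $f(d)$) in which every $d\in\mathcal D(\kappa_1)$ occurs, and $\sigma$ by a list with one representation of $\sigma(F)$ for each non-terminal $F$. **Proposition.** There is a polynomial $p$ with natural-number coefficients such that the following hold. 1. For every game and every kind $\kappa$ of order $k'$, the domain $\mathcal D(\kappa)$ of the optimized model is finite, its cardinality is at most $\exp_{k'+2}(p(|Q|+|\kappa|))$, and every strictly descending chain in it has at most $\exp_{k'+1}(p(|Q|+|\kappa|))$ elements. 2. For every game $\mathcal G$ with highest order $k$ of a non-terminal, $\sigma$ is the greatest fixed point of $\mathrm{rhs}$, and Kleene iteration reaches it in at most $(k+1)$-fold exponentially many steps: $\mathrm{rhs}^i(\top)=\sigma$ for some $i\le\exp_{k+1}(p(\|\mathcal G\|))$. 3. The optimized semantics is computable in $(k+1)$-fold exponential time: there is one multi-stack Turing machine that, on the code of any game $\mathcal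 G$ with highest order $k$ of a non-terminal, halts after at most $\exp_{k+1}(p(\|\mathcal G\|))$ steps and outputs (the code of) a representation of $\sigma$. -/

import Mathlib

namespace HOGame

/-! ### Kinds -/

/-- Kinds `κ ::= o | κ₁ → κ₂`. -/
inductive Kind : Type
  | ground : Kind
  | arrow : Kind → Kind → Kind

namespace Kind

/-- The order of a kind. -/
def order : Kind → ℕ
  | ground => 0
  | arrow a b => max (a.order + 1) b.order

/-- The number of symbols of a kind. -/
def size : Kind → ℕ
  | ground => 1
  | arrow a b => a.size + b.size + 1

/-- The list `[κ₁, …, κₙ]` of argument kinds of `κ₁ → … → κₙ → o`; its length is the arity. -/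
def args : Kind → List Kind
  | ground => []
  | arrow a b => a :: b.args

/-- The kind `o → … → o → o` with `n` arguments. -/
def firstOrder : ℕ → Kind
  | 0 => ground
  | n + 1 => arrow ground (firstOrder n)

end Kind

/-! ### Pointed ω-complete partial orders (for descending chains) -/

/-- `f` preserves the meets of descending chains. -/
def MeetContinuous {A B : Type} [PartialOrder A] [PartialOrder B] (f : A → B) : Prop :=
  ∀ (d : ℕ → A) (e : A), Antitone d → IsGLB (Set.range d) e →
    IsGLB (Set.range fun i => f (d i)) (f e)

/-- A cppo: a partial order with a greatest element in which every descending chain has a meet. -/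
structure Cppo : Type 1 where
  carrier : Type
  [order : PartialOrder carrier]
  [top : OrderTop carrier]
  complete : ∀ d : ℕ → carrier, Antitone d → ∃ e, IsGLB (Set.range d) e

instance : CoeSort Cppo Type := ⟨Cppo.carrier⟩

instance (D : Cppo) : PartialOrder D := D.order

instance (D : Cppo) : OrderTop D := D.top

theorem MeetContinuous.monotone {A B : Type} [PartialOrder A] [PartialOrder B] {f : A → B}
    (hf : MeetContinuous f) : Monotone f := by
  intro x y hxy
  have hd : Antitone fun i : ℕ => if i = 0 then y else x := by
    intro i j hij
    by_cases hi : i = 0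
    · by_cases hj : j = 0 <;> simp [hi, hj, hxy]
    · have hj : j ≠ 0 := by omega
      simp [hi, hj]
  have hg : IsGLB (Set.range fun i : ℕ => if i = 0 then y else x) x := by
    constructor
    · rintro _ ⟨i, rfl⟩
      by_cases hi : i = 0 <;> simp [hi, hxy]
    · intro z hz
      simpa using hz ⟨1, rfl⟩
  have h := (hf _ x hd hg).1 ⟨0, rfl⟩
  simpa using h

theorem isGLB_range_iff {A : Type} [PartialOrder A] {d : ℕ → A} {e : A} :
    IsGLB (Set.range d) e ↔ (∀ i, e ≤ d i) ∧ ∀ x, (∀ i, x ≤ d i) → x ≤ e := by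
  constructor
  · rintro ⟨h1, h2⟩
    refine ⟨fun i => h1 ⟨i, rfl⟩, fun x hx => h2 ?_⟩
    rintro _ ⟨i, rfl⟩
    exact hx i
  · rintro ⟨h1, h2⟩
    refine ⟨?_, fun x hx => h2 x fun i => hx ⟨i, rfl⟩⟩
    rintro _ ⟨i, rfl⟩
    exact h1 i

theorem isGLB_range_prod {A B : Type} [PartialOrder A] [PartialOrder B] {d : ℕ → A × B}
    {e : A × B} : IsGLB (Set.range d) e ↔
      IsGLB (Set.range fun i => (d i).1) e.1 ∧ IsGLB (Set.range fun i => (d i).2) e.2 := by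
  rw [isGLB_prod, ← Set.range_comp, ← Set.range_comp]
  rfl

theorem isGLB_range_const {A : Type} [PartialOrder A] (a : A) :
    IsGLB (Set.range fun _ : ℕ => a) a :=
  isGLB_range_iff.2 ⟨fun _ => le_rfl, fun _ hx => hx 0⟩

/-- Meets of descending chains of functions are pointwise. -/
theorem isGLB_range_fun {A : Type} [PartialOrder A] {B : Cppo}
    {f : ℕ → {f : A → B // MeetContinuous f}} {g : {f : A → B // MeetContinuous f}}
    (h : ∀ a, IsGLB (Set.range fun i => (f i).1 a) (g.1 a)) : IsGLB (Set.range f) g := by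
  rw [isGLB_range_iff]
  refine ⟨fun i a => (isGLB_range_iff.1 (h a)).1 i, fun x hx a => ?_⟩
  exact (isGLB_range_iff.1 (h a)).2 _ fun i => hx i a

theorem exists_pointwise {A : Type} [PartialOrder A] {B : Cppo}
    (f : ℕ → {f : A → B // MeetContinuous f}) (hf : Antitone f) :
    ∃ g : {f : A → B // MeetContinuous f},
      ∀ a, IsGLB (Set.range fun i => (f i).1 a) (g.1 a) := by
  have hex : ∀ a, ∃ e, IsGLB (Set.range fun i => (f i).1 a) e := fun a =>
    B.complete _ fun i j hij => hf hij a
  choose g hg using hex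
  refine ⟨⟨g, fun d e hd he => ?_⟩, hg⟩
  rw [isGLB_range_iff]
  constructor
  · intro j
    refine (isGLB_range_iff.1 (hg (d j))).2 _ fun i => ?_
    exact ((isGLB_range_iff.1 (hg e)).1 i).trans
      ((f i).2.monotone ((isGLB_range_iff.1 he).1 j))
  · intro x hx
    refine (isGLB_range_iff.1 (hg e)).2 _ fun i => ?_
    refine (isGLB_range_iff.1 ((f i).2 d e hd he)).2 _ fun j => ?_
    exact (hx j).trans ((isGLB_range_iff.1 (hg (d j))).1 i)

theorem isGLB_range_fun_iff {A : Type} [PartialOrder A] {B : Cppo}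
    {f : ℕ → {f : A → B // MeetContinuous f}} {g : {f : A → B // MeetContinuous f}}
    (hf : Antitone f) :
    IsGLB (Set.range f) g ↔ ∀ a, IsGLB (Set.range fun i => (f i).1 a) (g.1 a) := by
  refine ⟨fun h => ?_, isGLB_range_fun⟩
  obtain ⟨g', hg'⟩ := exists_pointwise f hf
  rwa [h.unique (isGLB_range_fun hg')]

/-- The cppo `Cont(A, B)` of ⊓-continuous functions with the pointwise order. -/
def Cppo.arrow (A B : Cppo) : Cppo where
  carrier := {f : A → B // MeetContinuous f}
  top :=
    { top := ⟨fun _ => ⊤, fun _ _ _ _ => isGLB_range_const _⟩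
      le_top := fun _ _ => le_top }
  complete f hf :=
    let ⟨g, hg⟩ := exists_pointwise f hf
    ⟨g, isGLB_range_fun hg⟩

/-- The one-element cppo. -/
def Cppo.unit : Cppo where
  carrier := Unit
  complete _ _ := ⟨(), isGLB_range_iff.2 ⟨fun _ => le_rfl, fun _ _ => le_rfl⟩⟩

/-- The product of two cppos with the componentwise order. -/
def Cppo.prod (A B : Cppo) : Cppo where
  carrier := A × B
  complete d hd := by
    obtain ⟨a, ha⟩ := A.complete (fun i => (d i).1) fun i j hij => (hd hij).1
    obtain ⟨b, hb⟩ := B.complete (fun i => (d i).2) fun i j hij => (hd hij).2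
    exact ⟨(a, b), isGLB_range_prod.2 ⟨ha, hb⟩⟩

/-- The domain `D(κ)` over a ground domain `D(o) = D`, with
`D(κ₁ → κ₂) = Cont(D(κ₁), D(κ₂))`. -/
def Dom (D : Cppo) : Kind → Cppo
  | .ground => D
  | .arrow a b => (Dom D a).arrow (Dom D b)

/-- Values for a list of variables of the given kinds. -/
def Env (D : Cppo) : List Kind → Cppo
  | [] => Cppo.unit
  | κ :: Γ => (Dom D κ).prod (Env D Γ)

/-! ### Terms and schemes -/

/-- `Var Γ κ` is the set of positions in the list `Γ` that hold `κ`. If the kinds of the variables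
`x₁, …, xₙ` are listed in `Γ`, it is the set of those variables that have kind `κ`. -/
inductive Var : List Kind → Kind → Type
  | zero {Γ : List Kind} {κ : Kind} : Var (κ :: Γ) κ
  | succ {Γ : List Kind} {κ κ' : Kind} : Var Γ κ → Var (κ' :: Γ) κ

/-- `Term tk nk Γ κ` is the set of `λ`-free terms of kind `κ` over terminals `T` with kinds `tk`,
non-terminals `N` with kinds `nk`, and variables whose kinds are listed in `Γ`. -/
inductive Term {T N : Type} (tk : T → Kind) (nk : N → Kind) (Γ : List Kind) : Kind → Type
  | terminal (t : T) : Term tk nk Γ (tk t)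
  | nonterminal (F : N) : Term tk nk Γ (nk F)
  | var {κ : Kind} (x : Var Γ κ) : Term tk nk Γ κ
  | app {a b : Kind} (s : Term tk nk Γ (Kind.arrow a b)) (t : Term tk nk Γ a) : Term tk nk Γ b

/-- A (non-deterministic) recursion scheme over kinded terminals. `rules F` lists the bodies `e` of
the rules `F = λ x₁ … λ xₙ. e`, where `F : κ₁ → … → κₙ → o` and `xᵢ : κᵢ`, and every non-terminal
has at least one rule. Variables are identified with their position among the arguments of `F`. -/
structure Scheme {T : Type} (tk : T → Kind) (N : Type) where
  nkind : N → Kind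
  start : N
  rules : ∀ F : N, List (Term tk nkind (nkind F).args Kind.ground)
  rules_ne_nil : ∀ F, rules F ≠ []

/-- A deterministic scheme: exactly one rule `F = λ x₁ … λ xₙ. e` for every non-terminal. -/
structure DetScheme {T : Type} (tk : T → Kind) (N : Type) where
  nkind : N → Kind
  start : N
  rule : ∀ F : N, Term tk nkind (nkind F).args Kind.ground

section Determinization

variable {T N : Type} {tk : T → Kind}

/-- The kinds of the terminals of the determinized scheme: `T` is extended by one terminal
`op_F : o → … → o` per non-terminal `F`, whose arity is the number of rules for `F`. -/
def Scheme.detKind (G : Scheme tk N) : T ⊕ N → Kind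
  | .inl t => tk t
  | .inr F => Kind.firstOrder (G.rules F).length

/-- A term over the original terminals as a term over the extended terminals. -/
def Scheme.liftTerm (G : Scheme tk N) {Γ : List Kind} :
    {κ : Kind} → Term tk G.nkind Γ κ → Term G.detKind G.nkind Γ κ
  | _, .terminal t => Term.terminal (tk := G.detKind) (Sum.inl t)
  | _, .nonterminal F => Term.nonterminal F
  | _, .var x => Term.var x
  | _, .app s t => Term.app (G.liftTerm s) (G.liftTerm t)

/-- `s e₁ … eₗ` for ground terms `e₁, …, eₗ` that are lifted to the extended terminals. -/
def Scheme.liftApps (G : Scheme tk N) {Γ : List Kind} :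
    (l : List (Term tk G.nkind Γ Kind.ground)) →
      Term G.detKind G.nkind Γ (Kind.firstOrder l.length) →
        Term G.detKind G.nkind Γ Kind.ground
  | [], s => s
  | e :: l, s => G.liftApps l (Term.app s (G.liftTerm e))

/-- The determinized scheme, with the rule `F = λ x₁ … λ xₙ. op_F e₁ … eₗ` for `F`, where
`e₁, …, eₗ` are the bodies of the original rules for `F`. -/
def Scheme.det (G : Scheme tk N) : DetScheme G.detKind N where
  nkind := G.nkind
  start := G.start
  rule F := G.liftApps (G.rules F) (Term.terminal (tk := G.detKind) (Sum.inr F))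

end Determinization

/-! ### Semantics of deterministic schemes in a model -/

/-- The value of a variable. -/
def lookup {D : Cppo} : {Γ : List Kind} → {κ : Kind} → Var Γ κ → Env D Γ → Dom D κ
  | _, _, .zero, e => Prod.fst e
  | _, _, .succ x, e => lookup x (Prod.snd e)

theorem lookup_continuous {D : Cppo} {Γ : List Kind} {κ : Kind} (x : Var Γ κ) :
    MeetContinuous (lookup (D := D) x) := by
  induction x with
  | zero => intro d e _ he; exact (isGLB_range_prod.1 he).1
  | succ x ih =>
    intro d e hd he
    exact ih (fun i => (d i).2) e.2 (fun i j hij => (hd hij).2) (isGLB_range_prod.1 he).2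

/-- The function `d₁ ↦ … ↦ dₙ ↦ f (d₁, …, dₙ)` of kind `κ = κ₁ → … → κₙ → o`, as a ⊓-continuous
function of `f`. -/
def curry {D : Cppo} : (κ : Kind) → ((Env D κ.args).arrow D).arrow (Dom D κ)
  | .ground => ⟨fun f => f.1 (), fun _ _ hd he => (isGLB_range_fun_iff hd).1 he ()⟩
  | .arrow a b =>
    have slice : ∀ (f : (Env D (Kind.arrow a b).args).arrow D) (d : Dom D a),
        MeetContinuous fun e : Env D b.args => f.1 (d, e) := fun f d c e hc he =>
      f.2 (fun i => (d, c i)) (d, e) (fun _ _ hij => ⟨le_rfl, hc hij⟩)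
        (isGLB_range_prod.2 ⟨isGLB_range_const d, he⟩)
    have cont : ∀ f : (Env D (Kind.arrow a b).args).arrow D,
        MeetContinuous fun d : Dom D a =>
          (curry b).1 ⟨fun e => f.1 (d, e), slice f d⟩ := fun f c d hc hd =>
      (curry b).2 (fun i => ⟨fun e => f.1 (c i, e), slice f (c i)⟩)
        ⟨fun e => f.1 (d, e), slice f d⟩
        (fun _ _ hij _ => f.2.monotone ⟨hc hij, le_rfl⟩)
        (isGLB_range_fun fun e =>
          f.2 (fun i => (c i, e)) (d, e) (fun _ _ hij => ⟨hc hij, le_rfl⟩)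
            (isGLB_range_prod.2 ⟨hd, isGLB_range_const e⟩))
    ⟨fun f => ⟨fun d => (curry b).1 ⟨fun e => f.1 (d, e), slice f d⟩, cont f⟩,
      fun c f hc hf => isGLB_range_fun fun d =>
        (curry b).2 (fun i => ⟨fun e => (c i).1 (d, e), slice (c i) d⟩)
          ⟨fun e => f.1 (d, e), slice f d⟩
          (fun _ _ hij e => hc hij (d, e))
          (isGLB_range_fun fun e => (isGLB_range_fun_iff hc).1 hf (d, e))⟩

section Semantics

variable {T N : Type} {tk : T → Kind} {nk : N → Kind} {D : Cppo}

/-- The value of a term under an interpretation `I` of the terminals and a valuation of the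
non-terminals (`ν`) and of the variables (`η`). -/
def Term.sem (I : ∀ t : T, Dom D (tk t)) {Γ : List Kind} :
    {κ : Kind} → Term tk nk Γ κ → (∀ F : N, Dom D (nk F)) → Env D Γ → Dom D κ
  | _, .terminal t, _, _ => I t
  | _, .nonterminal F, ν, _ => ν F
  | _, .var x, _, η => lookup x η
  | _, .app s t, ν, η => (s.sem I ν η).1 (t.sem I ν η)

theorem Term.sem_isGLB (I : ∀ t : T, Dom D (tk t)) {Γ : List Kind} {κ : Kind}
    (t : Term tk nk Γ κ) {ν : ℕ → ∀ F : N, Dom D (nk F)} {ν' : ∀ F : N, Dom D (nk F)}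
    {η : ℕ → Env D Γ} {η' : Env D Γ} (hν : Antitone ν) (hν' : IsGLB (Set.range ν) ν')
    (hη : Antitone η) (hη' : IsGLB (Set.range η) η') :
    (Antitone fun i => t.sem I (ν i) (η i)) ∧
      IsGLB (Set.range fun i => t.sem I (ν i) (η i)) (t.sem I ν' η') := by
  induction t with
  | terminal t => exact ⟨antitone_const, isGLB_range_const _⟩
  | nonterminal F =>
    refine ⟨fun i j hij => hν hij F, ?_⟩
    have h := (isGLB_pi.1 hν') F
    rw [← Set.range_comp] at h
    exact h
  | var x =>
    exact ⟨fun i j hij => (lookup_continuous x).monotone (hη hij),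
      lookup_continuous x η η' hη hη'⟩
  | app s t ihs iht =>
    obtain ⟨hs, hs'⟩ := ihs
    obtain ⟨ht, ht'⟩ := iht
    have anti : Antitone fun i => (Term.app s t).sem I (ν i) (η i) := fun i j hij =>
      (hs hij (t.sem I (ν j) (η j))).trans ((s.sem I (ν i) (η i)).2.monotone (ht hij))
    refine ⟨anti, isGLB_range_iff.2 ⟨fun i => ?_, fun x hx => ?_⟩⟩
    · exact ((isGLB_range_iff.1 hs').1 i _).trans
        ((s.sem I (ν i) (η i)).2.monotone ((isGLB_range_iff.1 ht').1 i))
    · have hp := (isGLB_range_fun_iff hs).1 hs' (t.sem I ν' η')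
      refine (isGLB_range_iff.1 hp).2 x fun i => ?_
      refine (isGLB_range_iff.1 ((s.sem I (ν i) (η i)).2 _ _ ht ht')).2 x fun j => ?_
      refine (hx (max i j)).trans ?_
      exact (hs (le_max_left i j) _).trans
        ((s.sem I (ν i) (η i)).2.monotone (ht (le_max_right i j)))

theorem Term.sem_continuous (I : ∀ t : T, Dom D (tk t)) {Γ : List Kind} {κ : Kind}
    (t : Term tk nk Γ κ) (ν : ∀ F : N, Dom D (nk F)) : MeetContinuous (t.sem I ν) :=
  fun _ _ hd he => (t.sem_isGLB I (ν := fun _ => ν) antitone_const (isGLB_range_const ν) hd he).2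

/-- The function `rhs` on valuations of the non-terminals: `rhs ν F` is the value
of the right-hand side `λ x₁ … λ xₙ. e` of the rule for `F` under `ν`. -/
def DetScheme.rhs (H : DetScheme tk N) (I : ∀ t : T, Dom D (tk t))
    (ν : ∀ F : N, Dom D (H.nkind F)) : ∀ F : N, Dom D (H.nkind F) := fun F =>
  (curry (H.nkind F)).1 ⟨(H.rule F).sem I ν, (H.rule F).sem_continuous I ν⟩

theorem DetScheme.rhs_continuous (H : DetScheme tk N) (I : ∀ t : T, Dom D (tk t)) :
    MeetContinuous (H.rhs I) := by
  intro d e hd he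
  refine isGLB_pi.2 fun F => ?_
  rw [← Set.range_comp]
  refine (curry (H.nkind F)).2
    (fun i => ⟨(H.rule F).sem I (d i), (H.rule F).sem_continuous I (d i)⟩)
    ⟨(H.rule F).sem I e, (H.rule F).sem_continuous I e⟩ ?_ ?_
  · intro i j hij η
    exact ((H.rule F).sem_isGLB I hd he (η := fun _ => η) antitone_const
      (isGLB_range_const η)).1 hij
  · exact isGLB_range_fun fun η => ((H.rule F).sem_isGLB I hd he (η := fun _ => η) antitone_const
      (isGLB_range_const η)).2

/-- The approximants `rhs^i (⊤)` of Kleene iteration. -/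
def DetScheme.approx (H : DetScheme tk N) (I : ∀ t : T, Dom D (tk t)) :
    ℕ → ∀ F : N, Dom D (H.nkind F)
  | 0 => fun _ => ⊤
  | i + 1 => H.rhs I (H.approx I i)

theorem DetScheme.exists_sol (H : DetScheme tk N) (I : ∀ t : T, Dom D (tk t)) :
    ∃ σ : ∀ F : N, Dom D (H.nkind F), IsGLB (Set.range (H.approx I)) σ := by
  have anti : Antitone (H.approx I) := by
    refine antitone_nat_of_succ_le fun n => ?_
    induction n with
    | zero => exact fun _ => le_top
    | succ n ih => exact (H.rhs_continuous I).monotone ih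
  have h : ∀ F, ∃ e, IsGLB (Set.range fun i => H.approx I i F) e := fun F =>
    (Dom D (H.nkind F)).complete _ fun i j hij => anti hij F
  choose σ hσ using h
  refine ⟨σ, isGLB_pi.2 fun F => ?_⟩
  rw [← Set.range_comp]
  exact hσ F

/-- The semantics of a deterministic scheme in a model: the meet of the approximants. -/
noncomputable def DetScheme.sol (H : DetScheme tk N) (I : ∀ t : T, Dom D (tk t)) :
    ∀ F : N, Dom D (H.nkind F) :=
  (H.exists_sol I).choose

end Semantics

/-! ### Automata, positive Boolean formulas, and the optimized ground domain -/

/-- A non-deterministic finite automaton with numbered states and letters. -/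
structure Automaton where
  numStates : ℕ
  numLetters : ℕ
  trans : Fin numStates → Fin numLetters → Fin numStates → Bool
  init : Fin numStates
  final : Fin numStates → Bool

namespace Automaton

variable (A : Automaton)

/-- There is a run from `q` to `q'` on the given word. -/
def Run : Fin A.numStates → List (Fin A.numLetters) → Fin A.numStates → Prop
  | q, [], q' => q = q'
  | q, a :: w, q' => ∃ p, A.trans q a p = true ∧ Run p w q'

/-- The set of states from which the word `w` is accepted. -/
def acceptFrom (w : List (Fin A.numLetters)) : Set (Fin A.numStates) :=
  {q | ∃ f, A.final f = true ∧ A.Run q w f}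

/-- The sets of states of the form `acceptFrom w`. -/
def AccSet : Type := {Q : Set (Fin A.numStates) // ∃ w, Q = A.acceptFrom w}

end Automaton

/-- Positive Boolean formulas over the atomic propositions `P`. -/
inductive Formula (P : Type) : Type
  | tru : Formula P
  | atom (p : P) : Formula P
  | and (φ ψ : Formula P) : Formula P
  | or (φ ψ : Formula P) : Formula P

/-- The formula holds if exactly the atomic propositions in `v` are true. -/
def Formula.Holds {P : Type} (v : Set P) : Formula P → Prop
  | tru => True
  | atom p => p ∈ v
  | and φ ψ => φ.Holds v ∧ ψ.Holds v
  | or φ ψ => φ.Holds v ∨ ψ.Holds v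

namespace Automaton

variable (A : Automaton)

/-- The class, up to logical equivalence, of the formula over states that results from `φ` by
replacing every atomic proposition `Q = {q₁, …, qₙ}` by the disjunction `q₁ ∨ … ∨ qₙ` (which is
false if `Q` is empty). A class of equivalent formulas is given by its set of satisfying
assignments, where an assignment is the set of the states that are true in it. -/
def resolve (φ : Formula A.AccSet) : Set (Set (Fin A.numStates)) :=
  {v | φ.Holds {Q | ∃ q ∈ Q.1, q ∈ v}}

/-- The elements of the optimized ground domain: the formulas over states, up to logical
equivalence, that arise from formulas over the sets `acceptFrom w`. The order is implication. -/
def OptGround : Type := {M : Set (Set (Fin A.numStates)) // ∃ φ, M = A.resolve φ}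

instance : PartialOrder A.OptGround :=
  inferInstanceAs (PartialOrder {M : Set (Set (Fin A.numStates)) // ∃ φ, M = A.resolve φ})

instance : OrderTop A.OptGround where
  top := ⟨Set.univ, Formula.tru, by ext; simp [resolve, Formula.Holds]⟩
  le_top M := Set.subset_univ M.1

instance : Finite A.OptGround :=
  inferInstanceAs (Finite {M : Set (Set (Fin A.numStates)) // ∃ φ, M = A.resolve φ})

end Automaton

theorem exists_stable {X : Type} [PartialOrder X] [Finite X] (d : ℕ → X) (hd : Antitone d) :
    ∃ n, ∀ m, n ≤ m → d m = d n := by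
  obtain ⟨_, ⟨n, rfl⟩, hn⟩ := (Set.toFinite (Set.range d)).exists_minimal ⟨d 0, 0, rfl⟩
  exact ⟨n, fun m hm => le_antisymm (hd hm) (hn ⟨m, rfl⟩ (hd hm))⟩

theorem isGLB_of_stable {X : Type} [PartialOrder X] {d : ℕ → X} (hd : Antitone d) {n : ℕ}
    (h : ∀ m, n ≤ m → d m = d n) : IsGLB (Set.range d) (d n) := by
  refine isGLB_range_iff.2 ⟨fun i => ?_, fun x hx => hx n⟩
  rcases le_total i n with hi | hi
  · exact hd hi
  · exact (h i hi).ge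

/-- A monotone function of two ⊓-continuous functions into finite orders is ⊓-continuous. -/
theorem MeetContinuous.comp₂ {X A B C : Type} [PartialOrder X] [PartialOrder A] [PartialOrder B]
    [PartialOrder C] [Finite A] [Finite B] {f : X → A} {g : X → B} (hf : MeetContinuous f)
    (hg : MeetContinuous g) {op : A → B → C}
    (hop : ∀ a a' b b', a ≤ a' → b ≤ b' → op a b ≤ op a' b') :
    MeetContinuous fun x => op (f x) (g x) := by
  intro d e hd he
  have hfd : Antitone fun i => f (d i) := fun i j hij => hf.monotone (hd hij)
  have hgd : Antitone fun i => g (d i) := fun i j hij => hg.monotone (hd hij)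
  obtain ⟨n, hn⟩ := exists_stable _ hfd
  obtain ⟨m, hm⟩ := exists_stable _ hgd
  have h1 := (hf d e hd he).unique (isGLB_of_stable hfd hn)
  have h2 := (hg d e hd he).unique (isGLB_of_stable hgd hm)
  have hst : ∀ k, max n m ≤ k → op (f (d k)) (g (d k)) = op (f e) (g e) := by
    intro k hk
    have e1 := hn k (le_trans (le_max_left n m) hk)
    have e2 := hm k (le_trans (le_max_right n m) hk)
    rw [e1, e2, h1, h2]
  have hanti : Antitone fun i => op (f (d i)) (g (d i)) := fun i j hij =>
    hop _ _ _ _ (hfd hij) (hgd hij)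
  have := isGLB_of_stable hanti (n := max n m) fun k hk => by
    rw [hst k hk, hst _ le_rfl]
  simpa only [hst _ le_rfl] using this

namespace Automaton

variable (A : Automaton)

/-- The optimized ground domain. -/
def optGround : Cppo where
  carrier := A.OptGround
  complete d hd :=
    let ⟨n, hn⟩ := exists_stable d hd
    ⟨d n, isGLB_of_stable hd hn⟩

instance : Finite A.optGround.carrier := inferInstanceAs (Finite A.OptGround)

/-- Conjunction on the optimized ground domain. -/
def conj (M M' : A.OptGround) : A.OptGround :=
  ⟨M.1 ∩ M'.1, by
    obtain ⟨_, φ, rfl⟩ := M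
    obtain ⟨_, ψ, rfl⟩ := M'
    exact ⟨φ.and ψ, rfl⟩⟩

/-- Disjunction on the optimized ground domain. -/
def disj (M M' : A.OptGround) : A.OptGround :=
  ⟨M.1 ∪ M'.1, by
    obtain ⟨_, φ, rfl⟩ := M
    obtain ⟨_, ψ, rfl⟩ := M'
    exact ⟨φ.or ψ, rfl⟩⟩

/-- The interpretation of the end marker: the disjunction of the final states. -/
def optEnd : A.OptGround :=
  ⟨{v | ∃ q, A.final q = true ∧ q ∈ v}, Formula.atom ⟨A.acceptFrom [], [], rfl⟩, by
    ext v
    constructor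
    · rintro ⟨q, hq, hv⟩
      exact ⟨q, ⟨q, hq, rfl⟩, hv⟩
    · rintro ⟨q, ⟨f, hf, rfl⟩, hv⟩
      exact ⟨q, hf, hv⟩⟩

theorem exists_pred (a : Fin A.numLetters) (φ : Formula A.AccSet) :
    ∃ ψ, {v | {q | ∃ p, A.trans p a q = true ∧ p ∈ v} ∈ A.resolve φ} = A.resolve ψ := by
  induction φ with
  | tru => exact ⟨.tru, rfl⟩
  | atom Q =>
    obtain ⟨_, w, rfl⟩ := Q
    refine ⟨.atom ⟨A.acceptFrom (a :: w), a :: w, rfl⟩, ?_⟩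
    ext v
    simp only [resolve, Formula.Holds, acceptFrom, Run, Set.mem_ofPred_eq]
    constructor
    · rintro ⟨q, ⟨f, hf, hr⟩, p, hp, hv⟩
      exact ⟨p, ⟨f, hf, q, hp, hr⟩, hv⟩
    · rintro ⟨p, ⟨f, hf, q, hp, hr⟩, hv⟩
      exact ⟨q, ⟨f, hf, hr⟩, p, hp, hv⟩
  | and φ ψ ih₁ ih₂ =>
    obtain ⟨φ', h₁⟩ := ih₁
    obtain ⟨ψ', h₂⟩ := ih₂
    refine ⟨φ'.and ψ', ?_⟩
    ext v
    exact and_congr (Set.ext_iff.1 h₁ v) (Set.ext_iff.1 h₂ v)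
  | or φ ψ ih₁ ih₂ =>
    obtain ⟨φ', h₁⟩ := ih₁
    obtain ⟨ψ', h₂⟩ := ih₂
    refine ⟨φ'.or ψ', ?_⟩
    ext v
    exact or_congr (Set.ext_iff.1 h₁ v) (Set.ext_iff.1 h₂ v)

/-- The predecessor function of the letter `a`: every atomic proposition `q` in a formula is
replaced by the disjunction of the states `p` with a transition from `p` to `q` under `a`. -/
def optPred (a : Fin A.numLetters) (M : A.OptGround) : A.OptGround :=
  ⟨{v | {q | ∃ p, A.trans p a q = true ∧ p ∈ v} ∈ M.1}, by
    obtain ⟨_, φ, rfl⟩ := M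
    exact A.exists_pred a φ⟩

theorem optPred_continuous (a : Fin A.numLetters) : MeetContinuous (A.optPred a) := by
  have hid : MeetContinuous (id : A.OptGround → A.OptGround) := fun _ _ _ he => he
  exact MeetContinuous.comp₂ (op := fun M _ => A.optPred a M) hid hid
    fun M M' _ _ h _ v hv => h hv

end Automaton

/-! ### Games and the optimized model -/

/-- The two players. -/
inductive Player : Type
  | existential
  | universal

/-- The kinds of the terminals of a word-generating scheme: the end marker `none` is ground,
all letters have kind `o → o`. -/
def wordKind {L : Type} : Option L → Kind
  | none => Kind.ground
  | some _ => Kind.arrow Kind.ground Kind.ground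

/-- A higher-order game: an automaton, a word-generating scheme over the letters of the automaton
with numbered non-terminals, and an owner for every non-terminal. -/
structure Game where
  aut : Automaton
  numNonterminals : ℕ
  scheme : Scheme (wordKind (L := Fin aut.numLetters)) (Fin numNonterminals)
  owner : Fin numNonterminals → Player

namespace Game

variable (G : Game)

/-- The highest order of a non-terminal. -/
def order : ℕ := Finset.univ.sup fun F => (G.scheme.nkind F).order

/-- The domain of the optimized model for the kind `κ`. -/
def optDom (κ : Kind) : Cppo := Dom G.aut.optGround κ

/-- Binary disjunction for the existential player, binary conjunction for the universal player. -/
def choice : Player → G.aut.OptGround → G.aut.OptGround → G.aut.OptGround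
  | .existential => G.aut.disj
  | .universal => G.aut.conj

theorem choice_mono (P : Player) (a a' b b' : G.aut.OptGround) (h : a ≤ a') (h' : b ≤ b') :
    G.choice P a b ≤ G.choice P a' b' := by
  cases P with
  | existential => exact Set.union_subset_union h h'
  | universal => exact Set.inter_subset_inter h h'

/-- The conjunction or disjunction of `n` formulas (`n = 0` does not occur in games). -/
def choices (P : Player) : (n : ℕ) → Env G.aut.optGround (Kind.firstOrder n).args →
    G.aut.OptGround
  | 0, _ => ⊤
  | 1, e => e.1
  | n + 2, e => G.choice P e.1 (choices P (n + 1) e.2)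

theorem choices_continuous (P : Player) (n : ℕ) : MeetContinuous (G.choices P n) := by
  have hfst : ∀ n, MeetContinuous fun e : Env G.aut.optGround (Kind.firstOrder (n + 1)).args =>
      (e.1 : G.aut.OptGround) := fun n d e hd he => (isGLB_range_prod.1 he).1
  induction n with
  | zero => exact fun d e _ _ => isGLB_range_const _
  | succ n ih =>
    cases n with
    | zero => exact hfst 0
    | succ n =>
      refine MeetContinuous.comp₂ (A := G.aut.OptGround) (B := G.aut.OptGround)
        (op := G.choice P) (hfst (n + 1)) ?_ (G.choice_mono P)
      exact fun d e hd he =>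
        ih (fun i => (d i).2) e.2 (fun i j hij => (hd hij).2) (isGLB_range_prod.1 he).2

/-- The interpretation of the terminals of the determinized scheme in the optimized model. -/
def optInterp : ∀ t, Dom G.aut.optGround (G.scheme.detKind t)
  | .inl none => G.aut.optEnd
  | .inl (some a) => ⟨G.aut.optPred a, G.aut.optPred_continuous a⟩
  | .inr F => (curry (Kind.firstOrder (G.scheme.rules F).length)).1
      ⟨G.choices (G.owner F) _, G.choices_continuous (G.owner F) _⟩

/-- Valuations of the non-terminals in the optimized model. -/
abbrev OptVal : Type := ∀ F, G.optDom (G.scheme.nkind F)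

/-- The right-hand side function of the determinized scheme in the optimized model. -/
def optRhs : G.OptVal → G.OptVal := G.scheme.det.rhs G.optInterp

/-- The optimized semantics: the semantics of the determinized scheme in the optimized model. -/
noncomputable def optSol : G.OptVal := G.scheme.det.sol G.optInterp

end Game

/-! ### Encoding of games and of domain elements -/

/-- Binary trees, in which all data are encoded. -/
inductive SExp : Type
  | nil : SExp
  | cons : SExp → SExp → SExp

namespace SExp

/-- The preorder traversal of a tree. -/
def toBits : SExp → List Bool
  | nil => [false]
  | cons s t => true :: (s.toBits ++ t.toBits)

def ofList : List SExp → SExp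
  | [] => nil
  | s :: l => cons s (ofList l)

/-- Unary encoding of a number. -/
def ofNat (n : ℕ) : SExp := ofList (List.replicate n nil)

def ofBool : Bool → SExp
  | false => nil
  | true => cons nil nil

/-- The list of the codes `f 0, …, f (n - 1)`. -/
def ofFn {n : ℕ} (f : Fin n → SExp) : SExp := ofList (List.ofFn f)

end SExp

def Kind.code : Kind → SExp
  | ground => .nil
  | arrow a b => .cons a.code b.code

def Player.code : Player → SExp
  | existential => SExp.ofBool false
  | universal => SExp.ofBool true

/-- The position of a variable in the list of variables. -/
def Var.index : {Γ : List Kind} → {κ : Kind} → Var Γ κ → ℕ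
  | _, _, .zero => 0
  | _, _, .succ x => x.index + 1

/-- The code of a term over letters, end marker, non-terminals and variables: a tag together with
the number of the symbol or the codes of the two subterms. -/
def Term.code {L n : ℕ} {nk : Fin n → Kind} {Γ : List Kind} :
    {κ : Kind} → Term (wordKind (L := Fin L)) nk Γ κ → SExp
  | _, .terminal none => .cons (SExp.ofNat 0) .nil
  | _, .terminal (some a) => .cons (SExp.ofNat 1) (SExp.ofNat a)
  | _, .nonterminal F => .cons (SExp.ofNat 2) (SExp.ofNat F)
  | _, .var x => .cons (SExp.ofNat 3) (SExp.ofNat x.index)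
  | _, .app s t => .cons (SExp.ofNat 4) (.cons s.code t.code)

def Automaton.code (A : Automaton) : SExp :=
  SExp.ofList [SExp.ofNat A.numStates, SExp.ofNat A.numLetters,
    SExp.ofFn fun q => SExp.ofFn fun a => SExp.ofFn fun q' => SExp.ofBool (A.trans q a q'),
    SExp.ofNat A.init, SExp.ofFn fun q => SExp.ofBool (A.final q)]

def Game.code (G : Game) : SExp :=
  SExp.ofList [G.aut.code, SExp.ofNat G.numNonterminals,
    SExp.ofFn fun F => (G.scheme.nkind F).code,
    SExp.ofNat G.scheme.start,
    SExp.ofFn fun F => SExp.ofList ((G.scheme.rules F).map Term.code),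
    SExp.ofFn fun F => (G.owner F).code]

/-- The input word that encodes a game. -/
def Game.input (G : Game) : List Bool := G.code.toBits

/-- Explicit representations of domain elements: formulas in conjunctive normal form (lists of
clauses, which are lists of states) for the ground kind, and tables that list the values of all
arguments for function kinds. -/
def Table (n : ℕ) : Kind → Type
  | .ground => List (List (Fin n))
  | .arrow a b => List (Table n a × Table n b)

/-- The table represents the given element of the domain of kind `κ`. For a function `f`, the
entries are pairs of a representation of an argument `d` and a representation of `f d`, and all
arguments occur. -/
def Represents (A : Automaton) :
    (κ : Kind) → Table A.numStates κ → Dom A.optGround κ → Prop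
  | .ground, (t : List (List (Fin A.numStates))), M =>
      ∀ v : Set (Fin A.numStates), v ∈ M.1 ↔ ∀ c ∈ t, ∃ q ∈ c, q ∈ v
  | .arrow a b, (t : List (Table A.numStates a × Table A.numStates b)), f =>
      (∀ p ∈ t, ∃ d : Dom A.optGround a, Represents A a p.1 d ∧ Represents A b p.2 (f.1 d)) ∧
      ∀ d : Dom A.optGround a, ∃ p ∈ t, Represents A a p.1 d

def Table.code {n : ℕ} : (κ : Kind) → Table n κ → SExp
  | .ground, t => SExp.ofList (t.map fun c => SExp.ofList (c.map fun q => SExp.ofNat q))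
  | .arrow a b, t => SExp.ofList (t.map fun p => .cons (Table.code a p.1) (Table.code b p.2))

/-- The output word that encodes a table for every non-terminal. -/
def Game.output (G : Game) (τ : ∀ F, Table G.aut.numStates (G.scheme.nkind F)) : List Bool :=
  (SExp.ofFn fun F => Table.code (G.scheme.nkind F) (τ F)).toBits

/-! ### Complexity -/

/-- The `j`-fold exponential `2 ^ (2 ^ … (2 ^ n))`. -/
def tower : ℕ → ℕ → ℕ
  | 0, n => n
  | j + 1, n => 2 ^ tower j n

/-- The machine, started on the word `x`, halts with output `y` after at most `t` steps. -/
def OutputsWithin (M : Turing.TM2ComputableAux Bool Bool) (x y : List Bool) (t : ℕ) : Prop :=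
  Nonempty (Turing.TM2OutputsInTime M.tm (x.map M.inputAlphabet.invFun)
    (some (y.map M.outputAlphabet.invFun)) t)

end HOGame

open HOGame

namespace HOGame

/-! ### Open machine fragments -/

/-! Cardinalities. A ground element is a set of assignments, so `𝒟(o)` has at most `2^(2^|Q|)`
elements, and a function domain has at most `|𝒟(κ₂)|^|𝒟(κ₁)|`. A product of towers of positive
height is bounded by a tower over the sum of the arguments, so the exponents add up along the kind
(`tower_arrow_le`, `card_dom_le`). Chains are bounded one exponential lower by a strictly monotone
rank (`exists_rank`): the number of satisfying assignments of a ground element, and for a function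
the sum of the ranks of its values.

Kleene iteration. The sum of the ranks over all non-terminals drops in every round that changes
something, so iteration is stable after at most `Game.height` rounds. The stable value is `σ`, and
every fixed point lies below all iterates, hence below `σ`.

Computation. Data are binary trees in preorder on one stack of a four-stack machine. `TC f S` says
that a program fragment computes `f` in time polynomial in the scale `S a` and the size of `a`. The
notion is closed under composition, pairing, branching, loops with a decreasing counter (`TC.loop`),
recursion (`TC.hylo`) and iteration up to stability (`TC.fix`), so no concrete machine beyond these
constructions is ever analyzed.

The algorithm relies on a normal form. A positive formula is upward closed, so it implies a clause
`c` exactly if it fails at the complement of `c`. The sets generated from the final states under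
predecessors and unions are the clauses that occur in conjunctive normal forms of elements of
`𝒟(o)`. There are at most `2^|Q|` of them, and an element is coded by the list of all of them that
it implies. On such codes the order is reverse inclusion, conjunction and disjunction are union and
intersection, and predecessors act clause by clause. Functions are coded by tables over the
enumerated argument domain, and the functions of the model are exactly the monotone tables, as all
domains are finite (`domSpec`).

Two points keep the time at `k + 1` exponentials. Only the domains of argument kinds are enumerated;
they have order at most `k - 1`, so their sizes are towers of height `k + 1`. The value of a
non-terminal is one table over all argument tuples, and its own domain is never listed (`nodes_le`).
For `k = 0` even the ground domain is too large to be listed; but then no letter is ever passed as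
an argument, so letters are applied directly and the list is not needed (`evalVal_eq`,
`groundList_spec`). -/

abbrev Stk : Type := Fin 4 → List Bool

abbrev MStmt (Λ : Type) : Type := Turing.TM2.Stmt (fun _ : Fin 4 => Bool) Λ (Option Bool)

abbrev MCfg (Λ : Type) : Type := Turing.TM2.Cfg (fun _ : Fin 4 => Bool) Λ (Option Bool)

/-- The machine reaches `c'` from `c` in at most `t` steps. -/
def Reach {Λ : Type} (m : Λ → MStmt Λ) (c c' : MCfg Λ) (t : ℕ) : Prop :=
  ∃ n ≤ t, (flip bind (Turing.TM2.step m))^[n] (some c) = some c'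

theorem Reach.trans {Λ : Type} {m : Λ → MStmt Λ} {c c' c'' : MCfg Λ} {t u : ℕ}
    (h : Reach m c c' t) (h' : Reach m c' c'' u) : Reach m c c'' (t + u) := by
  obtain ⟨n, hn, e⟩ := h
  obtain ⟨k, hk, e'⟩ := h'
  refine ⟨k + n, by omega, ?_⟩
  rw [Function.iterate_add_apply, e, e']

theorem Reach.mono {Λ : Type} {m : Λ → MStmt Λ} {c c' : MCfg Λ} {t u : ℕ}
    (h : Reach m c c' t) (htu : t ≤ u) : Reach m c c' u := by
  obtain ⟨n, hn, e⟩ := h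
  exact ⟨n, hn.trans htu, e⟩

theorem Reach.single {Λ : Type} {m : Λ → MStmt Λ} {l : Λ} {v : Option Bool} {s : Stk}
    {c : MCfg Λ} (h : Turing.TM2.stepAux (m l) v s = c) : Reach m ⟨some l, v, s⟩ c 1 :=
  ⟨1, le_rfl, congrArg some h⟩

theorem Reach.head {Λ : Type} {m : Λ → MStmt Λ} {l : Λ} {v : Option Bool} {s : Stk}
    {c c' : MCfg Λ} {t : ℕ} (h : Turing.TM2.stepAux (m l) v s = c) (h' : Reach m c c' t) :
    Reach m ⟨some l, v, s⟩ c' (t + 1) :=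
  ((Reach.single h).trans h').mono (by omega)

/-- A program with one entry and one exit, whose labels can be embedded into any set of labels. -/
structure Frag where
  Λ : Type
  [fin : Fintype Λ]
  start : Λ
  code : ∀ {Λ' : Type}, (Λ → Λ') → Λ' → Λ → MStmt Λ'

/-- Wherever the fragment is embedded, it leads from the stacks `s` to the stacks `s'`. -/
def Frag.Runs (M : Frag) (s s' : Stk) (t : ℕ) : Prop :=
  ∀ (Λ' : Type) (m : Λ' → MStmt Λ') (e : M.Λ → Λ') (x : Λ'),
    (∀ l, m (e l) = M.code e x l) → Reach m ⟨some (e M.start), none, s⟩ ⟨some x, none, s'⟩ t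

theorem Frag.Runs.mono {M : Frag} {s s' : Stk} {t u : ℕ} (h : M.Runs s s' t) (htu : t ≤ u) :
    M.Runs s s' u := fun Λ' m e x hm => (h Λ' m e x hm).mono htu

def Frag.seq (M N : Frag) : Frag :=
  have := M.fin
  have := N.fin
  { Λ := M.Λ ⊕ N.Λ
    start := .inl M.start
    code := fun e x l => match l with
      | .inl l => M.code (fun l => e (.inl l)) (e (.inr N.start)) l
      | .inr l => N.code (fun l => e (.inr l)) x l }

theorem Frag.Runs.seq {M N : Frag} {s s' s'' : Stk} {t u : ℕ} (h : M.Runs s s' t)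
    (h' : N.Runs s' s'' u) : (M.seq N).Runs s s'' (t + u) := fun Λ' m e x hm =>
  (h Λ' m (fun l => e (.inl l)) _ fun l => hm (.inl l)).trans
    (h' Λ' m (fun l => e (.inr l)) x fun l => hm (.inr l))

/-- One label that may be repeated. -/
def Frag.loop (q : ∀ {Λ' : Type}, Λ' → Λ' → MStmt Λ') : Frag where
  Λ := Unit
  start := ()
  code := fun e x _ => q (e ()) x

/-- The stacks, given one by one. -/
def stk (a b c d : List Bool) : Stk := ![a, b, c, d]

section stk
variable (a b c d x : List Bool)
@[simp] theorem stk_zero : stk a b c d 0 = a := rfl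
@[simp] theorem stk_one : stk a b c d 1 = b := rfl
@[simp] theorem stk_two : stk a b c d 2 = c := rfl
@[simp] theorem stk_three : stk a b c d 3 = d := rfl
@[simp] theorem update_stk_zero : Function.update (stk a b c d) 0 x = stk x b c d := by
  ext i; fin_cases i <;> rfl
@[simp] theorem update_stk_one : Function.update (stk a b c d) 1 x = stk a x c d := by
  ext i; fin_cases i <;> rfl
@[simp] theorem update_stk_two : Function.update (stk a b c d) 2 x = stk a b x d := by
  ext i; fin_cases i <;> rfl
@[simp] theorem update_stk_three : Function.update (stk a b c d) 3 x = stk a b c x := by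
  ext i; fin_cases i <;> rfl
end stk

open Turing.TM2.Stmt in
/-- Moves the contents of stack `i` onto other stacks with the statement `q`. -/
def Frag.transfer (i : Fin 4) (q : ∀ {Λ' : Type}, MStmt Λ' → MStmt Λ') : Frag :=
  .loop fun again exit =>
    pop i (fun _ o => o) <| branch Option.isSome
      (q <| load (fun _ => none) <| goto fun _ => again) (goto fun _ => exit)

open Turing.TM2.Stmt in
def pushVar {Λ' : Type} (i : Fin 4) (q : MStmt Λ') : MStmt Λ' :=
  push i (fun v => v.getD false) q

def Frag.oneToZero : Frag := .transfer 1 (pushVar 0)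
def Frag.twoToZero : Frag := .transfer 2 (pushVar 0)
def Frag.twoToOne : Frag := .transfer 2 (pushVar 1)
def Frag.oneToBoth : Frag := .transfer 1 fun q => pushVar 0 (pushVar 2 q)
def Frag.clearOne : Frag := .transfer 1 id

theorem Frag.oneToZero_runs (a b c d : List Bool) :
    Frag.oneToZero.Runs (stk a b c d) (stk (b.reverse ++ a) [] c d) (b.length + 1) := by
  intro Λ' m e x hm
  induction b generalizing a with
  | nil => exact Reach.single (by rw [hm]; simp [oneToZero, transfer, loop, pushVar])
  | cons y b ih =>
    have h := ih (y :: a)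
    have h3 := Reach.head (m := m) (l := e oneToZero.start) (v := none) (s := stk a (y :: b) c d) ?_ h
    · simpa using h3
    · rw [hm]; simp [oneToZero, transfer, loop, pushVar]

theorem Frag.twoToZero_runs (a b c d : List Bool) :
    Frag.twoToZero.Runs (stk a b c d) (stk (c.reverse ++ a) b [] d) (c.length + 1) := by
  intro Λ' m e x hm
  induction c generalizing a with
  | nil => exact Reach.single (by rw [hm]; simp [twoToZero, transfer, loop, pushVar])
  | cons y c ih =>
    have h := ih (y :: a)
    have h3 := Reach.head (m := m) (l := e twoToZero.start) (v := none) (s := stk a b (y :: c) d) ?_ h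
    · simpa using h3
    · rw [hm]; simp [twoToZero, transfer, loop, pushVar]

theorem Frag.twoToOne_runs (a b c d : List Bool) :
    Frag.twoToOne.Runs (stk a b c d) (stk a (c.reverse ++ b) [] d) (c.length + 1) := by
  intro Λ' m e x hm
  induction c generalizing b with
  | nil => exact Reach.single (by rw [hm]; simp [twoToOne, transfer, loop, pushVar])
  | cons y c ih =>
    have h := ih (y :: b)
    have h3 := Reach.head (m := m) (l := e twoToOne.start) (v := none) (s := stk a b (y :: c) d) ?_ h
    · simpa using h3
    · rw [hm]; simp [twoToOne, transfer, loop, pushVar]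

theorem Frag.oneToBoth_runs (a b c d : List Bool) :
    Frag.oneToBoth.Runs (stk a b c d) (stk (b.reverse ++ a) [] (b.reverse ++ c) d)
      (b.length + 1) := by
  intro Λ' m e x hm
  induction b generalizing a c with
  | nil => exact Reach.single (by rw [hm]; simp [oneToBoth, transfer, loop, pushVar])
  | cons y b ih =>
    have h := ih (y :: a) (y :: c)
    have h3 := Reach.head (m := m) (l := e oneToBoth.start) (v := none) (s := stk a (y :: b) c d) ?_ h
    · simpa using h3
    · rw [hm]; simp [oneToBoth, transfer, loop, pushVar]

theorem Frag.clearOne_runs (a b c d : List Bool) :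
    Frag.clearOne.Runs (stk a b c d) (stk a [] c d) (b.length + 1) := by
  intro Λ' m e x hm
  induction b with
  | nil => exact Reach.single (by rw [hm]; simp [clearOne, transfer, loop])
  | cons y b ih =>
    refine (Reach.head ?_ ih).mono (by simp)
    rw [hm]; simp [clearOne, transfer, loop]

/-- The number of bits of a tree. -/
def SExp.len (x : SExp) : ℕ := x.toBits.length

@[simp] theorem SExp.len_nil : SExp.nil.len = 1 := rfl
@[simp] theorem SExp.len_cons (s t : SExp) : (SExp.cons s t).len = s.len + t.len + 1 := by
  simp [SExp.len, SExp.toBits]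
theorem SExp.len_pos (x : SExp) : 0 < x.len := by cases x <;> simp

open Turing.TM2.Stmt in
/-- Moves one tree from stack 0 to stack `i`, in reversed order. Stack 3 holds one symbol for each
tree that remains to be read after the current one. -/
def Frag.take (i : Fin 4) : Frag :=
  .loop fun again exit =>
    pop 0 (fun _ o => o) <| pushVar i <| branch (fun v => v.getD false)
      (push 3 (fun _ => true) <| load (fun _ => none) <| goto fun _ => again)
      (pop 3 (fun _ o => o) <| branch Option.isSome
        (load (fun _ => none) <| goto fun _ => again) (goto fun _ => exit))

/-- While the first subtree is read, a symbol on stack 3 stands for the second one, so the induction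
needs an arbitrary counter `d`. At the end of a tree the loop is left if `d` is empty; otherwise one
symbol is consumed and reading goes on. One bit moves per step, hence `t.len` steps suffice. -/
theorem Frag.take_one_aux {Λ' : Type} {m : Λ' → MStmt Λ'} {e : Unit → Λ'} {x : Λ'}
    (hm : ∀ l, m (e l) = (Frag.take 1).code e x l) (t : SExp) (a b c d : List Bool) :
    Reach m ⟨some (e ()), none, stk (t.toBits ++ a) b c d⟩
      ⟨some (if d = [] then x else e ()), none, stk a (t.toBits.reverse ++ b) c d.tail⟩ t.len := by
  induction t generalizing a b d with
  | nil =>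
    refine Reach.single ?_
    rw [hm]
    cases d <;> simp [take, loop, pushVar, SExp.toBits]
  | cons s t ihs iht =>
    have h1 := ihs (t.toBits ++ a) (true :: b) (true :: d)
    have h2 := iht a (s.toBits.reverse ++ true :: b) d
    simp only [reduceCtorEq, if_false, List.tail_cons] at h1
    have h3 : Turing.TM2.stepAux (m (e ())) none (stk ((SExp.cons s t).toBits ++ a) b c d) =
        ⟨some (e ()), none, stk (s.toBits ++ (t.toBits ++ a)) (true :: b) c (true :: d)⟩ := by
      rw [hm]
      simp [take, loop, pushVar, SExp.toBits]
    simpa [SExp.toBits] using (Reach.head h3 (h1.trans h2)).mono (by simp)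

theorem Frag.take_two_aux {Λ' : Type} {m : Λ' → MStmt Λ'} {e : Unit → Λ'} {x : Λ'}
    (hm : ∀ l, m (e l) = (Frag.take 2).code e x l) (t : SExp) (a b c d : List Bool) :
    Reach m ⟨some (e ()), none, stk (t.toBits ++ a) b c d⟩
      ⟨some (if d = [] then x else e ()), none, stk a b (t.toBits.reverse ++ c) d.tail⟩ t.len := by
  induction t generalizing a c d with
  | nil =>
    refine Reach.single ?_
    rw [hm]
    cases d <;> simp [take, loop, pushVar, SExp.toBits]
  | cons s t ihs iht =>
    have h1 := ihs (t.toBits ++ a) (true :: c) (true :: d)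
    have h2 := iht a (s.toBits.reverse ++ true :: c) d
    simp only [reduceCtorEq, if_false, List.tail_cons] at h1
    have h3 : Turing.TM2.stepAux (m (e ())) none (stk ((SExp.cons s t).toBits ++ a) b c d) =
        ⟨some (e ()), none, stk (s.toBits ++ (t.toBits ++ a)) b (true :: c) (true :: d)⟩ := by
      rw [hm]
      simp [take, loop, pushVar, SExp.toBits]
    simpa [SExp.toBits] using (Reach.head h3 (h1.trans h2)).mono (by simp)

theorem Frag.take_one_runs (t : SExp) (a b c : List Bool) :
    (Frag.take 1).Runs (stk (t.toBits ++ a) b c []) (stk a (t.toBits.reverse ++ b) c []) t.len :=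
  fun _ m e _ hm => Frag.take_one_aux (m := m) (e := e) hm t a b c []

theorem Frag.take_two_runs (t : SExp) (a b c : List Bool) :
    (Frag.take 2).Runs (stk (t.toBits ++ a) b c []) (stk a b (t.toBits.reverse ++ c) []) t.len :=
  fun _ m e _ hm => Frag.take_two_aux (m := m) (e := e) hm t a b c []

/-- The stacks between two operations on trees. -/
def top (a : List Bool) : Stk := stk a [] [] []

/-! ### Copying, exchanging and deleting the topmost tree -/

def Frag.dup : Frag :=
  (((Frag.take 1).seq .oneToBoth).seq .twoToOne).seq .oneToZero

/-- Every transfer reverses a word, so each copy has to undergo an even number of transfers: two for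
the first copy, four for the second. -/
theorem Frag.dup_runs (t : SExp) (a : List Bool) :
    Frag.dup.Runs (top (t.toBits ++ a)) (top (t.toBits ++ (t.toBits ++ a))) (4 * t.len + 3) := by
  have h := (((Frag.take_one_runs t a [] []).seq (Frag.oneToBoth_runs _ _ _ _)).seq
    (Frag.twoToOne_runs _ _ _ _)).seq (Frag.oneToZero_runs _ _ _ _)
  simp only [List.append_nil, List.reverse_reverse] at h
  exact h.mono (by simp [SExp.len]; omega)

def Frag.swap : Frag :=
  (((Frag.take 1).seq (.take 2)).seq .oneToZero).seq .twoToZero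

theorem Frag.swap_runs (s t : SExp) (a : List Bool) :
    Frag.swap.Runs (top (s.toBits ++ (t.toBits ++ a))) (top (t.toBits ++ (s.toBits ++ a)))
      (2 * s.len + 2 * t.len + 2) := by
  have h := (((Frag.take_one_runs s (t.toBits ++ a) [] []).seq (Frag.take_two_runs t _ _ _)).seq
    (Frag.oneToZero_runs _ _ _ _)).seq (Frag.twoToZero_runs _ _ _ _)
  simp only [List.append_nil, List.reverse_reverse] at h
  exact h.mono (by simp [SExp.len]; omega)

def Frag.drop : Frag := (Frag.take 1).seq .clearOne

theorem Frag.drop_runs (t : SExp) (a : List Bool) :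
    Frag.drop.Runs (top (t.toBits ++ a)) (top a) (2 * t.len + 1) :=
  ((Frag.take_one_runs t a [] []).seq (Frag.clearOne_runs _ _ _ _)).mono (by simp [SExp.len]; omega)

open Turing.TM2.Stmt in
def Frag.pushBit (b : Bool) : Frag := .loop fun _ exit => push 0 (fun _ => b) <| goto fun _ => exit

theorem Frag.pushBit_runs (b : Bool) (a : List Bool) :
    (Frag.pushBit b).Runs (top a) (top (b :: a)) 1 := fun Λ' m e x hm => by
  refine Reach.single ?_
  rw [hm]
  simp [Frag.pushBit, loop, top]

open Turing.TM2.Stmt in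
def Frag.popBit : Frag := .loop fun _ exit => pop 0 (fun _ _ => none) <| goto fun _ => exit

theorem Frag.popBit_runs (b : Bool) (a : List Bool) :
    Frag.popBit.Runs (top (b :: a)) (top a) 1 := fun Λ' m e x hm => by
  refine Reach.single ?_
  rw [hm]
  simp [Frag.popBit, loop, top]

def Frag.skip : Frag := .loop fun _ exit => Turing.TM2.Stmt.goto fun _ => exit

theorem Frag.skip_runs (s : Stk) : Frag.skip.Runs s s 1 := fun Λ' m e x hm => by
  refine Reach.single ?_
  rw [hm]
  simp [skip, loop]

/-! ### Branching, loops and the closed machine -/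

open Turing.TM2.Stmt in
/-- Runs `M` if the topmost bit is true, and `N` otherwise. -/
def Frag.ite (M N : Frag) : Frag :=
  have := M.fin
  have := N.fin
  { Λ := Option (M.Λ ⊕ N.Λ)
    start := none
    code := fun e x l => match l with
      | none => peek 0 (fun _ o => o) <| branch (fun v => v.getD false)
          (load (fun _ => none) <| goto fun _ => e (some (.inl M.start)))
          (load (fun _ => none) <| goto fun _ => e (some (.inr N.start)))
      | some (.inl l) => M.code (fun l => e (some (.inl l))) x l
      | some (.inr l) => N.code (fun l => e (some (.inr l))) x l }

theorem Frag.ite_runs_true {M N : Frag} {a : List Bool} {s : Stk} {t : ℕ}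
    (h : M.Runs (top (true :: a)) s t) : (M.ite N).Runs (top (true :: a)) s (t + 1) :=
  fun Λ' m e x hm => by
    refine Reach.head ?_ (h Λ' m (fun l => e (some (.inl l))) x fun l => hm (some (.inl l)))
    rw [hm]
    simp [Frag.ite, top]

theorem Frag.ite_runs_false {M N : Frag} {a : List Bool} {s : Stk} {t : ℕ}
    (h : N.Runs (top (false :: a)) s t) : (M.ite N).Runs (top (false :: a)) s (t + 1) :=
  fun Λ' m e x hm => by
    refine Reach.head ?_ (h Λ' m (fun l => e (some (.inr l))) x fun l => hm (some (.inr l)))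
    rw [hm]
    simp [Frag.ite, top]

open Turing.TM2.Stmt in
/-- Runs `M` as long as the topmost bit is true. This bit is removed in every round, and so is the
final bit. -/
def Frag.repeat (M : Frag) : Frag :=
  have := M.fin
  { Λ := Option M.Λ
    start := none
    code := fun e x l => match l with
      | none => pop 0 (fun _ o => o) <| branch (fun v => v.getD false)
          (load (fun _ => none) <| goto fun _ => e (some M.start))
          (load (fun _ => none) <| goto fun _ => x)
      | some l => M.code (fun l => e (some l)) (e none) l }

theorem Frag.repeat_runs_true {M : Frag} {a b : List Bool} {s : Stk} {t u : ℕ}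
    (h : M.Runs (top a) (top b) t) (h' : M.repeat.Runs (top b) s u) :
    M.repeat.Runs (top (true :: a)) s (t + u + 1) := fun Λ' m e x hm => by
  refine Reach.head ?_ ((h Λ' m (fun l => e (some l)) (e none) fun l => hm (some l)).trans
    (h' Λ' m e x hm))
  rw [hm]
  simp [Frag.repeat, top]

theorem Frag.repeat_runs_false {M : Frag} {a : List Bool} :
    M.repeat.Runs (top (false :: a)) (top a) 1 := fun Λ' m e x hm => by
  refine Reach.single ?_
  rw [hm]
  simp [Frag.repeat, top]

open Turing.TM2.Stmt in
/-- The closed machine. -/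
def Frag.machine (M : Frag) : Turing.TM2ComputableAux Bool Bool :=
  have := M.fin
  { tm :=
      { K := Fin 4
        k₀ := 0
        k₁ := 0
        Γ := fun _ => Bool
        Λ := Option M.Λ
        main := some M.start
        σ := Option Bool
        initialState := none
        m := fun l => match l with
          | none => halt
          | some l => M.code some none l }
    inputAlphabet := Equiv.refl Bool
    outputAlphabet := Equiv.refl Bool }

/-- The exit of the fragment is a halting label, which accounts for the additional step. -/
theorem Frag.machine_outputs {M : Frag} {x y : List Bool} {t : ℕ} (h : M.Runs (top x) (top y) t) :
    OutputsWithin M.machine x y (t + 1) := by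
  obtain ⟨n, hn, e⟩ := (h (Option M.Λ) (fun l => match l with
    | none => Turing.TM2.Stmt.halt
    | some l => M.code some none l) some none fun _ => rfl).trans
      (Reach.single (c := ⟨none, none, top y⟩) rfl)
  refine ⟨⟨⟨n, ?_⟩, hn⟩⟩
  have e1 : ∀ z : List Bool,
      (fun k : Fin 4 => if h : k = 0 then z else []) = top z := by
    intro z; ext k; fin_cases k <;> rfl
  have hx : Turing.initList M.machine.tm (x.map M.machine.inputAlphabet.invFun) =
      (⟨some (some M.start), none, top x⟩ : MCfg (Option M.Λ)) := by
    rw [← e1 x]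
    have : x.map M.machine.inputAlphabet.invFun = x := List.map_id x
    rw [this]
    rfl
  have hy : Turing.haltList M.machine.tm (y.map M.machine.outputAlphabet.invFun) =
      (⟨none, none, top y⟩ : MCfg (Option M.Λ)) := by
    rw [← e1 y]
    have : y.map M.machine.outputAlphabet.invFun = y := List.map_id y
    rw [this]
    rfl
  rw [hx]
  refine e.trans ?_
  rw [← hy]
  rfl

end HOGame

namespace HOGame

/-! ### Polynomial bounds -/

/-- `T` is bounded by a polynomial in `Z`. -/
def PB {α : Type} (Z T : α → ℕ) : Prop := ∃ c, ∀ a, T a ≤ (Z a + 2) ^ c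

namespace PB

variable {α β : Type} {Z Z' T U : α → ℕ}

theorem mono (h : PB Z T) (hU : ∀ a, U a ≤ T a) : PB Z U :=
  h.imp fun _ hc a => (hU a).trans (hc a)

theorem of_le (h : ∀ a, T a ≤ Z a) : PB Z T := ⟨1, fun a => by have := h a; simp; omega⟩

theorem add (h : PB Z T) (h' : PB Z U) : PB Z fun a => T a + U a := by
  obtain ⟨c, hc⟩ := h
  obtain ⟨d, hd⟩ := h'
  refine ⟨c + d + 1, fun a => ?_⟩
  have h1 : (Z a + 2) ^ c ≤ (Z a + 2) ^ (c + d) := Nat.pow_le_pow_right (by omega) (by omega)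
  have h2 : (Z a + 2) ^ d ≤ (Z a + 2) ^ (c + d) := Nat.pow_le_pow_right (by omega) (by omega)
  have := hc a
  have := hd a
  rw [pow_succ]
  nlinarith

theorem mul (h : PB Z T) (h' : PB Z U) : PB Z fun a => T a * U a := by
  obtain ⟨c, hc⟩ := h
  obtain ⟨d, hd⟩ := h'
  exact ⟨c + d, fun a => by rw [pow_add]; exact Nat.mul_le_mul (hc a) (hd a)⟩

theorem pow (h : PB Z T) (n : ℕ) : PB Z fun a => T a ^ n := by
  obtain ⟨c, hc⟩ := h
  exact ⟨c * n, fun a => by rw [pow_mul]; exact Nat.pow_le_pow_left (hc a) n⟩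

theorem const (n : ℕ) : PB Z fun _ => n :=
  -- The base `Z a + 2` is at least two, so every constant is absorbed by a power of it.
  ⟨n, fun a => (Nat.lt_two_pow_self (n := n)).le.trans (Nat.pow_le_pow_left (by omega) n)⟩

theorem trans (h : PB Z' T) (h' : PB Z Z') : PB Z T := by
  obtain ⟨c, hc⟩ := h
  exact ((h'.add (const 2)).pow c).mono hc

theorem comp (h : PB Z T) (f : β → α) : PB (fun b => Z (f b)) fun b => T (f b) :=
  h.imp fun _ hc b => hc (f b)

end PB

/-! ### Functions computed by fragments -/

/-- A representation of data by trees. -/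
class Enc (α : Type) where
  enc : α → SExp

open _root_.HOGame.Enc (enc)

section Enc
variable {α β : Type} [Enc α] [Enc β]

instance : Enc SExp := ⟨id⟩
instance : Enc Bool := ⟨SExp.ofBool⟩
instance : Enc (α × β) := ⟨fun p => .cons (enc p.1) (enc p.2)⟩
instance : Enc (List α) := ⟨fun l => SExp.ofList (l.map enc)⟩
instance : Enc (α ⊕ β) := ⟨Sum.elim (fun a => .cons (.cons .nil .nil) (enc a))
  fun b => .cons .nil (enc b)⟩
instance {p : α → Prop} : Enc {a // p a} := ⟨fun a => enc a.1⟩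

theorem enc_sexp (x : SExp) : enc x = x := rfl
theorem enc_true : enc true = .cons .nil .nil := rfl
theorem enc_false : enc false = .nil := rfl
theorem enc_pair (p : α × β) : enc p = .cons (enc p.1) (enc p.2) := rfl
theorem enc_nil : enc ([] : List α) = .nil := rfl
theorem enc_cons (a : α) (l : List α) : enc (a :: l) = .cons (enc a) (enc l) := rfl
theorem enc_inl (a : α) : enc (Sum.inl a : α ⊕ β) = .cons (.cons .nil .nil) (enc a) := rfl
theorem enc_inr (b : β) : enc (Sum.inr b : α ⊕ β) = .cons .nil (enc b) := rfl
theorem enc_subtype {p : α → Prop} (a : {a // p a}) : enc a = enc a.1 := rfl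

/-- The size of a representation. -/
def esz (a : α) : ℕ := (enc a).len

theorem esz_pos (a : α) : 0 < esz a := SExp.len_pos _
@[simp] theorem esz_sexp (x : SExp) : esz x = x.len := rfl
@[simp] theorem esz_pair (a : α) (b : β) : esz (a, b) = esz a + esz b + 1 := by
  simp [esz, enc_pair]
theorem esz_prod (p : α × β) : esz p = esz p.1 + esz p.2 + 1 := esz_pair _ _
@[simp] theorem esz_nil : esz ([] : List α) = 1 := rfl
@[simp] theorem esz_cons (a : α) (l : List α) : esz (a :: l) = esz a + esz l + 1 := by
  simp [esz, enc_cons]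
@[simp] theorem esz_inl (a : α) : esz (Sum.inl a : α ⊕ β) = esz a + 4 := by
  simp [esz, enc_inl]; omega
@[simp] theorem esz_inr (b : β) : esz (Sum.inr b : α ⊕ β) = esz b + 2 := by
  simp [esz, enc_inr]; omega
@[simp] theorem esz_subtype {p : α → Prop} (a : {a // p a}) : esz a = esz a.1 := rfl
theorem esz_bool_le (b : Bool) : esz b ≤ 3 := by cases b <;> decide

/-- The stack contents for a value. -/
def bits (a : α) : List Bool := (enc a).toBits

end Enc

/-- `f` is computable in time polynomial in the scale `S a` and the size of `a`. -/
def TC {α β : Type} [Enc α] [Enc β] (f : α → β) (S : α → ℕ) : Prop :=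
  ∃ (M : Frag) (T : α → ℕ), (∀ a r, M.Runs (top (bits a ++ r)) (top (bits (f a) ++ r)) (T a)) ∧
    PB (fun a => S a + esz a) T ∧ PB (fun a => S a + esz a) fun a => esz (f a)

/-- `f` is computable in polynomial time. -/
@[fun_prop]
def PT {α β : Type} [Enc α] [Enc β] (f : α → β) : Prop := TC f fun _ => 0

section TC
variable {α β γ δ ε : Type} [Enc α] [Enc β] [Enc γ] [Enc δ] [Enc ε]

theorem TC.mono {f : α → β} {S S' : α → ℕ} (h : TC f S)
    (hS : PB (fun a => S' a + esz a) S) : TC f S' := by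
  obtain ⟨M, T, hM, hT, ho⟩ := h
  have := hS.add (PB.of_le (T := fun a => esz a) fun a => by omega)
  exact ⟨M, T, hM, hT.trans this, ho.trans this⟩

theorem TC.of_le {f : α → β} {S S' : α → ℕ} (h : TC f S) (hS : ∀ a, S a ≤ S' a) : TC f S' :=
  h.mono (PB.of_le fun a => (hS a).trans (by omega))

theorem TC.congr {f g : α → β} {S : α → ℕ} (h : TC f S) (hfg : ∀ a, f a = g a) : TC g S :=
  funext hfg ▸ h

theorem PT.congr {f g : α → β} (h : PT f) (hfg : ∀ a, f a = g a) : PT g := TC.congr h hfg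

theorem PT.tc {f : α → β} (h : PT f) (S : α → ℕ) : TC f S := TC.of_le h fun _ => Nat.zero_le _

theorem TC.pt {f : α → β} {S : α → ℕ} (h : TC f S) (hS : PB esz S) : PT f :=
  h.mono (by simpa using hS)

theorem TC.size {f : α → β} {S : α → ℕ} (h : TC f S) :
    PB (fun a => S a + esz a) fun a => esz (f a) := h.choose_spec.choose_spec.2.2

theorem PT.size {f : α → β} (h : PT f) : PB esz fun a => esz (f a) := by
  simpa using TC.size h

theorem TC.comp {g : β → γ} {S' : β → ℕ} (hg : TC g S') {f : α → β} {S : α → ℕ} (hf : TC f S) :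
    TC (fun a => g (f a)) fun a => S a + S' (f a) := by
  obtain ⟨M, T, hM, hT, ho⟩ := hf
  obtain ⟨N, U, hN, hU, ho'⟩ := hg
  have e1 : PB (fun a => S a + S' (f a) + esz a) (fun a => S a + esz a) :=
    .of_le fun a => by omega
  have e2 : PB (fun a => S a + S' (f a) + esz a) (fun a => S' (f a) + esz (f a)) :=
    (PB.of_le fun a => by omega).add (ho.trans e1)
  exact ⟨M.seq N, fun a => T a + U (f a), fun a r => (hM a r).seq (hN (f a) r),
    (hT.trans e1).add ((hU.comp f).trans e2), (ho'.comp f).trans e2⟩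

@[fun_prop]
theorem PT.comp {g : β → γ} {f : α → β} (hg : PT g) (hf : PT f) : PT fun a => g (f a) :=
  TC.comp hg hf

/-- A mere change of view leaves the stack as it is. This covers structures seen as tuples, lists
seen as trees, and subtypes. -/
theorem PT.of_enc_eq {f : α → β} (h : ∀ a, enc (f a) = enc a) : PT f :=
  ⟨.skip, fun _ => 1, fun a r => by
    rw [show bits (f a) = bits a from congrArg SExp.toBits (h a)]; exact Frag.skip_runs _,
    PB.const 1, PB.of_le fun a => by simp [esz, h a]⟩

@[fun_prop]
theorem PT.id : PT fun a : α => a := PT.of_enc_eq fun _ => rfl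

/-- Pushes the bits of a fixed word. -/
def Frag.pushAll : List Bool → Frag
  | [] => .skip
  | b :: l => (Frag.pushAll l).seq (.pushBit b)

theorem Frag.pushAll_runs (l a : List Bool) :
    (Frag.pushAll l).Runs (top a) (top (l ++ a)) (l.length + 1) := by
  induction l with
  | nil => exact Frag.skip_runs _
  | cons b l ih => exact ih.seq (Frag.pushBit_runs b _)

@[fun_prop]
theorem PT.const (b : β) : PT fun _ : α => b := by
  refine ⟨Frag.drop.seq (.pushAll (bits b)), fun a => 2 * esz a + 1 + (esz b + 1),
    fun a r => (Frag.drop_runs _ _).seq (Frag.pushAll_runs _ _), ?_, PB.const _⟩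
  exact (((PB.const 2).mul (.of_le fun a => by simp)).add (.const 1)).add (.const _)

/-- `g` runs on a copy, its result is moved below the original, and `f` then consumes the original;
a final bit joins the two results. -/
theorem TC.pair {f : α → β} {g : α → γ} {S S' : α → ℕ} (hf : TC f S) (hg : TC g S') :
    TC (fun a => (f a, g a)) fun a => S a + S' a := by
  obtain ⟨M, T, hM, hT, ho⟩ := hf
  obtain ⟨N, U, hN, hU, ho'⟩ := hg
  have e1 : PB (fun a => S a + S' a + esz a) (fun a => S a + esz a) :=
    .of_le fun a => by omega
  have e2 : PB (fun a => S a + S' a + esz a) (fun a => S' a + esz a) :=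
    .of_le fun a => by omega
  refine ⟨(((Frag.dup.seq N).seq .swap).seq M).seq (.pushBit true),
    fun a => 4 * esz a + 3 + U a + (2 * esz (g a) + 2 * esz a + 2) + T a + 1, fun a r => ?_,
    ?_, ?_⟩
  · have := ((((Frag.dup_runs (enc a) r).seq (hN a _)).seq (Frag.swap_runs _ (enc a) r)).seq
      (hM a _)).seq (Frag.pushBit_runs true _)
    simpa [bits, esz, enc_pair, SExp.toBits] using this
  · have h1 : PB (fun a => S a + S' a + esz a) (fun a => esz a) := .of_le fun a => by omega
    exact ((((((PB.const 4).mul h1).add (.const 3)).add (hU.trans e2)).add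
      ((((PB.const 2).mul (ho'.trans e2)).add ((PB.const 2).mul h1)).add (.const 2))).add
      (hT.trans e1)).add (.const 1)
  · simpa using ((ho.trans e1).add (ho'.trans e2)).add (.const 1)

@[fun_prop]
theorem PT.pair {f : α → β} {g : α → γ} (hf : PT f) (hg : PT g) : PT fun a => (f a, g a) :=
  TC.pair hf hg

@[fun_prop]
theorem PT.fst : PT (Prod.fst : α × β → α) := by
  refine ⟨((Frag.popBit.seq .swap).seq .drop),
    fun p => 1 + (2 * esz p.1 + 2 * esz p.2 + 2) + (2 * esz p.2 + 1), fun p r => ?_, ?_, ?_⟩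
  · have := ((Frag.popBit_runs true ((enc p.1).toBits ++ ((enc p.2).toBits ++ r))).seq
      (Frag.swap_runs _ _ r)).seq (Frag.drop_runs (enc p.2) ((enc p.1).toBits ++ r))
    simpa [bits, esz, enc_pair, SExp.toBits] using this
  · exact PB.mono (T := fun p => 4 * (0 + esz p) + 4)
      (((PB.const 4).mul (.of_le fun a => le_rfl)).add (.const 4))
      fun p => by rw [esz_prod]; omega
  · exact .of_le fun p => by rw [esz_prod]; omega

@[fun_prop]
theorem PT.snd : PT (Prod.snd : α × β → β) := by
  refine ⟨Frag.popBit.seq .drop, fun p => 1 + (2 * esz p.1 + 1), fun p r => ?_, ?_, ?_⟩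
  · have := (Frag.popBit_runs true ((enc p.1).toBits ++ ((enc p.2).toBits ++ r))).seq
      (Frag.drop_runs (enc p.1) ((enc p.2).toBits ++ r))
    simpa [bits, esz, enc_pair, SExp.toBits] using this
  · exact PB.mono (T := fun p => 4 * (0 + esz p) + 4)
      (((PB.const 4).mul (.of_le fun a => le_rfl)).add (.const 4))
      fun p => by rw [esz_prod]; omega
  · exact .of_le fun p => by rw [esz_prod]; omega

/-- The key is computed from a copy of the argument. The code of `nil` is the single bit false and
all other codes start with true, so the topmost bit decides. The branches are programs on subtypes,
and each is charged only for the arguments on which it runs; recursion with very different costs in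
its cases depends on this. -/
theorem TC.branch {k : α → SExp} {Sk : α → ℕ} (hk : TC k Sk) {f : α → β} {S₁ S₂ : α → ℕ}
    (h₁ : TC (fun a : {a // k a = .nil} => f a) fun a => S₁ a)
    (h₂ : TC (fun a : {a // k a ≠ .nil} => f a) fun a => S₂ a) :
    TC f fun a => open Classical in Sk a + if k a = .nil then S₁ a else S₂ a := by
  classical
  obtain ⟨K, T, hK, hT, ho⟩ := hk
  obtain ⟨M, T₁, hM, ⟨c₁, hT₁⟩, ⟨d₁, ho₁⟩⟩ := h₁
  obtain ⟨N, T₂, hN, ⟨c₂, hT₂⟩, ⟨d₂, ho₂⟩⟩ := h₂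
  set S : α → ℕ := fun a => Sk a + if k a = .nil then S₁ a else S₂ a with hS
  have e1 : PB (fun a => S a + esz a) (fun a => Sk a + esz a) :=
    .of_le fun a => by simp only [hS]; omega
  have e2 : ∀ c, PB (fun a => S a + esz a) fun a => (S a + esz a + 2) ^ c := fun c =>
    ⟨c, fun a => le_rfl⟩
  refine ⟨(Frag.dup.seq K).seq ((Frag.drop.seq N).ite (Frag.drop.seq M)),
    fun a => 4 * esz a + 3 + T a + ((2 * esz (k a) + 1) +
      ((S a + esz a + 2) ^ c₁ + (S a + esz a + 2) ^ c₂) + 1), fun a r => ?_, ?_, ?_⟩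
  · refine ((Frag.dup_runs (enc a) r).seq (hK a _)).seq ?_
    by_cases h : k a = .nil
    · have h1 := (Frag.drop_runs (k a) ((enc a).toBits ++ r)).seq (hM ⟨a, h⟩ r)
      have h2 := hT₁ ⟨a, h⟩
      have h3 : (S₁ a + esz a + 2) ^ c₁ ≤ (S a + esz a + 2) ^ c₁ := by
        simp only [hS, if_pos h]; gcongr; omega
      simp only [esz_subtype] at h2
      have e3 : bits (k a) ++ ((enc a).toBits ++ r) = false :: ((enc a).toBits ++ r) := by
        rw [h]; rfl
      have e4 : (k a).toBits ++ ((enc a).toBits ++ r) = false :: ((enc a).toBits ++ r) := e3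
      rw [e4] at h1
      rw [e3]
      exact (Frag.ite_runs_false h1).mono (by rw [esz_sexp]; omega)
    · have h1 := (Frag.drop_runs (k a) ((enc a).toBits ++ r)).seq (hN ⟨a, h⟩ r)
      have h2 := hT₂ ⟨a, h⟩
      have h3 : (S₂ a + esz a + 2) ^ c₂ ≤ (S a + esz a + 2) ^ c₂ := by
        simp only [hS, if_neg h]; gcongr; omega
      simp only [esz_subtype] at h2
      obtain ⟨z, e3⟩ : ∃ z, bits (k a) ++ ((enc a).toBits ++ r) = true :: z := by
        cases hx : k a with
        | nil => exact absurd hx h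
        | cons x y => exact ⟨_, rfl⟩
      have e4 : (k a).toBits ++ ((enc a).toBits ++ r) = true :: z := e3
      rw [e4] at h1
      rw [e3]
      exact (Frag.ite_runs_true h1).mono (by rw [esz_sexp]; omega)
  · have h1 : PB (fun a => S a + esz a) (fun a => esz a) := .of_le fun a => by omega
    exact ((((PB.const 4).mul h1).add (.const 3)).add (hT.trans e1)).add
      (((((PB.const 2).mul (ho.trans e1)).add (.const 1)).add ((e2 _).add (e2 _))).add (.const 1))
  · refine ((e2 d₁).add (e2 d₂)).mono fun a => ?_
    by_cases h : k a = .nil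
    · have h2 := ho₁ ⟨a, h⟩
      have h3 : (S₁ a + esz a + 2) ^ d₁ ≤ (S a + esz a + 2) ^ d₁ := by
        simp only [hS, if_pos h]; gcongr; omega
      simp only [esz_subtype] at h2
      omega
    · have h2 := ho₂ ⟨a, h⟩
      have h3 : (S₂ a + esz a + 2) ^ d₂ ≤ (S a + esz a + 2) ^ d₂ := by
        simp only [hS, if_neg h]; gcongr; omega
      simp only [esz_subtype] at h2
      omega

theorem PT.val {p : α → Prop} : PT fun a : {a // p a} => a.1 := PT.of_enc_eq fun _ => rfl

theorem TC.restrict {f : α → β} {S : α → ℕ} (h : TC f S) (p : α → Prop) :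
    TC (fun a : {a // p a} => f a.1) fun a => S a.1 :=
  (h.comp PT.val).of_le fun _ => by simp

theorem TC.cond {b : α → Bool} {f g : α → β} {Sb Sf Sg : α → ℕ} (hb : TC b Sb) (hf : TC f Sf)
    (hg : TC g Sg) :
    TC (fun a => bif b a then f a else g a) fun a => Sb a + bif b a then Sf a else Sg a := by
  classical
  have hk : TC (fun a => enc (b a)) Sb :=
    ((PT.of_enc_eq (f := fun b : Bool => enc b) fun _ => rfl).tc (fun _ => 0)).comp hb
  have hn : ∀ a, enc (b a) = .nil ↔ b a = false := fun a => by
    cases b a <;> simp [enc_true, enc_false]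
  refine (TC.branch (f := fun a => bif b a then f a else g a) (S₁ := Sg) (S₂ := Sf) hk ?_ ?_).of_le
    fun a => ?_
  · convert hg.restrict (fun a => enc (b a) = .nil) with a
    rw [(hn _).1 a.2]; rfl
  · convert hf.restrict (fun a => enc (b a) ≠ .nil) with a
    have := mt (hn a.1).2 a.2
    rw [Bool.not_eq_false] at this
    rw [this]; rfl
  · cases h : b a <;> simp [enc_true, enc_false]

@[fun_prop]
theorem PT.cond {b : α → Bool} {f g : α → β} (hb : PT b) (hf : PT f) (hg : PT g) :
    PT fun a => bif b a then f a else g a :=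
  (TC.cond hb hf hg).of_le fun a => by cases b a <;> simp

/-- A non-empty list and the pair of its head and tail have the same code, so nothing has to be
rearranged before `h` is run. -/
theorem TC.list_case {l : α → List γ} {g : α → β} {h : α × γ × List γ → β} {Sl Sg : α → ℕ}
    {Sh : α × γ × List γ → ℕ} (hl : TC l Sl) (hg : TC g Sg) (hh : TC h Sh) :
    TC (fun a => match l a with | [] => g a | x :: xs => h (a, x, xs))
      fun a => Sl a + match l a with | [] => Sg a | x :: xs => Sh (a, x, xs) := by
  classical
  set F : α × List γ → β := fun p => match p.2 with | [] => g p.1 | x :: xs => h (p.1, x, xs)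
  set SF : α × List γ → ℕ := fun p => match p.2 with | [] => Sg p.1 | x :: xs => Sh (p.1, x, xs)
  have key : TC F SF := by
    have hk : PT fun p : α × List γ => enc p.2 :=
      PT.comp (g := fun l : List γ => enc l) (PT.of_enc_eq fun _ => rfl) PT.snd
    have hn : ∀ l : List γ, enc l = .nil ↔ l = [] := fun l => by
      cases l <;> simp [enc_cons, enc_nil]
    refine (TC.branch hk (S₁ := SF) (S₂ := SF) ?_ ?_).of_le fun a => ?_
    · have := hg.comp ((PT.fst (α := α) (β := List γ)).comp
        (PT.val (p := fun p : α × List γ => enc p.2 = .nil)))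
      refine TC.of_le (S := fun p => SF p.1) ?_ fun _ => le_rfl
      convert this using 1
      · funext ⟨⟨a, l⟩, hp⟩
        obtain rfl := (hn l).1 hp
        rfl
      · funext ⟨⟨a, l⟩, hp⟩
        obtain rfl := (hn l).1 hp
        simp [SF]
    · have hr : PT fun p : {p : α × List γ // enc p.2 ≠ .nil} =>
          (p.1.1, p.1.2.head fun h => p.2 ((hn _).2 h), p.1.2.tail) := by
        refine PT.of_enc_eq ?_
        rintro ⟨⟨a, _ | ⟨x, xs⟩⟩, hp⟩
        · exact absurd rfl hp
        · rfl
      have := hh.comp hr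
      refine TC.of_le (S := fun p => SF p.1) ?_ fun _ => le_rfl
      convert this using 1
      · funext ⟨⟨a, l⟩, hp⟩
        cases l with
        | nil => exact absurd rfl hp
        | cons x xs => rfl
      · funext ⟨⟨a, l⟩, hp⟩
        cases l with
        | nil => exact absurd rfl hp
        | cons x xs => simp [SF]
    · split <;> simp
  exact (key.comp (TC.pair PT.id hl)).of_le fun a => by simp [SF]

theorem PT.list_case {l : α → List γ} {g : α → β} {h : α × γ × List γ → β} (hl : PT l)
    (hg : PT g) (hh : PT h) : PT fun a => match l a with | [] => g a | x :: xs => h (a, x, xs) :=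
  (TC.list_case hl hg hh).of_le fun a => by split <;> simp

@[fun_prop]
theorem PT.list_cons {f : α → β} {g : α → List β} (hf : PT f) (hg : PT g) :
    PT fun a => f a :: g a :=
  PT.comp (g := fun p : β × List β => p.1 :: p.2) (PT.of_enc_eq fun _ => rfl) (hf.pair hg)

theorem PT.inl : PT (Sum.inl : α → α ⊕ β) :=
  PT.comp (g := fun p : SExp × α => (Sum.inl p.2 : α ⊕ β))
    (f := fun a => (SExp.cons .nil .nil, a))
    ⟨.seq (.seq .popBit .drop) (.pushAll [true, true, false, false]),
      fun p => 1 + (2 * esz p.1 + 1) + 5, fun p r => by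
        have := ((Frag.popBit_runs true (p.1.toBits ++ (bits p.2 ++ r))).seq
          (Frag.drop_runs p.1 (bits p.2 ++ r))).seq
          (Frag.pushAll_runs [true, true, false, false] _)
        simpa [bits, enc_sexp, enc_pair, enc_inl, SExp.toBits] using this,
      PB.mono (T := fun p => 4 * (0 + esz p) + 7)
        (((PB.const 4).mul (.of_le fun a => le_rfl)).add (.const 7))
        fun p => by rw [esz_prod]; omega,
      PB.mono (T := fun p => (0 + esz p) + 7) (PB.add (.of_le fun a => le_rfl) (.const 7))
        fun p => by rw [esz_prod]; simp; omega⟩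
    (PT.pair (PT.const _) PT.id)

theorem PT.inr : PT (Sum.inr : β → α ⊕ β) :=
  PT.comp (g := fun p : SExp × β => (Sum.inr p.2 : α ⊕ β)) (f := fun a => (SExp.nil, a))
    ⟨.seq (.seq .popBit .drop) (.pushAll [true, false]),
      fun p => 1 + (2 * esz p.1 + 1) + 3, fun p r => by
        have := ((Frag.popBit_runs true (p.1.toBits ++ (bits p.2 ++ r))).seq
          (Frag.drop_runs p.1 (bits p.2 ++ r))).seq
          (Frag.pushAll_runs [true, false] _)
        simpa [bits, enc_sexp, enc_pair, enc_inr, SExp.toBits] using this,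
      PB.mono (T := fun p => 4 * (0 + esz p) + 7)
        (((PB.const 4).mul (.of_le fun a => le_rfl)).add (.const 7))
        fun p => by rw [esz_prod]; omega,
      PB.mono (T := fun p => (0 + esz p) + 7) (PB.add (.of_le fun a => le_rfl) (.const 7))
        fun p => by rw [esz_prod]; simp; omega⟩
    (PT.pair (PT.const _) PT.id)

/-- Turns the code of a sum into a flag bit and the code of the summand. -/
def Frag.flag : Frag :=
  Frag.popBit.seq (.ite (((Frag.popBit.seq .popBit).seq .popBit).seq (.pushBit true)) .skip)

/-- The index `j` of the invariant is a potential that exists only in the analysis. It starts at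
most at `W a` and strictly decreases, so there are at most `W a + 1` rounds. As `W a` also bounds
the size and scale of every reachable state, each round is polynomial in `W a`. -/
theorem TC.loop {σ : Type} [Enc σ] {step : σ → σ ⊕ β} {Ss : σ → ℕ} (hstep : TC step Ss)
    {init : α → σ} {Si : α → ℕ} (hinit : TC init Si) {f : α → β} {W : α → ℕ}
    (inv : α → ℕ → σ → Prop) (h0 : ∀ a, ∃ j ≤ W a, inv a j (init a))
    (hl : ∀ a j s s', inv a j s → step s = .inl s' → ∃ j' < j, inv a j' s')
    (hr : ∀ a j s b, inv a j s → step s = .inr b → b = f a)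
    (hW : ∀ a j s, inv a j s → esz s + Ss s ≤ W a) : TC f fun a => Si a + W a := by
  obtain ⟨M, T, hM, ⟨c, hT⟩, ⟨d, ho⟩⟩ := hstep
  obtain ⟨N, U, hN, hU, hoN⟩ := hinit
  have hTW : ∀ a j s, inv a j s → T s ≤ (W a + 2) ^ c := fun a j s hs => (hT s).trans <|
     Nat.pow_le_pow_left (by have := hW a j s hs; dsimp only; omega) _
  have hoW : ∀ a j s, inv a j s → esz (step s) ≤ (W a + 2) ^ d := fun a j s hs =>
    (ho s).trans <| Nat.pow_le_pow_left (by have := hW a j s hs; dsimp only; omega) _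
  have round : ∀ a j s, inv a j s →
      (∀ s', step s = .inl s' → ∀ r, (M.seq .flag).Runs (top (bits s ++ r))
        (top (true :: (bits s' ++ r))) ((W a + 2) ^ c + 6)) ∧
      (∀ b, step s = .inr b → ∀ r, (M.seq .flag).Runs (top (bits s ++ r))
        (top (false :: (bits b ++ r))) ((W a + 2) ^ c + 6)) := by
    intro a j s hs
    have h1 := hTW a j s hs
    constructor
    · intro s' he r
      have h2 := (hM s r).mono h1
      rw [he] at h2
      refine (h2.seq (Frag.popBit_runs true (true :: false :: false :: (bits s' ++ r)) |>.seq
        (Frag.ite_runs_true ((((Frag.popBit_runs true (false :: false :: (bits s' ++ r))).seq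
          (Frag.popBit_runs false (false :: (bits s' ++ r)))).seq
          (Frag.popBit_runs false (bits s' ++ r))).seq
          (Frag.pushBit_runs true _))))).mono ?_
      omega
    · intro b he r
      have h2 := (hM s r).mono h1
      rw [he] at h2
      refine (h2.seq (Frag.popBit_runs true (false :: (bits b ++ r)) |>.seq
        (Frag.ite_runs_false (Frag.skip_runs _)))).mono ?_
      omega
  -- The constant 8 consists of at most 6 steps of `Frag.flag`, the test of the round, and the final
  -- test that ends the loop.
  have run : ∀ a j s, inv a j s → ∀ r, (M.seq .flag).repeat.Runs (top (true :: (bits s ++ r)))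
      (top (bits (f a) ++ r)) ((j + 1) * ((W a + 2) ^ c + 8)) := by
    intro a j
    induction j using Nat.strong_induction_on with
    | _ j ih =>
      intro s hs r
      obtain ⟨r1, r2⟩ := round a j s hs
      cases he : step s with
      | inl s' =>
        obtain ⟨j', hj, hs'⟩ := hl a j s s' hs he
        refine (Frag.repeat_runs_true (r1 s' he r) (ih j' hj s' hs' r)).mono ?_
        have : (j' + 1) * ((W a + 2) ^ c + 8) ≤ j * ((W a + 2) ^ c + 8) := by gcongr; omega
        rw [add_one_mul j]
        omega
      | inr b =>
        obtain rfl := hr a j s b hs he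
        refine (Frag.repeat_runs_true (r2 _ he r) Frag.repeat_runs_false).mono ?_
        rw [add_one_mul j]
        omega
  have out : ∀ a j s, inv a j s → esz (f a) ≤ (W a + 2) ^ d := by
    intro a j
    induction j using Nat.strong_induction_on with
    | _ j ih =>
      intro s hs
      cases he : step s with
      | inl s' =>
        obtain ⟨j', hj, hs'⟩ := hl a j s s' hs he
        exact ih j' hj s' hs'
      | inr b =>
        obtain rfl := hr a j s b hs he
        have := hoW a j s hs
        rw [he, esz_inr] at this
        omega
  have e1 : PB (fun a => Si a + W a + esz a) (fun a => Si a + esz a) :=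
    .of_le fun a => by omega
  have e2 : ∀ c, PB (fun a => Si a + W a + esz a) fun a => (W a + 2) ^ c := fun c =>
    PB.pow ((PB.of_le fun a => by omega).add (.const 2)) c
  have e3 : PB (fun a => Si a + W a + esz a) W := .of_le fun a => by omega
  refine ⟨(N.seq (.pushBit true)).seq (M.seq .flag).repeat,
    fun a => U a + 1 + (W a + 1) * ((W a + 2) ^ c + 8), fun a r => ?_, ?_, ?_⟩
  · obtain ⟨j, hj, hi⟩ := h0 a
    refine (((hN a r).seq (Frag.pushBit_runs true _)).seq
      (run a j (init a) hi r)).mono ?_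
    have := Nat.mul_le_mul_right ((W a + 2) ^ c + 8) (Nat.succ_le_succ hj)
    simp only [Nat.succ_eq_add_one] at this
    dsimp only
    omega
  · exact ((hU.trans e1).add (.const 1)).add ((e3.add (.const 1)).mul ((e2 c).add (.const 8)))
  · exact (e2 d).mono fun a => let ⟨j, _, hi⟩ := h0 a; out a j _ hi

end TC

end HOGame

namespace HOGame
open _root_.HOGame.Enc (enc)

/-! ### Recursion -/

section Hylo
variable {α β γ δ ε : Type} [Enc α] [Enc β] [Enc γ] [Enc δ] [Enc ε]

/-- A frame of a recursive computation: the argument of a call, the arguments of the recursive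
calls that are still to be made, and the results of the other ones in reversed order. -/
abbrev Frame (α β : Type) : Type := α × List α × List β

/-- One step of a recursive computation on the frame of the current call and the stack of the
frames of the suspended calls. -/
def hyloStep (ch : α → List α) (cb : α × List β → β) (s : Frame α β × List (Frame α β)) :
    (Frame α β × List (Frame α β)) ⊕ β :=
  match s.1.2.1 with
  | [] =>
    match s.2 with
    | [] => .inr (cb (s.1.1, s.1.2.2))
    | fr :: st => .inl ((fr.1, fr.2.1, cb (s.1.1, s.1.2.2) :: fr.2.2), st)
  | c :: cs => .inl ((c, ch c, []), (s.1.1, cs, s.1.2.2) :: s.2)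

def hyloScale (Sch : α → ℕ) (Scb : α × List β → ℕ) (s : Frame α β × List (Frame α β)) : ℕ :=
  match s.1.2.1 with
  | [] => Scb (s.1.1, s.1.2.2)
  | c :: _ => Sch c

/-- Case distinctions charge only the branch taken, so a step pays for `ch` when it opens a call and
for `cb` when it closes one. -/
theorem hyloStep_tc {ch : α → List α} {cb : α × List β → β} {Sch : α → ℕ} {Scb : α × List β → ℕ}
    (hch : TC ch Sch) (hcb : TC cb Scb) : TC (hyloStep ch cb) (hyloScale Sch Scb) := by
  have h1 : TC (fun s : Frame α β × List (Frame α β) => cb (s.1.1, s.1.2.2))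
      fun s => Scb (s.1.1, s.1.2.2) :=
    (hcb.comp (f := fun s : Frame α β × List (Frame α β) => (s.1.1, s.1.2.2))
      (S := fun _ => 0) (by change PT _; fun_prop)).of_le fun _ => by simp
  refine ((TC.list_case
    (l := fun s : Frame α β × List (Frame α β) => s.1.2.1) (Sl := fun _ => 0)
    (h := fun q => (.inl ((q.2.1, ch q.2.1, []), (q.1.1.1, q.2.2, q.1.1.2.2) :: q.1.2) :
      (Frame α β × List (Frame α β)) ⊕ β)) (Sh := fun q => Sch q.2.1)
    (by change PT _; fun_prop)
    (TC.list_case (l := fun s : Frame α β × List (Frame α β) => s.2)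
      (g := fun s => (.inr (cb (s.1.1, s.1.2.2)) :
      (Frame α β × List (Frame α β)) ⊕ β))
      (h := fun q => (.inl ((q.2.1.1, q.2.1.2.1, cb (q.1.1.1, q.1.1.2.2) :: q.2.1.2.2), q.2.2) :
      (Frame α β × List (Frame α β)) ⊕ β)) (Sl := fun _ => 0)
      (Sg := fun s => Scb (s.1.1, s.1.2.2)) (Sh := fun q => Scb (q.1.1.1, q.1.1.2.2))
      (by change PT _; fun_prop) ?_ ?_) ?_).congr ?_).of_le ?_
  · exact ((PT.inr.tc fun _ => 0).comp h1).of_le fun _ => by simp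
  · refine ((TC.comp (g := fun q : β × (Frame α β × List (Frame α β)) × Frame α β ×
        List (Frame α β) => (.inl ((q.2.2.1.1, q.2.2.1.2.1, q.1 :: q.2.2.1.2.2), q.2.2.2) :
      (Frame α β × List (Frame α β)) ⊕ β)) (S' := fun _ => 0)
      (PT.comp (g := Sum.inl) PT.inl (by fun_prop))
      (TC.pair (h1.comp (PT.fst.tc fun _ => 0)) (PT.id.tc fun _ => 0)))).of_le fun _ => ?_
    simp
  · refine ((TC.comp (g := fun q : List α × (Frame α β × List (Frame α β)) × α ×
        List α => (.inl ((q.2.2.1, q.1, []), (q.2.1.1.1, q.2.2.2, q.2.1.1.2.2) :: q.2.1.2) :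
      (Frame α β × List (Frame α β)) ⊕ β)) (S' := fun _ => 0)
      (PT.comp (g := Sum.inl) PT.inl (by fun_prop))
      (TC.pair (hch.comp ((PT.fst.comp PT.snd).tc fun _ => 0)) (PT.id.tc fun _ => 0)))).of_le
      fun _ => ?_
    simp
  · rintro ⟨⟨p, _ | ⟨c, cs⟩, rs⟩, _ | ⟨fr, st⟩⟩ <;> rfl
  · rintro ⟨⟨p, _ | ⟨c, cs⟩, rs⟩, _ | ⟨fr, st⟩⟩ <;> simp [hyloScale]

/-- `W` is a cost for the whole tree of calls below an argument: it covers the local sizes and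
scales and the costs of the immediate calls. A potential on the explicit call stack turns it into a
bound for the number of steps and for the size of the stack. -/
theorem TC.hylo_reverse {f : α → β} {ch : α → List α} {cb : α × List β → β} {Sch : α → ℕ}
    {Scb : α × List β → ℕ} (hch : TC ch Sch) (hcb : TC cb Scb) (W : α → ℕ)
    (hf : ∀ a, f a = cb (a, ((ch a).map f).reverse))
    (hW : ∀ a, 1 + esz a + esz (f a) + Sch a + Scb (a, ((ch a).map f).reverse) +
      ((ch a).map W).sum ≤ W a) : TC f W := by
  set w : α → ℕ := fun a =>
    1 + esz a + esz (f a) + Sch a + Scb (a, ((ch a).map f).reverse) with hw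
  have hw2 : ∀ a, 2 ≤ w a := fun a => by
    have := esz_pos a
    simp only [hw]; omega
  -- Opening a call at `c` exchanges `5 * W c` for `4 * w c` and the potential of its own calls,
  -- which together is at most `5 * W c - w c`. Closing a call at `p` frees at least `4 * w p` and
  -- adds a result that costs `1 + esz (f p) ≤ w p`. The potential drops in both cases.
  let pot : Frame α β → ℕ := fun fr =>
    4 * w fr.1 + 5 * (fr.2.1.map W).sum + (fr.2.2.map fun r => 1 + esz r).sum
  have szl : ∀ l : List α, esz l ≤ 1 + 2 * (l.map W).sum := by
    intro l
    induction l with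
    | nil => simp
    | cons a l ih =>
      have := hW a
      simp only [esz_cons, List.map_cons, List.sum_cons]
      omega
  have szr : ∀ l : List β, esz l = 1 + (l.map fun r => 1 + esz r).sum := by
    intro l
    induction l with
    | nil => simp
    | cons a l ih =>
      simp only [esz_cons, List.map_cons, List.sum_cons]
      omega
  have szf : ∀ fr : Frame α β, esz fr + 2 ≤ pot fr := by
    intro fr
    have h1 := szl fr.2.1
    have h2 := szr fr.2.2
    have h3 := hw2 fr.1
    have h4 : esz fr.1 + 1 ≤ w fr.1 := by simp only [hw]; omega
    rw [esz_prod, esz_prod, h2]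
    simp only [pot]
    omega
  have szs : ∀ st : List (Frame α β), esz st ≤ 1 + (st.map pot).sum := by
    intro st
    induction st with
    | nil => simp
    | cons fr st ih =>
      have := szf fr
      simp only [esz_cons, List.map_cons, List.sum_cons]
      omega
  -- `good` says that the completed calls form an initial segment with correct results. `susp` says
  -- that each suspended frame waits for the call just above it, and that the outermost call is the
  -- one at `a`.
  let good : Frame α β → Prop := fun fr =>
    ∃ l, ch fr.1 = l ++ fr.2.1 ∧ fr.2.2 = (l.map f).reverse
  let susp : α → α → List (Frame α β) → Prop := fun a q st =>
    List.rec (motive := fun _ => α → Prop) (fun q => q = a) (fun fr _ r q =>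
      (∃ l, ch fr.1 = l ++ q :: fr.2.1 ∧ fr.2.2 = (l.map f).reverse) ∧ r fr.1) st q
  refine (TC.loop (hyloStep_tc hch hcb) (init := fun a => ((a, ch a, []), [])) (Si := Sch)
    -- The potential never exceeds `5 * W a`, and it bounds both the size of the state and the scale
    -- of the next step.
    (W := fun a => 10 * W a) ?_
    (fun a j s => good s.1 ∧ susp a s.1.1 s.2 ∧ pot s.1 + (s.2.map pot).sum = j ∧ j ≤ 5 * W a)
    ?_ ?_ ?_ ?_).mono ?_
  · refine (TC.comp (g := fun q : List α × α =>
      ((⟨q.2, q.1, []⟩, []) : Frame α β × List (Frame α β))) (S' := fun _ => 0)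
      (by change PT _; fun_prop) (TC.pair hch (PT.id.tc fun _ => 0))).of_le fun a => by simp
  · intro a
    have := hW a
    have h1 : pot (a, ch a, []) ≤ 5 * W a := by
      simp only [pot, List.map_nil, List.sum_nil]
      simp only [hw]
      omega
    exact ⟨_, h1.trans (by omega), ⟨[], by simp, by simp⟩, rfl, by simp, by simpa using h1⟩
  · rintro a j ⟨⟨p, cs, rs⟩, st⟩ s' ⟨⟨l, hl, hr⟩, hs, hj, hj'⟩ he
    simp only at hl hr hs hj
    cases cs with
    | nil =>
      cases st with
      | nil => simp [hyloStep] at he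
      | cons fr st =>
        obtain ⟨p', cs', rs'⟩ := fr
        simp only [hyloStep, Sum.inl.injEq] at he
        subst he
        rw [List.append_nil] at hl
        have e1 : cb (p, rs) = f p := by rw [hf p, hl, hr]
        obtain ⟨⟨l', hl', hr'⟩, hs'⟩ := hs
        simp only at hl' hr' hs'
        have h2 : 1 + esz (f p) ≤ w p := by simp only [hw]; omega
        have h3 := hw2 p
        have h4 : pot (p', cs', f p :: rs') + (st.map pot).sum < j := by
          simp only [List.map_cons, List.sum_cons, pot] at hj ⊢
          omega
        rw [e1]
        exact ⟨_, h4, ⟨l' ++ [p], by simp [hl'], by simp [hr']⟩, hs', rfl, by omega⟩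
    | cons c cs =>
      simp only [hyloStep, Sum.inl.injEq] at he
      subst he
      have h2 := hW c
      have h3 := hw2 c
      have h4 : pot (c, ch c, []) + ((((p, cs, rs) :: st).map pot)).sum < j := by
        simp only [List.map_cons, List.sum_cons, pot, List.map_nil, List.sum_nil] at hj ⊢
        simp only [hw] at h3 hj ⊢
        omega
      exact ⟨_, h4, ⟨[], by simp, by simp⟩, ⟨⟨l, hl, hr⟩, hs⟩, rfl, by omega⟩
  · rintro a j ⟨⟨p, cs, rs⟩, st⟩ b ⟨⟨l, hl, hr⟩, hs, hj, hj'⟩ he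
    simp only at hl hr hs hj
    cases cs with
    | nil =>
      cases st with
      | nil =>
        simp only [hyloStep, Sum.inr.injEq] at he
        rw [List.append_nil] at hl
        obtain rfl : p = a := hs
        rw [← he, hf p, hl, hr]
      | cons fr st => simp [hyloStep] at he
    | cons c cs => simp [hyloStep] at he
  · rintro a j ⟨⟨p, cs, rs⟩, st⟩ ⟨⟨l, hl, hr⟩, hs, hj, hj'⟩
    simp only at hl hr hs hj
    have h1 := szf (p, cs, rs)
    have h2 := szs st
    have h3 : hyloScale Sch Scb ((p, cs, rs), st) ≤ pot (p, cs, rs) := by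
      cases cs with
      | nil =>
        simp only [List.append_nil] at hl
        simp only [hyloScale, pot]
        have : Scb (p, rs) ≤ w p := by
          simp only [hw]
          rw [hl, ← hr]
          omega
        omega
      | cons c cs =>
        have := hW c
        simp only [hyloScale, pot, List.map_cons, List.sum_cons]
        omega
    rw [esz_prod]
    simp only at hj ⊢
    omega
  · have h1 : PB (fun a => W a + esz a) W := .of_le fun a => by omega
    exact (PB.of_le fun a => by have := hW a; omega).add ((PB.const 10).mul h1)

/-- A fold is a recursion with one call on the tail, for which the reversed order of results is
irrelevant. `B` bounds the scales and the intermediate results, which are the folds over the tails;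
there is one level of recursion per member of the list. -/
theorem TC.foldr {b : ε → β} {h : ε × γ × β → β} {Sb : ε → ℕ} {Sh : ε × γ × β → ℕ}
    (hb : TC b Sb) (hh : TC h Sh) (B : List γ × ε → ℕ)
    (hB : ∀ x l e, B (l, e) ≤ B (x :: l, e))
    (hf : ∀ l e, esz (l.foldr (fun x r => h (e, x, r)) (b e)) ≤ B (l, e))
    (hSb : ∀ e, Sb e ≤ B ([], e))
    (hSh : ∀ x l e, Sh (e, x, l.foldr (fun x r => h (e, x, r)) (b e)) ≤ B (x :: l, e)) :
    TC (fun p : List γ × ε => p.1.foldr (fun x r => h (p.2, x, r)) (b p.2)) B := by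
  have hch : PT fun p : List γ × ε =>
      match p.1 with | [] => [] | _ :: xs => [(xs, p.2)] :=
    PT.list_case (h := fun q : (List γ × ε) × γ × List γ => [(q.2.2, q.1.2)])
      (by fun_prop) (by fun_prop) (by fun_prop)
  have hb' := hb.comp ((PT.snd (α := List γ) (β := ε)).comp
    (PT.fst (α := List γ × ε) (β := List β)))
  have hh' := hh.comp (f := fun q : (((List γ × ε) × List β) × γ × List γ) × β × List β =>
    (q.1.1.1.2, q.1.2.1, q.2.1)) (S := fun _ => 0) (by change PT _; fun_prop)
  have hcb := TC.list_case (l := fun q : (List γ × ε) × List β => q.1.1) (Sl := fun _ => 0)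
    (by change PT _; fun_prop) hb' (TC.list_case
      (l := fun q : ((List γ × ε) × List β) × γ × List γ => q.1.2) (Sl := fun _ => 0)
      (by change PT _; fun_prop) (hb'.comp (PT.fst.tc fun _ => 0)) hh')
  refine (TC.hylo_reverse hch hcb
    (fun p => (p.1.length + 1) * (1 + esz p + 2 * B p)) ?_ ?_).mono ?_
  · rintro ⟨_ | ⟨x, l⟩, e⟩ <;> rfl
  · rintro ⟨_ | ⟨x, l⟩, e⟩
    · have h1 := hf [] e
      have h2 := hSb e
      simp only [List.foldr_nil] at h1
      simp
      omega
    · have h1 := hf (x :: l) e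
      have h2 := hSh x l e
      have h3 := hB x l e
      have h4 : (l.length + 1) * (1 + esz (l, e) + 2 * B (l, e)) ≤
          (l.length + 1) * (1 + esz (x :: l, e) + 2 * B (x :: l, e)) := by
        gcongr
        simp
        omega
      simp only [List.foldr_cons] at h1
      simp only [List.map_cons, List.map_nil, List.sum_cons, List.sum_nil, List.length_cons,
        List.foldr_cons, List.reverse_singleton, zero_add] at h2 ⊢
      rw [add_one_mul (l.length + 1)]
      omega
  · have h1 : PB (fun p => B p + esz p) B := .of_le fun a => by omega
    have h2 : PB (fun p => B p + esz p) esz := .of_le fun a => by omega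
    have h3 : PB (fun p : List γ × ε => B p + esz p) fun p => p.1.length := by
      refine h2.mono ?_
      rintro ⟨l, e⟩
      induction l with
      | nil => simp
      | cons x l ih => simp at ih ⊢; omega
    exact (h3.add (.const 1)).mul (((PB.const 1).add h2).add ((PB.const 2).mul h1))

/-- Polynomial steps alone do not suffice, since results might grow at each member. Therefore `hB`
asks for a polynomial bound on the result for every list, so that it also applies to the tails. -/
theorem PT.foldr {l : α → List γ} {b : α → β} {h : α → γ → β → β} (hb : PT b)
    (hh : PT fun p : α × γ × β => h p.1 p.2.1 p.2.2) (hl : PT l)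
    (hB : PB esz fun p : List γ × α => esz (p.1.foldr (h p.2) (b p.2))) :
    PT fun a => (l a).foldr (h a) (b a) := by
  obtain ⟨c, hc⟩ := hB
  refine PT.comp (g := fun p : List γ × α => p.1.foldr (h p.2) (b p.2)) (f := fun a => (l a, a))
    ((TC.foldr (h := fun q => h q.1 q.2.1 q.2.2) hb hh (fun p => (esz p + 2) ^ c) ?_ ?_ ?_ ?_).pt ?_)
    (hl.pair PT.id)
  · intro x l e
    gcongr
    simp
    omega
  · exact fun l e => hc (l, e)
  · simp
  · simp
  · exact ⟨c, fun _ => le_rfl⟩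

/-! ### List operations in polynomial time -/

theorem esz_list (l : List α) : esz l = 1 + (l.map fun r => esz r + 1).sum := by
  induction l with
  | nil => simp
  | cons a l ih =>
    simp only [esz_cons, List.map_cons, List.sum_cons]
    omega

theorem esz_append (l l' : List α) : esz (l ++ l') + 1 = esz l + esz l' := by
  induction l with
  | nil => simp; omega
  | cons a l ih =>
    simp only [esz_cons, List.cons_append]
    omega

theorem length_lt_esz (l : List α) : l.length < esz l := by
  induction l with
  | nil => simp
  | cons a l ih => simp; omega

theorem esz_le_of_mem {a : α} {l : List α} (h : a ∈ l) : esz a + 2 ≤ esz l := by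
  induction l with
  | nil => simp at h
  | cons b l ih =>
    have := esz_pos l
    rcases List.mem_cons.1 h with rfl | h
    · simp; omega
    · have := ih h
      simp; omega

@[fun_prop]
theorem PT.append {f g : α → List β} (hf : PT f) (hg : PT g) : PT fun a => f a ++ g a := by
  have : PT fun p : List β × List β => p.1.foldr (fun x r => x :: r) p.2 :=
    PT.foldr (by fun_prop) (by fun_prop) (by fun_prop) (.of_le fun p => by
      have := esz_append p.1 p.2.2
      rw [esz_prod, esz_prod]
      simp
      omega)
  simpa using PT.comp this (hf.pair hg)

@[fun_prop]
theorem PT.reverse {f : α → List β} (hf : PT f) : PT fun a => (f a).reverse := by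
  have h1 : ∀ l : List β, l.foldr (fun x r => r ++ [x]) [] = l.reverse := fun l => by
    induction l with
    | nil => rfl
    | cons x l ih => simp [ih]
  have : PT fun a => (f a).foldr (fun x r => r ++ [x]) [] :=
    PT.foldr (by fun_prop) (by fun_prop) hf (.of_le fun p => by
      have h2 : ∀ l : List β, esz l.reverse = esz l := fun l => by
        induction l with
        | nil => rfl
        | cons x l ih =>
          have := esz_append l.reverse [x]
          simp at this ⊢
          omega
      rw [h1, h2, esz_prod]
      omega)
  simpa only [h1] using this

/-- Recursion: the value of `f` at `a` is computed from its values at the members of `ch a`. -/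
theorem TC.hylo {f : α → β} {ch : α → List α} {cb : α × List β → β} {Sch : α → ℕ}
    {Scb : α × List β → ℕ} (hch : TC ch Sch) (hcb : TC cb Scb) (W : α → ℕ)
    (hf : ∀ a, f a = cb (a, (ch a).map f))
    (hW : ∀ a, 1 + esz a + esz (f a) + Sch a + Scb (a, (ch a).map f) +
      ((ch a).map W).sum ≤ W a) : TC f W :=
  TC.hylo_reverse (cb := fun q => cb (q.1, q.2.reverse)) (Scb := fun q => Scb (q.1, q.2.reverse)) hch
    ((hcb.comp (f := fun q : α × List β => (q.1, q.2.reverse)) (S := fun _ => 0)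
      (by change PT _; fun_prop)).of_le fun _ => by simp) W
    (fun a => by simpa using hf a) fun a => by simpa using hW a

theorem PT.hylo {f : α → β} {ch : α → List α} {cb : α × List β → β} (hch : PT ch) (hcb : PT cb)
    (W : α → ℕ) (hf : ∀ a, f a = cb (a, (ch a).map f))
    (hW : ∀ a, 1 + esz a + esz (f a) + ((ch a).map W).sum ≤ W a) : TC f W :=
  TC.hylo hch hcb W hf fun a => by simpa using hW a

@[fun_prop]
theorem PT.flatMap {l : α → List γ} {f : α → γ → List δ} (hf : PT fun p : α × γ => f p.1 p.2)
    (hl : PT l) : PT fun a => (l a).flatMap (f a) := by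
  have h1 : ∀ (a : α) (l : List γ), l.foldr (fun x r => f a x ++ r) [] = l.flatMap (f a) :=
    fun a l => by
      induction l with
      | nil => rfl
      | cons x l ih => simp [ih]
  have : PT fun a => (l a).foldr (fun x r => f a x ++ r) [] := by
    refine PT.foldr (by fun_prop) ?_ hl ?_
    · exact PT.append (hf.comp (f := fun p : α × γ × List δ => (p.1, p.2.1)) (by fun_prop))
        (by fun_prop)
    · obtain ⟨c, hc⟩ := hf.size
      have h2 : ∀ (a : α) (l l' : List γ), esz l ≤ esz l' →
          esz (l.flatMap (f a)) ≤ l.length * (esz (l', a) + 2) ^ c + 1 := by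
        intro a l l' hl
        induction l with
        | nil => simp
        | cons x l ih =>
          have h3 := hc (a, x)
          simp only [esz_cons] at hl
          have h4 := ih (by omega)
          have h5 := esz_append (f a x) (l.flatMap (f a))
          have h6 : (esz (a, x) + 2) ^ c ≤ (esz (l', a) + 2) ^ c := by
            gcongr
            simp
            omega
          simp only [List.flatMap_cons, List.length_cons]
          rw [add_one_mul]
          simp only at h3
          omega
      refine PB.mono (T := fun p => esz p * (esz p + 2) ^ c + 1)
        (((PB.of_le fun _ => le_rfl).mul ⟨c, fun _ => le_rfl⟩).add (.const 1)) ?_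
      rintro ⟨l, a⟩
      simp only [h1]
      refine (h2 a l l le_rfl).trans ?_
      have := length_lt_esz l
      gcongr
      simp
      omega
  simpa only [h1] using this

@[fun_prop]
theorem PT.list_map {l : α → List γ} {f : α → γ → δ} (hf : PT fun p : α × γ => f p.1 p.2)
    (hl : PT l) : PT fun a => (l a).map (f a) := by
  have : PT fun a => (l a).flatMap fun x => [f a x] :=
    PT.flatMap (PT.list_cons hf (PT.const _)) hl
  exact this.congr fun a => List.map_eq_flatMap.symm

@[fun_prop]
theorem PT.filter {l : α → List γ} {f : α → γ → Bool} (hf : PT fun p : α × γ => f p.1 p.2)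
    (hl : PT l) : PT fun a => (l a).filter (f a) := by
  have h1 : ∀ (a : α) (l : List γ), (l.flatMap fun x => bif f a x then [x] else []) =
      l.filter (f a) := fun a l => by
    induction l with
    | nil => rfl
    | cons x l ih => cases h : f a x <;> simp [h, ih]
  have : PT fun a => (l a).flatMap fun x => bif f a x then [x] else [] :=
    PT.flatMap (PT.cond hf (by fun_prop) (by fun_prop)) hl
  simpa only [h1] using this

@[fun_prop]
theorem PT.or {f g : α → Bool} (hf : PT f) (hg : PT g) : PT fun a => f a || g a := by
  have : PT fun a => bif f a then true else g a := PT.cond hf (PT.const _) hg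
  simpa [Bool.cond_true_left] using this

@[fun_prop]
theorem PT.and {f g : α → Bool} (hf : PT f) (hg : PT g) : PT fun a => f a && g a := by
  have : PT fun a => bif f a then g a else false := PT.cond hf hg (PT.const _)
  simpa [Bool.cond_false_right] using this

@[fun_prop]
theorem PT.not {f : α → Bool} (hf : PT f) : PT fun a => !f a := by
  have : PT fun a => bif f a then false else true := PT.cond hf (PT.const _) (PT.const _)
  simpa using this

@[fun_prop]
theorem PT.any {l : α → List γ} {f : α → γ → Bool} (hf : PT fun p : α × γ => f p.1 p.2)
    (hl : PT l) : PT fun a => (l a).any (f a) := by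
  have h1 : ∀ (a : α) (l : List γ), l.foldr (fun x r => f a x || r) false = l.any (f a) :=
    fun a l => by
      induction l with
      | nil => rfl
      | cons x l ih => simp [ih]
  have : PT fun a => (l a).foldr (fun x r => f a x || r) false :=
    PT.foldr (by fun_prop) (PT.or (hf.comp (f := fun p : α × γ × Bool => (p.1, p.2.1))
      (by fun_prop)) (by fun_prop)) hl ((PB.const 3).mono fun _ => esz_bool_le _)
  simpa only [h1] using this

@[fun_prop]
theorem PT.all {l : α → List γ} {f : α → γ → Bool} (hf : PT fun p : α × γ => f p.1 p.2)
    (hl : PT l) : PT fun a => (l a).all (f a) := by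
  have : PT fun a => !(l a).any fun x => !f a x := PT.not (PT.any (PT.not hf) hl)
  simpa [List.not_any_eq_all_not] using this

@[fun_prop]
theorem PT.tail {l : α → List γ} (hl : PT l) : PT fun a => (l a).tail := by
  have := PT.list_case (g := fun _ => []) (h := fun q : α × γ × List γ => q.2.2) hl
    (PT.const _) (by fun_prop)
  exact this.congr fun a => by cases l a <;> rfl

@[fun_prop]
theorem PT.headD {l : α → List γ} {d : α → γ} (hl : PT l) (hd : PT d) :
    PT fun a => (l a).headD (d a) := by
  have := PT.list_case (g := d) (h := fun q : α × γ × List γ => q.2.1) hl hd (by fun_prop)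
  exact this.congr fun a => by cases l a <;> rfl

@[fun_prop]
theorem PT.isEmpty {l : α → List γ} (hl : PT l) : PT fun a => (l a).isEmpty := by
  have := PT.list_case (g := fun _ => true) (h := fun q : α × γ × List γ => false) hl
    (by fun_prop) (by fun_prop)
  exact this.congr fun a => by cases l a <;> rfl

@[fun_prop]
theorem PT.drop_length {l : α → List γ} {n : α → List δ} (hl : PT l) (hn : PT n) :
    PT fun a => (l a).drop (n a).length := by
  have h1 : ∀ (l : List γ) (n : List δ), n.foldr (fun _ r => r.tail) l = l.drop n.length :=
    fun l n => by
      induction n with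
      | nil => simp
      | cons x n ih => simp [ih]
  have h2 : ∀ (l : List γ) (n : ℕ), esz (l.drop n) ≤ esz l := fun l n => by
    rw [esz_list, esz_list]
    have := ((List.drop_sublist n l).map fun r => esz r + 1).sum_le_sum (by simp)
    omega
  have : PT fun p : List γ × List δ => p.2.foldr (fun _ r => r.tail) p.1 :=
    PT.foldr (by fun_prop) (by fun_prop) (by fun_prop) (.of_le fun p => by
      rw [h1, esz_prod, esz_prod]
      have := h2 p.2.1 p.1.length
      omega)
  simpa only [h1] using PT.comp this (hl.pair hn)

end Hylo

/-! ### Operations on trees -/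

namespace SExp

def hd : SExp → SExp
  | nil => nil
  | cons s _ => s

def tl : SExp → SExp
  | nil => nil
  | cons _ t => t

def isCons : SExp → Bool
  | nil => false
  | cons _ _ => true

def toList : SExp → List SExp
  | nil => []
  | cons s t => s :: t.toList

@[simp] theorem hd_cons (s t : SExp) : (cons s t).hd = s := rfl
@[simp] theorem tl_cons (s t : SExp) : (cons s t).tl = t := rfl
@[simp] theorem isCons_cons (s t : SExp) : (cons s t).isCons = true := rfl
@[simp] theorem isCons_nil : nil.isCons = false := rfl
@[simp] theorem ofList_toList (x : SExp) : ofList x.toList = x := by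
  induction x with
  | nil => rfl
  | cons s t _ ih => simp [toList, ofList, ih]
@[simp] theorem toList_ofList (l : List SExp) : (ofList l).toList = l := by
  induction l with
  | nil => rfl
  | cons s l ih => simp [toList, ofList, ih]
theorem ofList_injective : Function.Injective ofList :=
  Function.LeftInverse.injective toList_ofList

/-- Equality of trees. -/
def eqb : SExp → SExp → Bool
  | nil, nil => true
  | cons a b, cons c d => a.eqb c && b.eqb d
  | _, _ => false

@[simp] theorem eqb_iff (x y : SExp) : x.eqb y = true ↔ x = y := by
  induction x generalizing y with
  | nil => cases y <;> simp [eqb]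
  | cons a b iha ihb => cases y <;> simp [eqb, iha, ihb]

end SExp

section Tree
variable {α β γ : Type} [Enc α] [Enc β] [Enc γ]

theorem PT.tree_case {f : SExp → β} {g : SExp × SExp → β} (hg : PT g)
    (h : ∀ s t, f (.cons s t) = g (s, t)) : PT f := by
  refine (TC.branch (f := f) (k := fun x => x) (S₁ := fun _ => 0) (S₂ := fun _ => 0) PT.id ?_
    ?_).of_le fun _ => by simp
  · have : PT fun _ : {a : SExp // a = .nil} => f .nil := PT.const _
    refine this.congr ?_
    rintro ⟨a, rfl⟩
    rfl
  · have : PT fun a : {a : SExp // a ≠ .nil} => (a.1.hd, a.1.tl) := PT.of_enc_eq <| by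
      rintro ⟨_ | ⟨s, t⟩, ha⟩
      · exact absurd rfl ha
      · rfl
    refine (hg.comp this).congr ?_
    rintro ⟨a, ha⟩
    cases a with
    | nil => exact absurd rfl ha
    | cons s t => exact (h s t).symm

@[fun_prop]
theorem PT.hd {f : α → SExp} (hf : PT f) : PT fun a => (f a).hd :=
  PT.comp (PT.tree_case (g := Prod.fst) (by fun_prop) fun _ _ => rfl) hf

@[fun_prop]
theorem PT.tl {f : α → SExp} (hf : PT f) : PT fun a => (f a).tl :=
  PT.comp (PT.tree_case (g := Prod.snd) (by fun_prop) fun _ _ => rfl) hf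

@[fun_prop]
theorem PT.isCons {f : α → SExp} (hf : PT f) : PT fun a => (f a).isCons :=
  PT.comp (PT.tree_case (g := fun _ => true) (by fun_prop) fun _ _ => rfl) hf

@[fun_prop]
theorem PT.tree_cons {f g : α → SExp} (hf : PT f) (hg : PT g) :
    PT fun a => SExp.cons (f a) (g a) :=
  PT.comp (g := fun p : SExp × SExp => SExp.cons p.1 p.2) (PT.of_enc_eq fun _ => rfl) (hf.pair hg)

theorem enc_list_sexp (l : List SExp) : enc l = SExp.ofList l := by
  change SExp.ofList (l.map id) = _
  rw [List.map_id]

@[fun_prop]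
theorem PT.toList {f : α → SExp} (hf : PT f) : PT fun a => (f a).toList :=
  PT.comp (PT.of_enc_eq fun x => by simp [enc_list_sexp, enc_sexp]) hf

@[fun_prop]
theorem PT.ofList {f : α → List SExp} (hf : PT f) : PT fun a => SExp.ofList (f a) :=
  PT.comp (PT.of_enc_eq fun x => by simp [enc_list_sexp, enc_sexp]) hf

@[fun_prop]
theorem PT.enc {f : α → β} (hf : PT f) : PT fun a => enc (f a) :=
  PT.comp (PT.of_enc_eq fun _ => rfl) hf

theorem SExp.len_hd_add_len_tl (x : SExp) (h : x.isCons = true) :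
    x.hd.len + x.tl.len + 1 = x.len := by
  cases x with
  | nil => simp at h
  | cons s t => simp

@[fun_prop]
theorem PT.eqb {f g : α → SExp} (hf : PT f) (hg : PT g) : PT fun a => (f a).eqb (g a) := by
  -- A quadratic weight exceeds the sum of the weights of the two recursive calls by enough to pay
  -- for the sizes handled in the current call.
  have : TC (fun p : SExp × SExp => p.1.eqb p.2) fun p => 10 * (p.1.len + p.2.len) ^ 2 :=
    PT.hylo (ch := fun p => bif p.1.isCons && p.2.isCons then
        [(p.1.hd, p.2.hd), (p.1.tl, p.2.tl)] else [])
      (cb := fun q => bif q.1.1.isCons && q.1.2.isCons then q.2.all fun x => x else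
        !(q.1.1.isCons || q.1.2.isCons))
      (by fun_prop) (by fun_prop) _
      (by rintro ⟨_ | ⟨a, b⟩, _ | ⟨c, d⟩⟩ <;> simp [SExp.eqb])
      (by
        rintro ⟨x, y⟩
        have h3 := esz_bool_le (x.eqb y)
        have h4 := x.len_pos
        have h5 := y.len_pos
        have h6 : 2 * (x.len + y.len) ≤ (x.len + y.len) ^ 2 := by nlinarith
        rw [esz_prod]
        simp only [esz_sexp]
        cases h : x.isCons && y.isCons with
        | false =>
          simp
          omega
        | true =>
          simp only [Bool.and_eq_true] at h
          have h1 := x.len_hd_add_len_tl h.1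
          have h2 := y.len_hd_add_len_tl h.2
          simp only [cond_true, List.map_cons, List.map_nil, List.sum_cons, List.sum_nil]
          rw [← h1, ← h2] at h6 ⊢
          nlinarith)
  refine PT.comp (g := fun p : SExp × SExp => p.1.eqb p.2) (this.pt ?_) (hf.pair hg)
  exact (PB.const 10).mul (PB.pow (.of_le fun p => by rw [esz_prod]; simp) 2)

/-- Membership in a list, decided by comparing codes. -/
def memb (a : SExp) (l : List SExp) : Bool := l.any fun b => a.eqb b

@[simp] theorem memb_iff {a : SExp} {l : List SExp} : memb a l = true ↔ a ∈ l := by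
  simp [memb]

@[fun_prop]
theorem PT.memb {f : α → SExp} {g : α → List SExp} (hf : PT f) (hg : PT g) :
    PT fun a => memb (f a) (g a) := by
  unfold HOGame.memb
  fun_prop

/-- Iteration until nothing changes. -/
theorem TC.fix {ε : Type} [Enc ε] {g : ε → List SExp → List SExp} {Sg : ε × List SExp → ℕ}
    (hg : TC (fun p : ε × List SExp => g p.1 p.2) Sg) {e : α → ε} {Se : α → ℕ} (he : TC e Se)
    {x : α → List SExp} {Sx : α → ℕ} (hx : TC x Sx) (n : α → ℕ)
    (hn : ∀ a, g (e a) ((g (e a))^[n a] (x a)) = (g (e a))^[n a] (x a)) (W : α → ℕ)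
    (hW : ∀ a, ∀ i ≤ n a, n a + Sg (e a, (g (e a))^[i] (x a)) + esz (e a) +
      esz ((g (e a))^[i] (x a)) + 1 ≤ W a) :
    TC (fun a => (g (e a))^[n a] (x a)) fun a => Se a + Sx a + W a := by
  let step : ε × List SExp → (ε × List SExp) ⊕ List SExp := fun p =>
    bif (enc (g p.1 p.2)).eqb (enc p.2) then .inr p.2 else .inl (p.1, g p.1 p.2)
  have hstep : TC step Sg := by
    refine (TC.comp (g := fun q : List SExp × ε × List SExp =>
      bif (enc q.1).eqb (enc q.2.2) then (.inr q.2.2 : (ε × List SExp) ⊕ List SExp)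
        else .inl (q.2.1, q.1)) (S' := fun _ => 0)
      (PT.cond (by fun_prop) (PT.comp PT.inr (by fun_prop))
        (PT.comp (g := Sum.inl) PT.inl (by fun_prop)))
      (TC.pair hg (PT.id.tc fun _ => 0))).of_le fun a => by simp
  refine TC.loop hstep (TC.pair he hx)
    (fun a j s => ∃ i, i + j = n a ∧ s = (e a, (g (e a))^[i] (x a))) ?_ ?_ ?_ ?_
  · intro a
    have := hW a 0 (Nat.zero_le _)
    exact ⟨n a, by omega, 0, by omega, rfl⟩
  · rintro a j s s' ⟨i, hi, rfl⟩ he'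
    simp only [step] at he'
    cases hc : (enc (g (e a) ((g (e a))^[i] (x a)))).eqb (enc ((g (e a))^[i] (x a))) with
    | true => simp [hc] at he'
    | false =>
      simp only [hc, cond_false, Sum.inl.injEq] at he'
      subst he'
      -- A counter of zero means that `n a` rounds have been made, and there the iterate is stable,
      -- so the test would have ended the loop.
      have hj : j ≠ 0 := by
        rintro rfl
        rw [show i = n a by omega, hn a] at hc
        have := (SExp.eqb_iff (enc ((g (e a))^[n a] (x a))) _).2 rfl
        simp [this] at hc
      refine ⟨j - 1, by omega, i + 1, by omega, ?_⟩
      rw [Function.iterate_succ_apply']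
  · rintro a j s b ⟨i, hi, rfl⟩ he'
    simp only [step] at he'
    cases hc : (enc (g (e a) ((g (e a))^[i] (x a)))).eqb (enc ((g (e a))^[i] (x a))) with
    | false => simp [hc] at he'
    | true =>
      simp only [hc, cond_true, Sum.inr.injEq] at he'
      rw [SExp.eqb_iff, enc_list_sexp, enc_list_sexp] at hc
      have hc' := SExp.ofList_injective hc
      -- Once two consecutive iterates agree, all later ones do. So the loop returns the `n a`-th
      -- iterate without knowing `n a`.
      rw [← he', ← hi, add_comm, Function.iterate_add_apply]
      clear hi
      induction j with
      | zero => rfl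
      | succ j ih => rw [Function.iterate_succ_apply, hc', ← ih]
  · rintro a j s ⟨i, hi, rfl⟩
    have := hW a i (by omega)
    rw [esz_pair]
    omega

end Tree

end HOGame

namespace HOGame
open _root_.HOGame.Enc (enc)

attribute [local irreducible] TC

/-! ### The algorithm -/

/-- The `i`-th entry of a list, all represented by trees. -/
def nth (x i : SExp) : SExp := (x.toList.drop i.toList.length).headD .nil

/-- The codes of the numbers below the length of a list. -/
def upto (l : List SExp) : List SExp :=
  l.foldr (fun _ r => .nil :: r.map fun x => .cons .nil x) []

/-- The part of an automaton that matters: codes of the states, codes of the letters, the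
transitions, and the set of final states. Sets of states are represented by sorted lists. -/
structure AutData where
  states : List SExp
  letters : List SExp
  trans : SExp
  final : SExp

namespace AutData

def tr (d : AutData) (p a q : SExp) : Bool := (nth (nth (nth d.trans p) a) q).isCons

/-- The states with a transition under `a` into the set `c`. -/
def pre (d : AutData) (a c : SExp) : SExp :=
  .ofList (d.states.filter fun p => c.toList.any fun q => d.tr p a q)

def union (d : AutData) (c c' : SExp) : SExp :=
  .ofList (d.states.filter fun q => memb q c.toList || memb q c'.toList)

def subsets (d : AutData) : List SExp := d.states.sublists'.map fun l => .ofList l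

/-- One round of the computation of the sets generated by the set of final states under
predecessors and unions. -/
def clauseStep (d : AutData) (S L : List SExp) : List SExp :=
  S.filter fun c => c.eqb d.final || L.any fun x =>
    (d.letters.any fun a => c.eqb (d.pre a x)) || L.any fun y => c.eqb (d.union x y)

end AutData

/-- On sets of states this is implication between clauses. On lists of clauses in normal form it is
implication in the opposite direction. -/
def subb (c c' : SExp) : Bool := c.toList.all fun q => memb q c'.toList

/-- The clauses of `U` that are implied by the conjunction of the clauses of `s`. -/
def normalize (U s : List SExp) : List SExp := U.filter fun c => s.any fun x => subb x c

/-- The substitution commutes with conjunction and disjunction, so it acts on each clause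
separately; the result then has to be completed to the list of all implied clauses. -/
def predVal (d : AutData) (U : List SExp) (a v : SExp) : SExp :=
  .ofList (normalize U (v.toList.map fun c => d.pre a c))

def endVal (d : AutData) (U : List SExp) : SExp := .ofList (normalize U [d.final])

/-- A clause follows from a conjunction of positive formulas if it follows from one of them, and
from a disjunction if it follows from all. Hence no renormalization is needed. -/
def choiceVal (U : List SExp) (universal : Bool) (vs : List SExp) : SExp :=
  .ofList (U.filter fun c => bif universal then vs.any fun v => memb c v.toList else
    vs.all fun v => memb c v.toList)

/-- The elements of a domain, and the codes of the pairs in its order. -/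
abbrev DomData : Type := List SExp × List SExp

/-- Several sublists may have the same normal form, so elements can be listed repeatedly, here and
as keys of tables. The size bounds count the repetitions. -/
def groundElems (U : List SExp) : List SExp := U.sublists'.map fun s => .ofList (normalize U s)

def groundPairs (E : List SExp) : List SExp :=
  E.flatMap fun s => (E.filter fun t => subb t s).map fun t => .cons s t

def allTables (Ea Eb : List SExp) : List SExp :=
  Ea.foldr (fun k r => Eb.flatMap fun v => r.map fun t => .cons (.cons k v) t) [.nil]

/-- Two entries with the same key are compared in both directions, so the test also forces repeated
keys to have the same value. -/
def monoTable (Pa Pb : List SExp) (f : SExp) : Bool :=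
  f.toList.all fun p => f.toList.all fun q =>
    !memb (.cons p.hd q.hd) Pa || memb (.cons p.tl q.tl) Pb

def leTable (Pb : List SExp) (f g : SExp) : Bool :=
  f.toList.all fun p => g.toList.all fun q =>
    !p.hd.eqb q.hd || memb (.cons p.tl q.tl) Pb

/-- On finite domains monotonicity is equivalent to preservation of meets of descending chains, so
it is the only property to be tested. -/
def arrowElems (A B : DomData) : List SExp :=
  (allTables A.1 B.1).filter fun f => monoTable A.2 B.2 f

def arrowPairs (B : DomData) (E : List SExp) : List SExp :=
  E.flatMap fun s => (E.filter fun t => leTable B.2 s t).map fun t => .cons s t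

def domData (U : List SExp) : SExp → DomData
  | .nil => (groundElems U, groundPairs (groundElems U))
  | .cons a b =>
    let E := arrowElems (domData U a) (domData U b)
    (E, arrowPairs (domData U b) E)

/-- The data for the evaluation of terms: the automaton, the clauses, and the elements of the
ground domain. -/
structure Base where
  aut : AutData
  clauses : List SExp
  ground : List SExp

def hasTag (n : ℕ) (t : SExp) : Bool := t.hd.eqb (.ofNat n)

def applyTable (f x : SExp) : SExp := ((f.toList.filter fun p => p.hd.eqb x).headD .nil).tl

def Base.letterTable (D : Base) (a : SExp) : SExp :=
  .ofList (D.ground.map fun x => .cons x (predVal D.aut D.clauses a x))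

def leafVal (D : Base) (ν : SExp) (η : List SExp) (t : SExp) : SExp :=
  bif hasTag 0 t then endVal D.aut D.clauses else
  bif hasTag 1 t then D.letterTable t.tl else
  bif hasTag 2 t then nth ν t.tl else nth (.ofList η) t.tl

theorem len_tl_le (t : SExp) : t.tl.len ≤ t.len := by
  cases t with
  | nil => exact le_rfl
  | cons s t => simp [SExp.tl]; omega

theorem len_args_lt {t : SExp} (h : hasTag 4 t = true) : t.tl.hd.len + t.tl.tl.len < t.len := by
  cases t with
  | nil => simp [hasTag, SExp.hd, SExp.ofNat, List.replicate, SExp.ofList] at h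
  | cons s t =>
    rw [hasTag, SExp.hd_cons, SExp.eqb_iff] at h
    subst h
    cases t <;> simp [SExp.tl, SExp.hd, SExp.ofNat, List.replicate, SExp.ofList]; omega

/-- A letter in head position is applied directly. Its table over the ground domain is doubly
exponential, which would be too expensive for games of order 0, and is built only if the letter is
an argument. -/
def evalVal (D : Base) (ν : SExp) (η : List SExp) (t : SExp) : SExp :=
  if h : hasTag 4 t = true then
    have := len_args_lt h
    bif hasTag 1 t.tl.hd then predVal D.aut D.clauses t.tl.hd.tl (evalVal D ν η t.tl.tl)
    else applyTable (evalVal D ν η t.tl.hd) (evalVal D ν η t.tl.tl)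
  else leafVal D ν η t
termination_by t.len

/-- The rules of a non-terminal and the data for their evaluation. The valuation `nil` of the
non-terminals stands for the greatest one. -/
structure RuleData where
  base : Base
  val : SExp
  rules : List SExp
  universal : Bool

def RuleData.body (D : RuleData) (η : List SExp) : SExp :=
  bif D.val.isCons then
    choiceVal D.base.clauses D.universal (D.rules.map fun t => evalVal D.base D.val η t)
  else .nil

/-- The table of a function with the given domains of its arguments. -/
def RuleData.table (D : RuleData) : List (List SExp) → List SExp → SExp
  | [], η => D.body η
  | R :: Rs, η => .ofList (R.map fun x => .cons x (D.table Rs (η ++ [x])))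

/-- A non-terminal: the domains of its arguments, its rules, and whether the universal player owns
it. -/
abbrev NTData : Type := List (List SExp) × List SExp × Bool

def rhsVal (e : Base × List NTData) (ν : List SExp) : List SExp :=
  e.2.map fun F => RuleData.table ⟨e.1, .ofList ν, F.2.1, F.2.2⟩ F.1 []

/-! ### The algorithm is computable -/

section
variable {α β γ δ ε : Type} [Enc α] [Enc β] [Enc γ] [Enc δ] [Enc ε]

@[fun_prop]
theorem PT.nth {f g : α → SExp} (hf : PT f) (hg : PT g) : PT fun a => nth (f a) (g a) := by
  unfold HOGame.nth; fun_prop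

theorem esz_le_of_forall {l : List α} {m : ℕ} (h : ∀ x ∈ l, esz x ≤ m) :
    esz l ≤ 1 + l.length * (m + 1) := by
  induction l with
  | nil => simp
  | cons x l ih =>
    have h1 := h x (by simp)
    have h2 := ih fun y hy => h y (by simp [hy])
    simp only [esz_cons, List.length_cons, add_one_mul]
    omega

@[fun_prop]
theorem PT.upto {f : α → List SExp} (hf : PT f) : PT fun a => upto (f a) := by
  unfold HOGame.upto
  refine PT.foldr (by fun_prop) (by fun_prop) hf ?_
  have h : ∀ l : List SExp, (l.foldr (fun _ r => SExp.nil :: r.map fun x => .cons .nil x) []).length =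
      l.length ∧ ∀ x ∈ l.foldr (fun _ r => SExp.nil :: r.map fun x => .cons .nil x) [],
      esz x ≤ 2 * l.length := fun l => by
    induction l with
    | nil => simp
    | cons y l ih =>
      refine ⟨by simp [ih.1], fun x hx => ?_⟩
      simp only [List.foldr_cons, List.mem_cons, List.mem_map] at hx
      rcases hx with rfl | ⟨z, hz, rfl⟩
      · simp; omega
      · have := ih.2 z hz
        simp at this ⊢; omega
  refine PB.mono (T := fun p => 1 + esz p * (2 * esz p + 1)) ((PB.const 1).add
    ((PB.of_le fun _ => le_rfl).mul (((PB.const 2).mul (.of_le fun _ => le_rfl)).add (.const 1))))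
    fun p => ?_
  refine (esz_le_of_forall (h p.1).2).trans ?_
  rw [(h p.1).1]
  have := length_lt_esz p.1
  have : p.1.length ≤ esz p := by rw [esz_prod]; omega
  gcongr

instance : Enc AutData := ⟨fun d => enc (d.states, d.letters, d.trans, d.final)⟩

@[fun_prop]
theorem PT.states {f : α → AutData} (hf : PT f) : PT fun a => (f a).states :=
  PT.comp (g := fun p : List SExp × List SExp × SExp × SExp => p.1) (by fun_prop)
    (PT.comp (PT.of_enc_eq (f := fun d : AutData => (d.states, d.letters, d.trans, d.final))
      fun _ => rfl) hf)

@[fun_prop]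
theorem PT.letters {f : α → AutData} (hf : PT f) : PT fun a => (f a).letters :=
  PT.comp (g := fun p : List SExp × List SExp × SExp × SExp => p.2.1) (by fun_prop)
    (PT.comp (PT.of_enc_eq (f := fun d : AutData => (d.states, d.letters, d.trans, d.final))
      fun _ => rfl) hf)

@[fun_prop]
theorem PT.trans {f : α → AutData} (hf : PT f) : PT fun a => (f a).trans :=
  PT.comp (g := fun p : List SExp × List SExp × SExp × SExp => p.2.2.1) (by fun_prop)
    (PT.comp (PT.of_enc_eq (f := fun d : AutData => (d.states, d.letters, d.trans, d.final))
      fun _ => rfl) hf)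

@[fun_prop]
theorem PT.final {f : α → AutData} (hf : PT f) : PT fun a => (f a).final :=
  PT.comp (g := fun p : List SExp × List SExp × SExp × SExp => p.2.2.2) (by fun_prop)
    (PT.comp (PT.of_enc_eq (f := fun d : AutData => (d.states, d.letters, d.trans, d.final))
      fun _ => rfl) hf)

@[fun_prop]
theorem PT.autData_mk {f g : α → List SExp} {h i : α → SExp} (hf : PT f) (hg : PT g) (hh : PT h)
    (hi : PT i) : PT fun a => AutData.mk (f a) (g a) (h a) (i a) :=
  PT.comp (g := fun p : List SExp × List SExp × SExp × SExp =>
    AutData.mk p.1 p.2.1 p.2.2.1 p.2.2.2) (PT.of_enc_eq fun _ => rfl)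
    (hf.pair (hg.pair (hh.pair hi)))

@[fun_prop]
theorem PT.tr {d : α → AutData} {p a q : α → SExp} (hd : PT d) (hp : PT p) (ha : PT a)
    (hq : PT q) : PT fun x => (d x).tr (p x) (a x) (q x) := by
  unfold AutData.tr; fun_prop

@[fun_prop]
theorem PT.pre {d : α → AutData} {a c : α → SExp} (hd : PT d) (ha : PT a)
    (hc : PT c) : PT fun x => (d x).pre (a x) (c x) := by
  unfold AutData.pre; fun_prop

@[fun_prop]
theorem PT.union {d : α → AutData} {a c : α → SExp} (hd : PT d) (ha : PT a)
    (hc : PT c) : PT fun x => (d x).union (a x) (c x) := by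
  unfold AutData.union; fun_prop

@[fun_prop]
theorem PT.clauseStep {d : α → AutData} {a c : α → List SExp} (hd : PT d) (ha : PT a)
    (hc : PT c) : PT fun x => (d x).clauseStep (a x) (c x) := by
  unfold AutData.clauseStep; fun_prop

@[fun_prop]
theorem PT.subb {a c : α → SExp} (ha : PT a) (hc : PT c) : PT fun x => subb (a x) (c x) := by
  unfold HOGame.subb; fun_prop

@[fun_prop]
theorem PT.normalize {U s : α → List SExp} (hU : PT U) (hs : PT s) :
    PT fun x => normalize (U x) (s x) := by
  unfold HOGame.normalize; fun_prop

@[fun_prop]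
theorem PT.predVal {d : α → AutData} {U : α → List SExp} {a v : α → SExp} (hd : PT d) (hU : PT U)
    (ha : PT a) (hv : PT v) : PT fun x => predVal (d x) (U x) (a x) (v x) := by
  unfold HOGame.predVal; fun_prop

@[fun_prop]
theorem PT.endVal {d : α → AutData} {U : α → List SExp} (hd : PT d) (hU : PT U) :
    PT fun x => endVal (d x) (U x) := by
  unfold HOGame.endVal; fun_prop

@[fun_prop]
theorem PT.choiceVal {U vs : α → List SExp} {b : α → Bool} (hU : PT U) (hb : PT b) (hv : PT vs) :
    PT fun x => choiceVal (U x) (b x) (vs x) := by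
  unfold HOGame.choiceVal; fun_prop

/-! ### Enumerations of exponential size -/

theorem esz_sublists (l : List α) : esz l.sublists' ≤ 1 + 2 ^ l.length * (esz l + 1) := by
  refine (esz_le_of_forall (m := esz l) fun s hs => ?_).trans (by rw [List.length_sublists'])
  rw [esz_list, esz_list]
  have := ((List.mem_sublists'.1 hs).map fun r => esz r + 1).sum_le_sum (by simp)
  omega

theorem TC.sublists : TC (fun l : List α => l.sublists') fun l => 2 ^ l.length := by
  have h1 : ∀ l : List α, l.foldr (fun x r => r ++ r.map fun s => x :: s) [[]] = l.sublists' := by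
    intro l
    induction l with
    | nil => rfl
    | cons x l ih => rw [List.foldr_cons, ih, List.sublists'_cons]
  have h2 := TC.foldr (γ := α) (ε := SExp) (b := fun _ => [[]])
    (h := fun q : SExp × α × List (List α) => q.2.2 ++ q.2.2.map fun s => q.2.1 :: s)
    (Sb := fun _ => 0) (Sh := fun _ => 0) (PT.const _) (by change PT _; fun_prop)
    (fun p => 1 + 2 ^ p.1.length * (esz p.1 + 1))
    (fun x l e => by simp only [List.length_cons, esz_cons]; gcongr <;> omega)
    (fun l e => by rw [h1]; exact esz_sublists l) (by simp) (by simp)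
  refine ((h2.comp (f := fun l : List α => (l, SExp.nil)) (S := fun _ => 0)
    (by change PT _; fun_prop)).congr h1).mono ?_
  have e1 : PB (fun a : List α => 2 ^ a.length + esz a) fun a => 2 ^ a.length :=
    .of_le fun a => Nat.le_add_right _ _
  have e2 : PB (fun a : List α => 2 ^ a.length + esz a) esz := .of_le fun a => Nat.le_add_left _ _
  exact (PB.const 0).add ((PB.const 1).add (e1.mul (e2.add (.const 1))))

theorem TC.subsets : TC AutData.subsets fun d => 2 ^ d.states.length := by
  refine (TC.comp (g := fun S : List (List SExp) => S.map fun l => SExp.ofList l)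
    (S' := fun _ => 0) (by change PT _; fun_prop) (TC.sublists.comp (f := AutData.states)
    (S := fun _ => 0) (by change PT _; fun_prop))).of_le fun d => by simp

theorem TC.groundElems : TC groundElems fun U => 2 ^ U.length := by
  refine (TC.comp (g := fun p : List (List SExp) × List SExp =>
    p.1.map fun s => SExp.ofList (HOGame.normalize p.2 s)) (S' := fun _ => 0)
    (by change PT _; fun_prop) (TC.pair TC.sublists (PT.id.tc fun _ => 0))).of_le fun d => by simp

@[fun_prop]
theorem PT.groundPairs {f : α → List SExp} (hf : PT f) : PT fun a => groundPairs (f a) := by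
  unfold HOGame.groundPairs; fun_prop

theorem allTables_bound (Ea Eb : List SExp) :
    (allTables Ea Eb).length = Eb.length ^ Ea.length ∧
      ∀ f ∈ allTables Ea Eb, esz f ≤ esz Ea * (esz Eb + 2) := by
  induction Ea with
  | nil => simp [allTables]
  | cons k Ea ih =>
    have e : allTables (k :: Ea) Eb =
      Eb.flatMap fun v => (allTables Ea Eb).map fun t => .cons (.cons k v) t := rfl
    rw [e]
    constructor
    · simp [List.length_flatMap, ih.1, pow_succ, mul_comm]
    · intro f hf
      simp only [List.mem_flatMap, List.mem_map] at hf
      obtain ⟨v, hv, t, ht, rfl⟩ := hf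
      have h1 := ih.2 t ht
      have h2 := esz_le_of_mem hv
      have h3 := k.len_pos
      simp only [esz_sexp, esz_cons, SExp.len_cons] at *
      nlinarith

theorem esz_allTables (Ea Eb : List SExp) : esz (allTables Ea Eb) ≤
    1 + (Eb.length + 1) ^ Ea.length * (esz Ea * (esz Eb + 2) + 1) := by
  obtain ⟨h1, h2⟩ := allTables_bound Ea Eb
  refine (esz_le_of_forall h2).trans ?_
  rw [h1]
  gcongr
  omega

theorem TC.allTables : TC (fun p : List SExp × List SExp => allTables p.1 p.2)
    fun p => (p.2.length + 1) ^ p.1.length := by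
  have h2 := TC.foldr (γ := SExp) (ε := List SExp) (b := fun _ => [SExp.nil])
    (h := fun q : List SExp × SExp × List SExp =>
      q.1.flatMap fun v => q.2.2.map fun t => SExp.cons (.cons q.2.1 v) t)
    (Sb := fun _ => 0) (Sh := fun _ => 0) (PT.const _) (by change PT _; fun_prop)
    (fun p => 1 + (p.2.length + 1) ^ p.1.length * (esz p.1 * (esz p.2 + 2) + 1))
    (fun x l e => by
      simp only [List.length_cons, esz_cons]
      gcongr <;> omega)
    (fun l e => esz_allTables l e) (by simp) (by simp)
  refine h2.mono ?_
  have h : PB (fun p : List SExp × List SExp => (p.2.length + 1) ^ p.1.length + esz p) esz :=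
    .of_le fun a => by omega
  exact (PB.const 1).add ((PB.of_le fun a => by omega).mul (((h.mono fun p => by
    rw [esz_prod]; omega).mul ((h.mono fun p => by rw [esz_prod]; omega).add (.const 2))).add
    (.const 1)))

@[fun_prop]
theorem PT.monoTable {P Q : α → List SExp} {f : α → SExp} (hP : PT P) (hQ : PT Q) (hf : PT f) :
    PT fun a => monoTable (P a) (Q a) (f a) := by
  unfold HOGame.monoTable; fun_prop

@[fun_prop]
theorem PT.leTable {P : α → List SExp} {f g : α → SExp} (hP : PT P) (hf : PT f) (hg : PT g) :
    PT fun a => leTable (P a) (f a) (g a) := by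
  unfold HOGame.leTable; fun_prop

@[fun_prop]
theorem PT.arrowPairs {B : α → DomData} {E : α → List SExp} (hB : PT B) (hE : PT E) :
    PT fun a => arrowPairs (B a) (E a) := by
  unfold HOGame.arrowPairs; fun_prop

theorem TC.arrow : TC (fun p : DomData × DomData =>
    (arrowElems p.1 p.2, arrowPairs p.2 (arrowElems p.1 p.2)))
    fun p => (p.2.1.length + 1) ^ p.1.1.length := by
  have h1 : TC (fun p : DomData × DomData => arrowElems p.1 p.2)
      fun p => (p.2.1.length + 1) ^ p.1.1.length := by
    refine (TC.comp (g := fun q : List SExp × DomData × DomData =>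
      q.1.filter fun f => HOGame.monoTable q.2.1.2 q.2.2.2 f) (S' := fun _ => 0)
      (by change PT _; fun_prop) (TC.pair (TC.allTables.comp
      (f := fun p : DomData × DomData => (p.1.1, p.2.1)) (S := fun _ => 0)
      (by change PT _; fun_prop)) (PT.id.tc fun _ => 0))).of_le fun d => by simp
  refine (TC.comp (g := fun q : List SExp × DomData × DomData =>
      (q.1, HOGame.arrowPairs q.2.2 q.1)) (S' := fun _ => 0)
      (by change PT _; fun_prop) (TC.pair h1 (PT.id.tc fun _ => 0))).of_le fun d => by simp

/-- The time scale for computing the data of a domain. -/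
def domScale (U : List SExp) : SExp → ℕ
  | .nil => 1 + (2 + esz U) + esz (domData U .nil) + 2 ^ U.length
  | .cons a b => 1 + ((SExp.cons a b).len + esz U + 1) + esz (domData U (.cons a b)) +
      ((domData U b).1.length + 1) ^ (domData U a).1.length + (domScale U a + domScale U b)

/-- Recursion along the kind with the two component domains as calls; each component is computed
once, although its data are used several times. -/
theorem TC.domData : TC (fun p : SExp × List SExp => domData p.2 p.1) fun p => domScale p.2 p.1 := by
  have h1 : TC (fun q : (SExp × List SExp) × List DomData =>
      (HOGame.groundElems q.1.2, HOGame.groundPairs (HOGame.groundElems q.1.2)))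
      fun q => 2 ^ q.1.2.length := by
    refine (TC.comp (g := fun E : List SExp => (E, HOGame.groundPairs E)) (S' := fun _ => 0)
      (by change PT _; fun_prop) (TC.groundElems.comp
      (f := fun q : (SExp × List SExp) × List DomData => q.1.2) (S := fun _ => 0)
      (by change PT _; fun_prop))).of_le fun d => by simp
  have h2 := TC.arrow.comp (f := fun q : (SExp × List SExp) × List DomData =>
      (q.2.headD ([], []), q.2.tail.headD ([], []))) (S := fun _ => 0) (by change PT _; fun_prop)
  have h3 := TC.cond (b := fun q : (SExp × List SExp) × List DomData => q.1.1.isCons)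
    (Sb := fun _ => 0) (by change PT _; fun_prop) h2 h1
  refine TC.hylo (ch := fun p : SExp × List SExp => bif p.1.isCons then
    [(p.1.hd, p.2), (p.1.tl, p.2)] else []) (Sch := fun _ => 0) (by change PT _; fun_prop) h3 _
    ?_ ?_
  · rintro ⟨_ | ⟨a, b⟩, U⟩ <;> rfl
  · rintro ⟨_ | ⟨a, b⟩, U⟩
    · simp [domScale]
    · simp [domScale]

/-! ### Evaluation of terms, and the tables of right-hand sides -/

instance : Enc Base := ⟨fun d => enc (d.aut, d.clauses, d.ground)⟩

theorem PT.base_view : PT fun d : Base => (d.aut, d.clauses, d.ground) :=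
  PT.of_enc_eq fun _ => rfl

@[fun_prop]
theorem PT.aut {f : α → Base} (hf : PT f) : PT fun a => (f a).aut :=
  PT.comp (g := fun p : AutData × List SExp × List SExp => p.1) (by fun_prop)
    (PT.base_view.comp hf)

@[fun_prop]
theorem PT.clauses {f : α → Base} (hf : PT f) : PT fun a => (f a).clauses :=
  PT.comp (g := fun p : AutData × List SExp × List SExp => p.2.1) (by fun_prop)
    (PT.base_view.comp hf)

@[fun_prop]
theorem PT.ground {f : α → Base} (hf : PT f) : PT fun a => (f a).ground :=
  PT.comp (g := fun p : AutData × List SExp × List SExp => p.2.2) (by fun_prop)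
    (PT.base_view.comp hf)

@[fun_prop]
theorem PT.hasTag (n : ℕ) {f : α → SExp} (hf : PT f) : PT fun a => hasTag n (f a) := by
  unfold HOGame.hasTag; fun_prop

@[fun_prop]
theorem PT.applyTable {f g : α → SExp} (hf : PT f) (hg : PT g) :
    PT fun a => applyTable (f a) (g a) := by
  unfold HOGame.applyTable; fun_prop

@[fun_prop]
theorem PT.leafVal {D : α → Base} {ν t : α → SExp} {η : α → List SExp} (hD : PT D) (hν : PT ν)
    (hη : PT η) (ht : PT t) : PT fun a => leafVal (D a) (ν a) (η a) (t a) := by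
  unfold HOGame.leafVal Base.letterTable; fun_prop

theorem len_ofList_filter_le (U : List SExp) (p : SExp → Bool) :
    (SExp.ofList (U.filter p)).len ≤ esz U := by
  have h1 : (SExp.ofList (U.filter p)).len = esz (U.filter p) := by
    rw [esz, enc_list_sexp]
  rw [h1, esz_list, esz_list]
  have := ((List.filter_sublist (p := p) (l := U)).map fun r => esz r + 1).sum_le_sum (by simp)
  omega

theorem len_ofList (l : List SExp) : (SExp.ofList l).len = esz l := by
  rw [esz, enc_list_sexp]

theorem len_nth_le (x i : SExp) : (nth x i).len ≤ x.len := by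
  have h1 : x.len = esz x.toList := by rw [← len_ofList, SExp.ofList_toList]
  rw [nth, h1]
  rcases h : x.toList.drop i.toList.length with _ | ⟨y, l⟩
  · simpa [Nat.succ_le_iff] using esz_pos x.toList
  · have := esz_le_of_mem (List.mem_of_mem_drop (h ▸ List.mem_cons_self : y ∈ _))
    simp at this ⊢
    omega

theorem len_applyTable_le (f x : SExp) : (applyTable f x).len ≤ f.len := by
  have h1 : f.len = esz f.toList := by rw [← len_ofList, SExp.ofList_toList]
  rw [applyTable, h1]
  rcases h : f.toList.filter fun p => p.hd.eqb x with _ | ⟨y, l⟩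
  · rw [h]
    exact esz_pos f.toList
  · have h2 := esz_le_of_mem (List.mem_of_mem_filter (h ▸ List.mem_cons_self : y ∈ _))
    have h3 := len_tl_le y
    rw [h]
    simp only [List.headD_cons, esz_sexp] at h2 ⊢
    omega

/-- Application selects an entry of a table, so values do not grow with the term. A value is a list
of clauses from `D.clauses`, part of `ν`, `η` or a letter table; only the letter table needs the
quadratic bound. -/
theorem len_evalVal_le (D : Base) (ν : SExp) (η : List SExp) (t : SExp) :
    (evalVal D ν η t).len ≤ (esz (D, ν, η) + 3) ^ 2 := by
  have hD : esz D = esz D.aut + (esz D.clauses + esz D.ground + 1) + 1 := by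
    rw [show esz D = esz (D.aut, D.clauses, D.ground) from rfl, esz_pair, esz_pair]
  have hle : esz (D, ν, η) ≤ (esz (D, ν, η) + 3) ^ 2 := by nlinarith
  have hp : ∀ a v, (predVal D.aut D.clauses a v).len ≤ esz D.clauses := fun a v =>
    len_ofList_filter_le _ _
  have key : ∀ n t, SExp.len t ≤ n → (evalVal D ν η t).len ≤ (esz (D, ν, η) + 3) ^ 2 := by
    intro n
    induction n with
    | zero => exact fun t ht => absurd t.len_pos (by omega)
    | succ n ih =>
      intro t ht
      rw [evalVal]
      split
      · next h =>
        have h1 := len_args_lt h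
        cases hasTag 1 t.tl.hd with
        | true =>
          have := hp t.tl.hd.tl (evalVal D ν η t.tl.tl)
          rw [esz_pair, esz_pair] at hle ⊢
          rw [cond_true]
          omega
        | false => exact (len_applyTable_le _ _).trans (ih _ (by omega))
      · rw [leafVal]
        cases hasTag 0 t with
        | true =>
          have := len_ofList_filter_le D.clauses fun c => [D.aut.final].any fun x => subb x c
          rw [esz_pair, esz_pair] at hle ⊢
          rw [cond_true, endVal, normalize]
          omega
        | false =>
          rw [cond_false]
          cases hasTag 1 t with
          | true =>
            rw [cond_true, Base.letterTable, len_ofList]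
            refine (esz_le_of_forall (m := esz D.ground + esz D.clauses) fun x hx => ?_).trans ?_
            · simp only [List.mem_map] at hx
              obtain ⟨y, hy, rfl⟩ := hx
              have h1 := esz_le_of_mem hy
              have h2 := hp t.tl y
              simp at h1 ⊢
              omega
            · have h1 := length_lt_esz D.ground
              rw [List.length_map]
              have h2 : esz D.ground + esz D.clauses ≤ esz (D, ν, η) := by
                rw [esz_pair, hD]; omega
              calc _ ≤ 1 + esz (D, ν, η) * (esz (D, ν, η) + 1) := by gcongr; omega
                _ ≤ _ := by nlinarith
          | false =>
            rw [cond_false]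
            cases hasTag 2 t with
            | true =>
              have := len_nth_le ν t.tl
              rw [esz_pair, esz_pair] at hle ⊢
              simp at hle ⊢
              omega
            | false =>
              have := len_nth_le (.ofList η) t.tl
              rw [len_ofList] at this
              rw [esz_pair, esz_pair] at hle ⊢
              simp at hle ⊢
              omega
  exact key _ t le_rfl

-- By `len_evalVal_le` the results have a size that does not depend on the term, and the subterms
-- are disjoint. So the cost is the length of the term times a polynomial in the data.
@[fun_prop]
theorem PT.evalVal {D : α → Base} {ν t : α → SExp} {η : α → List SExp} (hD : PT D) (hν : PT ν)
    (hη : PT η) (ht : PT t) : PT fun a => evalVal (D a) (ν a) (η a) (t a) := by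
  have : TC (fun p : SExp × Base × SExp × List SExp => HOGame.evalVal p.2.1 p.2.2.1 p.2.2.2 p.1)
      fun p => p.1.len * (3 + p.1.len + esz p.2 + (esz p.2 + 3) ^ 2) := by
    refine PT.hylo (ch := fun p => bif HOGame.hasTag 4 p.1 then
        bif HOGame.hasTag 1 p.1.tl.hd then [(p.1.tl.tl, p.2)] else [(p.1.tl.hd, p.2), (p.1.tl.tl, p.2)]
        else [])
      (cb := fun q => bif HOGame.hasTag 4 q.1.1 then
        bif HOGame.hasTag 1 q.1.1.tl.hd then
          HOGame.predVal q.1.2.1.aut q.1.2.1.clauses q.1.1.tl.hd.tl (q.2.headD .nil)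
        else HOGame.applyTable (q.2.headD .nil) (q.2.tail.headD .nil)
        else HOGame.leafVal q.1.2.1 q.1.2.2.1 q.1.2.2.2 q.1.1)
      (by fun_prop) (by fun_prop) _ ?_ ?_
    · rintro ⟨t, D, ν, η⟩
      simp only
      rw [HOGame.evalVal]
      by_cases h : HOGame.hasTag 4 t = true
      · rw [dif_pos h, h]
        cases HOGame.hasTag 1 t.tl.hd <;> simp
      · rw [Bool.not_eq_true] at h
        simp [h]
    · rintro ⟨t, D, ν, η⟩
      have h1 := len_evalVal_le D ν η t
      have h2 := t.len_pos
      rw [esz_pair]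
      simp only [esz_sexp]
      set E := esz (D, ν, η) with hE
      generalize hV : (E + 3) ^ 2 = V at h1 ⊢
      have base : 1 + (t.len + E + 1) + (HOGame.evalVal D ν η t).len ≤ 3 + t.len + E + V := by omega
      by_cases h : HOGame.hasTag 4 t = true
      · have h3 := len_args_lt h
        have h5 := t.tl.hd.len_pos
        have h4 : t.tl.hd.len * (3 + t.tl.hd.len + E + V) + t.tl.tl.len * (3 + t.tl.tl.len + E + V)
            ≤ (t.tl.hd.len + t.tl.tl.len) * (3 + t.len + E + V) := by
          rw [add_mul]
          gcongr <;> omega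
        have h6 : (t.tl.hd.len + t.tl.tl.len + 1) * (3 + t.len + E + V) ≤
            t.len * (3 + t.len + E + V) := by gcongr; omega
        rw [add_one_mul] at h6
        rw [h]
        cases HOGame.hasTag 1 t.tl.hd <;>
          simp only [cond_true, cond_false, List.map_cons, List.map_nil, List.sum_cons,
            List.sum_nil, ← hE, hV] <;> omega
      · rw [Bool.not_eq_true] at h
        rw [h]
        simp only [cond_false, List.map_nil, List.sum_nil]
        nlinarith
  refine PT.comp (g := fun p : SExp × Base × SExp × List SExp =>
    HOGame.evalVal p.2.1 p.2.2.1 p.2.2.2 p.1) (this.pt ?_) (ht.pair (hD.pair (hν.pair hη)))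
  have h1 : PB esz fun p : SExp × Base × SExp × List SExp => p.1.len :=
    .of_le fun p => by rw [esz_prod p, esz_sexp]; omega
  have h2 : PB esz fun p : SExp × Base × SExp × List SExp => esz p.2 :=
    .of_le fun p => by rw [esz_prod p]; omega
  exact h1.mul ((((PB.const 3).add h1).add h2).add ((h2.add (.const 3)).pow 2))

instance : Enc RuleData := ⟨fun d => enc (d.base, d.val, d.rules, d.universal)⟩

theorem PT.ruleData_view : PT fun d : RuleData => (d.base, d.val, d.rules, d.universal) :=
  PT.of_enc_eq fun _ => rfl

@[fun_prop]
theorem PT.base {f : α → RuleData} (hf : PT f) : PT fun a => (f a).base :=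
  PT.comp (g := fun p : Base × SExp × List SExp × Bool => p.1)
    (f := fun a => ((f a).base, (f a).val, (f a).rules, (f a).universal))
    (by fun_prop) (PT.ruleData_view.comp hf)

@[fun_prop]
theorem PT.ruleData_val {f : α → RuleData} (hf : PT f) : PT fun a => (f a).val :=
  PT.comp (g := fun p : Base × SExp × List SExp × Bool => p.2.1)
    (f := fun a => ((f a).base, (f a).val, (f a).rules, (f a).universal))
    (by fun_prop) (PT.ruleData_view.comp hf)

@[fun_prop]
theorem PT.rules {f : α → RuleData} (hf : PT f) : PT fun a => (f a).rules :=
  PT.comp (g := fun p : Base × SExp × List SExp × Bool => p.2.2.1)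
    (f := fun a => ((f a).base, (f a).val, (f a).rules, (f a).universal))
    (by fun_prop) (PT.ruleData_view.comp hf)

@[fun_prop]
theorem PT.universal {f : α → RuleData} (hf : PT f) : PT fun a => (f a).universal :=
  PT.comp (g := fun p : Base × SExp × List SExp × Bool => p.2.2.2)
    (f := fun a => ((f a).base, (f a).val, (f a).rules, (f a).universal))
    (by fun_prop) (PT.ruleData_view.comp hf)

@[fun_prop]
theorem PT.body {D : α → RuleData} {η : α → List SExp} (hD : PT D) (hη : PT η) :
    PT fun a => (D a).body (η a) := by
  unfold RuleData.body; fun_prop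

/-- The number of argument tuples and of their prefixes. -/
def nodes : List (List SExp) → ℕ
  | [] => 1
  | R :: Rs => 1 + R.length * nodes Rs

theorem nodes_pos (Rs : List (List SExp)) : 0 < nodes Rs := by cases Rs <;> simp [nodes]

theorem RuleData.esz_base_le (D : RuleData) : esz D.base ≤ esz D := by
  rw [show esz D = esz (D.base, D.val, D.rules, D.universal) from rfl, esz_pair]
  omega

theorem len_body_le (D : RuleData) (η : List SExp) : (D.body η).len ≤ esz D.base := by
  have h2 : esz D.base = esz D.base.aut + (esz D.base.clauses + esz D.base.ground + 1) + 1 := by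
    rw [show esz D.base = esz (D.base.aut, D.base.clauses, D.base.ground) from rfl, esz_pair,
      esz_pair]
  rw [RuleData.body]
  cases D.val.isCons
  · simp; omega
  · exact (len_ofList_filter_le _ _).trans (by omega)

theorem len_table_le (D : RuleData) (Rs : List (List SExp)) (η : List SExp) :
    (D.table Rs η).len ≤ nodes Rs * (esz Rs + esz D.base) := by
  induction Rs generalizing η with
  | nil => have := len_body_le D η; simp [RuleData.table, nodes]; omega
  | cons R Rs ih =>
    rw [RuleData.table, len_ofList]
    refine (esz_le_of_forall (m := esz R + nodes Rs * (esz Rs + esz D.base)) fun x hx => ?_).trans ?_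
    · simp only [List.mem_map] at hx
      obtain ⟨y, hy, rfl⟩ := hx
      have h1 := esz_le_of_mem hy
      have h2 := ih (η ++ [y])
      simp at h1 ⊢
      omega
    · have h1 := nodes_pos Rs
      have h2 := esz_pos R
      rw [List.length_map, nodes, esz_cons]
      have h3 : R.length * (esz R + 1) ≤ R.length * (nodes Rs * (esz R + 1)) := by
        gcongr; exact Nat.le_mul_of_pos_left _ h1
      nlinarith

/-- In the recursion each call carries the key under which its result is stored, so that the results
of the calls are already the entries of the table. The outermost call gets the key `nil`, which is
stripped at the end. -/
theorem TC.table : TC (fun p : RuleData × List (List SExp) => p.1.table p.2 [])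
    fun p => nodes p.2 := by
  -- The weights make `X` non-increasing along calls: a member of the first domain enters the key
  -- once and the prefix with weight 3, and the removal of that domain frees 4 times its size.
  let X : SExp × (List (List SExp) × List SExp) × RuleData → ℕ := fun p =>
    4 + p.1.len + 3 * esz p.2.1.2 + 4 * esz p.2.1.1 + 2 * esz p.2.2
  have h1 : TC (fun p : SExp × (List (List SExp) × List SExp) × RuleData =>
      SExp.cons p.1 (p.2.2.table p.2.1.1 p.2.1.2))
      fun p => (p.2.1.1.length + 1) * (nodes p.2.1.1 * (2 * X p)) := by
    refine PT.hylo (ch := fun p => p.2.1.1.headD [] |>.map fun x =>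
        (x, (p.2.1.1.tail, p.2.1.2 ++ [x]), p.2.2))
      (cb := fun q => SExp.cons q.1.1 (bif q.1.2.1.1.isEmpty then q.1.2.2.body q.1.2.1.2
        else SExp.ofList q.2)) (by fun_prop) (by fun_prop) _ ?_ ?_
    · rintro ⟨k, ⟨_ | ⟨R, Rs⟩, η⟩, D⟩
      · simp [RuleData.table]
      · simp [RuleData.table, Function.comp_def]
    · rintro ⟨k, ⟨Rs, η⟩, D⟩
      have h2 := (len_table_le D Rs η).trans
        (Nat.mul_le_mul_left _ (Nat.add_le_add_left D.esz_base_le (esz Rs)))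
      have h3 : 1 + esz (k, (Rs, η), D) + esz (SExp.cons k (D.table Rs η)) ≤
          nodes Rs * (2 * X (k, (Rs, η), D)) := by
        have h4 := nodes_pos Rs
        have h5 : 2 * k.len + esz Rs + esz η + esz D + 5 ≤
            nodes Rs * (2 * k.len + esz Rs + esz η + esz D + 5) := Nat.le_mul_of_pos_left _ h4
        have h6 : nodes Rs * (2 * k.len + esz Rs + esz η + esz D + 5) +
            nodes Rs * (esz Rs + esz D) ≤ nodes Rs * (2 * X (k, (Rs, η), D)) := by
          rw [← mul_add]
          refine Nat.mul_le_mul_left _ ?_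
          simp only [X]
          omega
        simp only [esz_pair, esz_sexp, SExp.len_cons]
        omega
      cases Rs with
      | nil => simpa using h3
      | cons R Rs =>
        have h4 : ∀ x ∈ R, (Rs.length + 1) * (nodes Rs * (2 * X (x, (Rs, η ++ [x]), D))) ≤
            (Rs.length + 1) * (nodes Rs * (2 * X (k, (R :: Rs, η), D))) := by
          intro x hx
          have h5 := esz_le_of_mem hx
          have h6 := esz_append η [x]
          gcongr 3
          simp only [X, esz_cons, esz_nil, esz_sexp] at h5 h6 ⊢
          omega
        have h5 : ((R.map fun x => (x, (Rs, η ++ [x]), D)).map fun p :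
            SExp × (List (List SExp) × List SExp) × RuleData =>
            (p.2.1.1.length + 1) * (nodes p.2.1.1 * (2 * X p))).sum ≤
            R.length * ((Rs.length + 1) * (nodes Rs * (2 * X (k, (R :: Rs, η), D)))) := by
          rw [List.map_map]
          clear h2 h3
          generalize (Rs.length + 1) * (nodes Rs * (2 * X (k, (R :: Rs, η), D))) = Y at h4 ⊢
          induction R with
          | nil => simp
          | cons x R ih =>
            have h7 := h4 x (by simp)
            have h8 := ih fun y hy => h4 y (by simp [hy])
            rw [List.map_cons, List.sum_cons, List.length_cons, Nat.succ_mul, add_comm]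
            exact Nat.add_le_add h8 h7
        have h6 : R.length * ((Rs.length + 1) * (nodes Rs * (2 * X (k, (R :: Rs, η), D)))) ≤
            (Rs.length + 1) * (nodes (R :: Rs) * (2 * X (k, (R :: Rs, η), D))) := by
          calc _ = (Rs.length + 1) * ((R.length * nodes Rs) * (2 * X (k, (R :: Rs, η), D))) := by
                ring
            _ ≤ _ := by gcongr; rw [nodes]; omega
        simp only [List.headD_cons, List.tail_cons, List.length_cons]
        rw [add_one_mul (Rs.length + 1)]
        omega
  have h2 := (PT.tl (f := fun x : SExp => x) PT.id).tc (fun _ => 0) |>.comp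
    (h1.comp (f := fun p : RuleData × List (List SExp) =>
    (SExp.nil, (p.2, ([] : List SExp)), p.1)) (S := fun _ => 0) (by change PT _; fun_prop))
  refine TC.mono h2 ?_
  have e1 : PB (fun p : RuleData × List (List SExp) => nodes p.2 + esz p) esz :=
    .of_le fun p => by omega
  have e2 : PB (fun p : RuleData × List (List SExp) => nodes p.2 + esz p) fun p => esz p.2 :=
    .of_le fun p => by rw [esz_prod]; omega
  have e3 : PB (fun p : RuleData × List (List SExp) => nodes p.2 + esz p) fun p => esz p.1 :=
    .of_le fun p => by rw [esz_prod]; omega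
  have e4 : PB (fun p : RuleData × List (List SExp) => nodes p.2 + esz p) fun p => p.2.length :=
    e2.mono fun p => (length_lt_esz p.2).le
  have e5 : PB (fun p : RuleData × List (List SExp) => nodes p.2 + esz p) fun p => nodes p.2 :=
    .of_le fun p => by omega
  exact ((PB.const 0).add ((e4.add (.const 1)).mul (e5.mul ((PB.const 2).mul
    (((((PB.const 4).add (.const 1)).add (.const 3)).add ((PB.const 4).mul e2)).add
    ((PB.const 2).mul e3)))))).add (.const 0)

/-- In contrast to `PT.list_map`, `f` may be expensive. Running time and result size for each member
are polynomial in `W a` and the sizes, and the number of members is bounded by the size of the list.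
-/
theorem TC.list_map {f : α → γ → δ} {Sf : α × γ → ℕ} (hf : TC (fun p : α × γ => f p.1 p.2) Sf)
    {l : α → List γ} {Sl : α → ℕ} (hl : TC l Sl) (W : α → ℕ)
    (hW : ∀ a, ∀ x ∈ l a, Sf (a, x) ≤ W a) :
    TC (fun a => (l a).map (f a)) fun a => Sl a + W a := by
  obtain ⟨c, hc⟩ := hf.size
  let w : α → γ → ℕ := fun a x => (Sf (a, x) + esz (a, x) + 2) ^ c + 1 + Sf (a, x)
  have h1 : TC (fun p : List γ × α => p.1.foldr (fun x r => f p.2 x :: r) [])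
      fun p => 1 + (p.1.map fun x => w p.2 x).sum := by
    refine TC.foldr (b := fun _ => []) (h := fun q : α × γ × List δ => f q.1 q.2.1 :: q.2.2)
      (Sb := fun _ => 0) (Sh := fun q => Sf (q.1, q.2.1)) (PT.const _) ?_ _ ?_ ?_ (by simp) ?_
    · refine (TC.comp (g := fun q : δ × α × γ × List δ => q.1 :: q.2.2.2) (S' := fun _ => 0)
        (by change PT _; fun_prop) (TC.pair (hf.comp
        (f := fun q : α × γ × List δ => (q.1, q.2.1)) (S := fun _ => 0) (by change PT _; fun_prop))
        (PT.id.tc fun _ => 0))).of_le fun _ => by simp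
    · intro x l e
      simp
    · intro l e
      induction l with
      | nil => simp
      | cons x l ih =>
        have := hc (e, x)
        simp only [List.foldr_cons, esz_cons, List.map_cons, List.sum_cons, w] at ih ⊢
        dsimp only at this
        omega
    · intro x l e
      simp only [List.map_cons, List.sum_cons, w]
      omega
  refine ((h1.comp (f := fun a => (l a, a)) (TC.pair hl (PT.id.tc fun _ => 0))).congr
    fun a => ?_).mono ?_
  · simp only
    induction l a with
    | nil => rfl
    | cons x l ih => rw [List.foldr_cons, ih]; rfl
  · obtain ⟨d, hd⟩ := hl.size
    have e0 : PB (fun a => Sl a + W a + esz a) (fun a => (Sl a + esz a + 2) ^ d) :=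
      PB.pow (PB.add (.of_le fun a => by omega) (.const 2)) d
    have e1 : PB (fun a => Sl a + W a + esz a) (fun a => W a + esz a) := .of_le fun a => by omega
    have e2 : PB (fun a => Sl a + W a + esz a) W := .of_le fun a => by omega
    have e3 : PB (fun a => Sl a + W a + esz a) Sl := .of_le fun a => by omega
    refine PB.mono (T := fun a => Sl a + (1 + (Sl a + esz a + 2) ^ d *
      ((W a + esz a + (Sl a + esz a + 2) ^ d + 3) ^ c + 1 + W a)))
      (e3.add ((PB.const 1).add (e0.mul (((((e1.add e0).add (.const 3)).pow c).add
      (.const 1)).add e2)))) fun a => ?_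
    have h2 : ((l a).map fun x => w a x).sum ≤ (l a).length *
        ((W a + esz a + (Sl a + esz a + 2) ^ d + 3) ^ c + 1 + W a) := by
      have h3 : ∀ x ∈ l a, w a x ≤ (W a + esz a + (Sl a + esz a + 2) ^ d + 3) ^ c + 1 + W a := by
        intro x hx
        have h4 := hW a x hx
        have h5 := esz_le_of_mem hx
        have h6 := hd a
        dsimp only at h6
        simp only [w, esz_pair]
        exact Nat.add_le_add (Nat.add_le_add_right (Nat.pow_le_pow_left (by omega) c) 1) h4
      generalize l a = l' at h3
      clear hd
      induction l' with
      | nil => simp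
      | cons x l' ih =>
        have h7 := h3 x (by simp)
        have h8 := ih fun y hy => h3 y (by simp [hy])
        simp only [List.map_cons, List.sum_cons, List.length_cons, add_one_mul]
        omega
    have h3 := length_lt_esz (l a)
    have h4 := hd a
    dsimp only at h4 ⊢
    have h5 : (l a).length * ((W a + esz a + (Sl a + esz a + 2) ^ d + 3) ^ c + 1 + W a) ≤
      (Sl a + esz a + 2) ^ d * ((W a + esz a + (Sl a + esz a + 2) ^ d + 3) ^ c + 1 + W a) := by
      gcongr
      omega
    omega

theorem TC.rhsVal : TC (fun p : (Base × List NTData) × List SExp => rhsVal p.1 p.2)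
    fun p => (p.1.2.map fun F => nodes F.1).sum := by
  let f (p : (Base × List NTData) × List SExp) (F : NTData) : SExp :=
    RuleData.table ⟨p.1.1, .ofList p.2, F.2.1, F.2.2⟩ F.1 []
  have h1 : PT fun q : ((Base × List NTData) × List SExp) × NTData =>
      (q.1.1.1, SExp.ofList q.1.2, q.2.2.1, q.2.2.2) := by fun_prop
  have h2 : PT fun q : ((Base × List NTData) × List SExp) × NTData =>
      RuleData.mk q.1.1.1 (SExp.ofList q.1.2) q.2.2.1 q.2.2.2 :=
    PT.comp (g := fun p : Base × SExp × List SExp × Bool => RuleData.mk p.1 p.2.1 p.2.2.1 p.2.2.2)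
      (PT.of_enc_eq fun _ => rfl) h1
  have h3 : PT fun q : ((Base × List NTData) × List SExp) × NTData => q.2.1 := by fun_prop
  have h4 : TC (fun q : ((Base × List NTData) × List SExp) × NTData => f q.1 q.2)
      fun q => 0 + nodes q.2.1 := TC.table.comp (S := fun _ => 0) (h2.pair h3)
  have h5 : PT fun p : (Base × List NTData) × List SExp => p.1.2 := by fun_prop
  refine ((h4.list_map (Sl := fun _ => 0) h5
    (fun p => (p.1.2.map fun F => nodes F.1).sum) fun p F hF => ?_)).of_le fun p => ?_
  · rw [zero_add]
    exact List.le_sum_of_mem (List.mem_map_of_mem hF)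
  · rw [zero_add]

end

end HOGame

namespace HOGame

/-! ### Towers -/

theorem tower_mono (j : ℕ) : Monotone (tower j) := by
  induction j with
  | zero => exact monotone_id
  | succ j ih => exact fun a b h => Nat.pow_le_pow_right two_pos (ih h)

theorem le_tower (j n : ℕ) : n ≤ tower j n := by
  induction j with
  | zero => exact le_rfl
  | succ j ih => exact ih.trans Nat.lt_two_pow_self.le

theorem tower_le_tower {i j : ℕ} (h : i ≤ j) {a b : ℕ} (hab : a ≤ b) : tower i a ≤ tower j b := by
  refine (tower_mono i hab).trans ?_
  induction h with
  | refl => exact le_rfl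
  | step _ ih => exact ih.trans Nat.lt_two_pow_self.le

theorem tower_pos (j : ℕ) {n : ℕ} (h : 0 < n) : 0 < tower j n := h.trans_le (le_tower j n)

theorem two_pow_add_two_pow_le {x y : ℕ} (hx : 0 < x) (hy : 0 < y) : 2 ^ x + 2 ^ y ≤ 2 ^ (x + y) := by
  rw [pow_add]
  have h1 : 2 ^ 1 ≤ 2 ^ x := Nat.pow_le_pow_right two_pos hx
  have h2 : 2 ^ 1 ≤ 2 ^ y := Nat.pow_le_pow_right two_pos hy
  nlinarith

theorem tower_add_le (j : ℕ) {a b : ℕ} (ha : 0 < a) (hb : 0 < b) :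
    tower j a + tower j b ≤ tower j (a + b) := by
  induction j with
  | zero => exact le_rfl
  | succ j ih =>
    exact (two_pow_add_two_pow_le (tower_pos j ha) (tower_pos j hb)).trans
      (Nat.pow_le_pow_right two_pos ih)

theorem tower_mul_le (j : ℕ) {a b : ℕ} (ha : 0 < a) (hb : 0 < b) :
    tower (j + 1) a * tower (j + 1) b ≤ tower (j + 1) (a + b) := by
  rw [tower, tower, ← pow_add]
  exact Nat.pow_le_pow_right two_pos (tower_add_le j ha hb)

theorem tower_pow_le (j c : ℕ) {a : ℕ} (ha : 0 < a) :
    tower (j + 1) a ^ (c + 1) ≤ tower (j + 1) ((c + 1) * a) := by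
  induction c with
  | zero => simp
  | succ c ih =>
    rw [pow_succ, add_one_mul (c + 1)]
    exact (Nat.mul_le_mul_right _ ih).trans (tower_mul_le j (by positivity) ha)

theorem tower_sum_le {ι : Type} (j : ℕ) (s : Finset ι) (f : ι → ℕ) (hf : ∀ i, 0 < f i) :
    ∑ i ∈ s, tower j (f i) ≤ tower j (∑ i ∈ s, f i) := by
  classical
  induction s using Finset.induction_on with
  | empty => induction j with
    | zero => exact le_rfl
    | succ j ih => simp
  | insert i s hi ih =>
    rw [Finset.sum_insert hi, Finset.sum_insert hi]
    rcases s.eq_empty_or_nonempty with rfl | hs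
    · simp
    · exact (Nat.add_le_add_left ih _).trans
        (tower_add_le j (hf i) (Finset.sum_pos (fun i _ => hf i) hs))

/-- Functions that are bounded by a tower of height `k + 1` over a polynomial in `N`. -/
def TB {α : Type} (k N f : α → ℕ) : Prop := ∃ c, ∀ a, f a ≤ tower (k a + 1) ((N a + 2) ^ c)

section TB
variable {α : Type} {k N f g : α → ℕ}

theorem TB.mono (hg : TB k N g) (h : ∀ a, f a ≤ g a) : TB k N f :=
  hg.imp fun _ hc a => (h a).trans (hc a)

theorem TB.of_tower {e : α → ℕ} (he : PB N e) (h : ∀ a, f a ≤ tower (k a + 1) (e a)) :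
    TB k N f := by
  obtain ⟨c, hc⟩ := he
  exact ⟨c, fun a => (h a).trans (tower_mono _ (hc a))⟩

theorem TB.of_PB (h : PB N f) : TB k N f := .of_tower h fun _ => le_tower _ _

/-- The towers have height at least one, so a product becomes a sum in the exponent, and sums can be
moved down to the polynomial. Hence polynomials in such functions stay within the class. -/
theorem TB.mul (hf : TB k N f) (hg : TB k N g) : TB k N fun a => f a * g a := by
  obtain ⟨c, hc⟩ := hf
  obtain ⟨d, hd⟩ := hg
  refine .of_tower (e := fun a => (N a + 2) ^ c + (N a + 2) ^ d) (.add ⟨c, fun _ => le_rfl⟩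
    ⟨d, fun _ => le_rfl⟩) fun a => ?_
  exact (Nat.mul_le_mul (hc a) (hd a)).trans (tower_mul_le _ (by positivity) (by positivity))

theorem TB.add (hf : TB k N f) (hg : TB k N g) : TB k N fun a => f a + g a := by
  obtain ⟨c, hc⟩ := hf
  obtain ⟨d, hd⟩ := hg
  refine .of_tower (e := fun a => (N a + 2) ^ c + (N a + 2) ^ d) (.add ⟨c, fun _ => le_rfl⟩
    ⟨d, fun _ => le_rfl⟩) fun a => ?_
  exact (Nat.add_le_add (hc a) (hd a)).trans (tower_add_le _ (by positivity) (by positivity))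

theorem TB.const (n : ℕ) : TB k N fun _ => n := .of_PB (.const n)

theorem TB.pow (hf : TB k N f) (n : ℕ) : TB k N fun a => f a ^ n := by
  induction n with
  | zero => exact (TB.const 1).mono fun a => by simp
  | succ n ih => exact (ih.mul hf).mono fun a => by rw [pow_succ]

theorem TB.trans (hg : TB k N g) (hf : PB g f) : TB k N f := by
  obtain ⟨c, hc⟩ := hf
  exact ((hg.add (.const 2)).pow c).mono hc

end TB

/-! ### Sizes of domains -/

theorem Kind.size_pos (κ : Kind) : 0 < κ.size := by cases κ <;> simp [Kind.size]

theorem finite_dom {D : Cppo} [Finite D.carrier] (κ : Kind) : Finite (Dom D κ).carrier := by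
  induction κ with
  | ground => assumption
  | arrow a b iha ihb =>
    have := iha
    have := ihb
    exact inferInstanceAs (Finite {f : (Dom D a).carrier → (Dom D b).carrier // MeetContinuous f})

/-- The order of `a → b` is at least the order of `b` and exceeds that of `a`, so both factors are
towers of the height on the right. Their product adds the arguments, and the sizes of `a` and `b`
add up to less than the size of `a → b`. -/
theorem tower_arrow_le {a b : Kind} {x : ℕ} (hx : 0 < x) (i : ℕ) :
    tower (a.order + i + 2) (x * a.size) * tower (b.order + i + 1) (x * b.size) ≤
      tower ((Kind.arrow a b).order + i + 1) (x * (Kind.arrow a b).size) := by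
  have h1 : a.order + 1 ≤ (Kind.arrow a b).order := le_max_left _ _
  have h2 : b.order ≤ (Kind.arrow a b).order := le_max_right _ _
  calc _ ≤ tower ((Kind.arrow a b).order + i + 1) (x * a.size) *
        tower ((Kind.arrow a b).order + i + 1) (x * b.size) :=
        Nat.mul_le_mul (tower_le_tower (by omega) le_rfl) (tower_le_tower (by omega) le_rfl)
    _ ≤ tower ((Kind.arrow a b).order + i + 1) (x * a.size + x * b.size) :=
        tower_mul_le _ (Nat.mul_pos hx a.size_pos) (Nat.mul_pos hx b.size_pos)
    _ ≤ _ := tower_mono _ (by rw [← mul_add]; exact Nat.mul_le_mul_left _ (by simp [Kind.size]))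

section Sizes
variable (A : Automaton)

instance (κ : Kind) : Finite (Dom A.optGround κ).carrier := finite_dom κ

/-- A function is determined by its values. Writing the bound for `b` as a power of two turns the
exponentiation into a product in the exponent, to which `tower_arrow_le` applies. -/
theorem card_dom_le (κ : Kind) : Nat.card (Dom A.optGround κ) ≤
    tower (κ.order + 2) ((A.numStates + 1) * κ.size) := by
  induction κ with
  | ground =>
    refine (Nat.card_le_card_of_injective (β := Set (Set (Fin A.numStates)))
      (fun M : A.OptGround => M.1) fun _ _ => Subtype.ext).trans ?_
    simp only [Nat.card_eq_fintype_card, Fintype.card_set, Fintype.card_fin]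
    exact tower_mono 2 (by simp [Kind.size])
  | arrow a b iha ihb =>
    have h1 : Nat.card (Dom A.optGround (.arrow a b)) ≤
        Nat.card (Dom A.optGround b) ^ Nat.card (Dom A.optGround a) := by
      rw [← Nat.card_fun]
      exact Nat.card_le_card_of_injective
        (fun f : {f : Dom A.optGround a → Dom A.optGround b // MeetContinuous f} => f.1)
        fun _ _ => Subtype.ext
    refine h1.trans ((Nat.pow_le_pow_left ihb _).trans ?_)
    rw [tower, ← pow_mul]
    refine Nat.pow_le_pow_right two_pos ?_
    rw [mul_comm]
    exact (Nat.mul_le_mul_right _ iha).trans (tower_arrow_le (Nat.succ_pos _) 0)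

/-- The rank is the number of satisfying assignments for the ground kind, and the sum of the ranks
of all values for a function. The cardinality of the argument domain enters only as a factor, which
saves one exponential compared with the cardinality of the function domain. -/
theorem exists_rank (κ : Kind) : ∃ r : Dom A.optGround κ → ℕ, StrictMono r ∧
    ∀ x, r x ≤ tower (κ.order + 1) ((A.numStates + 1) * κ.size) := by
  classical
  induction κ with
  | ground =>
    refine ⟨fun M => (Subtype.val (p := fun M => ∃ φ, M = A.resolve φ) M).ncard, fun M M' h => ?_,
      fun M => ?_⟩
    · exact Set.ncard_lt_ncard h (Set.toFinite _)
    · refine (Set.ncard_le_card _).trans ?_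
      simp only [Nat.card_eq_fintype_card, Fintype.card_set, Fintype.card_fin]
      exact tower_mono 1 (by simp [Kind.size])
  | arrow a b _ ihb =>
    obtain ⟨r, hr, hb⟩ := ihb
    have := Fintype.ofFinite (Dom A.optGround a)
    refine ⟨fun f => ∑ d, r (f.1 d), fun f g h => ?_, fun f => ?_⟩
    · have h1 : ∀ d, f.1 d ≤ g.1 d := h.le
      refine Finset.sum_lt_sum (fun d _ => hr.monotone (h1 d)) ?_
      -- If no value had a strictly larger rank, strictness of `r` would force all values to agree,
      -- and hence the functions.
      by_contra! h2
      refine h.ne (Subtype.ext (funext fun d => ?_))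
      by_contra h3
      exact absurd (hr (lt_of_le_of_ne (h1 d) h3)) (h2 d (Finset.mem_univ d)).not_gt
    · refine (Finset.sum_le_card_nsmul _ _ _ fun d _ => hb (f.1 d)).trans ?_
      rw [smul_eq_mul, Finset.card_univ, ← Nat.card_eq_fintype_card]
      exact (Nat.mul_le_mul_right _ (card_dom_le A a)).trans (tower_arrow_le (Nat.succ_pos _) 0)

theorem chain_length_le (κ : Kind) (m : ℕ) (x : Fin (m + 1) → Dom A.optGround κ)
    (hx : StrictAnti x) : m + 1 ≤ tower (κ.order + 1) ((A.numStates + 1) * κ.size + 1) := by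
  obtain ⟨r, hr, hb⟩ := exists_rank A κ
  have h1 : ∀ i : ℕ, ∀ h : i ≤ m, r (x ⟨i, by omega⟩) + i ≤ r (x 0) := by
    intro i
    induction i with
    | zero => exact fun _ => le_rfl
    | succ i ih =>
      intro h
      have h2 := ih (by omega)
      have h3 : r (x ⟨i + 1, by omega⟩) < r (x ⟨i, by omega⟩) := hr (hx (by simp))
      omega
  have h2 := h1 m le_rfl
  have h3 := hb (x 0)
  have h4 := tower_add_le (κ.order + 1) (a := (A.numStates + 1) * κ.size) (b := 1)
    (Nat.mul_pos (Nat.succ_pos _) κ.size_pos) one_pos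
  have h5 := tower_pos (κ.order + 1) one_pos
  omega

end Sizes

/-! ### Kleene iteration -/

theorem DetScheme.isGLB_sol {T N : Type} {tk : T → Kind} {D : Cppo} (H : DetScheme tk N)
    (I : ∀ t : T, Dom D (tk t)) : IsGLB (Set.range (H.approx I)) (H.sol I) :=
  (H.exists_sol I).choose_spec

theorem SExp.len_ofList_le_of_mem {l : List SExp} {x : SExp} (h : x ∈ l) :
    x.len + 2 ≤ (SExp.ofList l).len := by
  rw [len_ofList]
  simpa using esz_le_of_mem h

theorem SExp.len_ofNat (n : ℕ) : (SExp.ofNat n).len = 2 * n + 1 := by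
  induction n with
  | zero => rfl
  | succ n ih =>
    rw [SExp.ofNat] at ih ⊢
    rw [List.replicate_succ, SExp.ofList, SExp.len_cons, ih]
    simp
    omega

theorem SExp.len_ofFn {n : ℕ} (f : Fin n → SExp) :
    (SExp.ofFn f).len = 1 + ∑ i, ((f i).len + 1) := by
  rw [SExp.ofFn, len_ofList, esz_list, List.map_ofFn, List.sum_ofFn]
  simp

theorem Kind.len_code (κ : Kind) : κ.code.len = κ.size := by
  induction κ with
  | ground => rfl
  | arrow a b iha ihb => simp [Kind.code, Kind.size, iha, ihb]

section Game
variable (G : Game)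

theorem Game.len_le_input {x : SExp} (hx : x ∈ [G.aut.code, SExp.ofNat G.numNonterminals,
    SExp.ofFn fun F => (G.scheme.nkind F).code,
    SExp.ofNat G.scheme.start,
    SExp.ofFn fun F => SExp.ofList ((G.scheme.rules F).map Term.code),
    SExp.ofFn fun F => (G.owner F).code]) : x.len + 2 ≤ G.input.length :=
  SExp.len_ofList_le_of_mem hx

theorem Game.numStates_le_input : G.aut.numStates + 1 ≤ G.input.length := by
  have h1 := G.len_le_input (x := G.aut.code) (by simp)
  have h2 : (SExp.ofNat G.aut.numStates).len + 2 ≤ G.aut.code.len :=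
    SExp.len_ofList_le_of_mem (by simp)
  rw [SExp.len_ofNat] at h2
  omega

theorem Game.sum_size_le_input : ∑ F, ((G.scheme.nkind F).size + 1) ≤ G.input.length := by
  have h1 := G.len_le_input (x := SExp.ofFn fun F => (G.scheme.nkind F).code) (by simp)
  simp only [SExp.len_ofFn, Kind.len_code] at h1
  omega

theorem Game.nkind_order_le (F) : (G.scheme.nkind F).order ≤ G.order :=
  Finset.le_sup (f := fun F => (G.scheme.nkind F).order) (Finset.mem_univ F)

theorem Game.iterate_eq (i : ℕ) : G.optRhs^[i] ⊤ = G.scheme.det.approx G.optInterp i := by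
  induction i with
  | zero => rfl
  | succ i ih => rw [Function.iterate_succ_apply', ih]; rfl

theorem Game.optRhs_mono : Monotone G.optRhs := (G.scheme.det.rhs_continuous G.optInterp).monotone

theorem Game.iterate_antitone : Antitone fun i => G.optRhs^[i] ⊤ := by
  refine antitone_nat_of_succ_le fun n => ?_
  rw [Function.iterate_succ_apply]
  exact G.optRhs_mono.iterate n le_top

/-- Kleene iteration becomes stable after at most this number of steps. -/
def Game.height : ℕ :=
  ∑ F, tower ((G.scheme.nkind F).order + 1) ((G.aut.numStates + 1) * (G.scheme.nkind F).size)

/-- The sum of towers is bounded by a tower over the sum of the arguments. That sum is linear in the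
number of states times the total size of the kinds, and both factors occur in the code. -/
theorem Game.height_le : G.height ≤ tower (G.order + 1) (G.input.length ^ 2) := by
  calc _ ≤ ∑ F, tower (G.order + 1) ((G.aut.numStates + 1) * (G.scheme.nkind F).size) :=
        Finset.sum_le_sum fun F _ => tower_le_tower (by have := G.nkind_order_le F; omega) le_rfl
    _ ≤ tower (G.order + 1) (∑ F, (G.aut.numStates + 1) * (G.scheme.nkind F).size) :=
        tower_sum_le _ _ _ fun F => Nat.mul_pos (Nat.succ_pos _) (Kind.size_pos _)
    _ ≤ _ := by
        refine tower_mono _ ?_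
        rw [← Finset.mul_sum, sq]
        refine Nat.mul_le_mul G.numStates_le_input (le_trans ?_ G.sum_size_le_input)
        exact Finset.sum_le_sum fun F _ => Nat.le_succ _

/-- As long as the iteration is not stable, the sum of the ranks over all non-terminals drops by at
least one, and it starts at most at `G.height`. -/
theorem Game.exists_stable : ∃ i ≤ G.height, G.optRhs (G.optRhs^[i] ⊤) = G.optRhs^[i] ⊤ := by
  choose r hr hb using fun F => exists_rank G.aut (G.scheme.nkind F)
  by_contra! h
  have h1 : ∀ i ≤ G.height + 1, (∑ F, r F (G.optRhs^[i] ⊤ F)) + i ≤ ∑ F, r F ⊤ := by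
    intro i
    induction i with
    | zero => exact fun _ => le_rfl
    | succ i ih =>
      intro hi
      have h2 := ih (by omega)
      have h3 : G.optRhs^[i + 1] ⊤ ≤ G.optRhs^[i] ⊤ := G.iterate_antitone (Nat.le_succ i)
      have h4 : ∑ F, r F (G.optRhs^[i + 1] ⊤ F) < ∑ F, r F (G.optRhs^[i] ⊤ F) := by
        refine Finset.sum_lt_sum (fun F _ => (hr F).monotone (h3 F)) ?_
        by_contra! h5
        refine h i (by omega) ?_
        rw [← Function.iterate_succ_apply' G.optRhs]
        refine funext fun F => ?_
        by_contra h6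
        exact absurd (hr F (lt_of_le_of_ne (h3 F) h6)) (h5 F (Finset.mem_univ F)).not_gt
      omega
  have h2 := h1 _ le_rfl
  have h3 : ∑ F, r F ⊤ ≤ G.height := Finset.sum_le_sum fun F _ => hb F ⊤
  omega

theorem Game.iterate_eq_of_stable {i : ℕ} (h : G.optRhs (G.optRhs^[i] ⊤) = G.optRhs^[i] ⊤) {m : ℕ}
    (hm : i ≤ m) : G.optRhs^[m] ⊤ = G.optRhs^[i] ⊤ := by
  induction hm with
  | refl => rfl
  | step _ ih => rw [Function.iterate_succ_apply', ih, h]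

theorem Game.iterate_eq_optSol {i : ℕ} (h : G.optRhs (G.optRhs^[i] ⊤) = G.optRhs^[i] ⊤) :
    G.optRhs^[i] ⊤ = G.optSol := by
  have h1 : IsGLB (Set.range fun i => G.optRhs^[i] ⊤) G.optSol := by
    rw [show (fun i => G.optRhs^[i] ⊤) = G.scheme.det.approx G.optInterp from
      funext G.iterate_eq]
    exact G.scheme.det.isGLB_sol G.optInterp
  refine IsGLB.unique (isGLB_range_iff.2 ⟨fun m => ?_, fun x hx => hx i⟩) h1
  rcases le_total i m with hm | hm
  · exact (G.iterate_eq_of_stable h hm).ge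
  · exact G.iterate_antitone hm

theorem Game.exists_iterate_eq_optSol : ∃ i ≤ G.height, G.optRhs^[i] ⊤ = G.optSol ∧
    G.optRhs (G.optRhs^[i] ⊤) = G.optRhs^[i] ⊤ := by
  obtain ⟨i, hi, h⟩ := G.exists_stable
  exact ⟨i, hi, G.iterate_eq_optSol h, h⟩

/-- A fixed point lies below `⊤`, hence by monotonicity below every iterate, and `G.optSol` is one
of the iterates. -/
theorem Game.isGreatest_optSol : IsGreatest {ν : G.OptVal | G.optRhs ν = ν} G.optSol := by
  obtain ⟨i, -, h1, h2⟩ := G.exists_iterate_eq_optSol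
  refine ⟨?_, fun ν hν => ?_⟩
  · rw [Set.mem_ofPred_eq, ← h1, h2]
  · rw [← h1]
    have h3 : ∀ j, ν ≤ G.optRhs^[j] ⊤ := fun j => by
      induction j with
      | zero => exact fun F => le_top
      | succ j ih =>
        rw [Function.iterate_succ_apply', ← (show G.optRhs ν = ν from hν)]
        exact G.optRhs_mono ih
    exact h3 i

end Game

end HOGame

namespace HOGame
open _root_.HOGame.Enc (enc)

/-! ### The generated clauses -/

theorem SExp.ofNat_injective : Function.Injective SExp.ofNat := fun a b h => by
  have := congrArg SExp.len h
  rw [SExp.len_ofNat, SExp.len_ofNat] at this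
  omega

theorem length_toList_ofNat (n : ℕ) : (SExp.ofNat n).toList.length = n := by
  simp [SExp.ofNat]

theorem nth_ofList (l : List SExp) (i : ℕ) (h : i < l.length) :
    nth (.ofList l) (.ofNat i) = l[i] := by
  rw [nth, length_toList_ofNat, SExp.toList_ofList, List.drop_eq_getElem_cons h]
  rfl

theorem nth_ofFn {n : ℕ} (f : Fin n → SExp) (i : Fin n) : nth (.ofFn f) (.ofNat i) = f i := by
  rw [SExp.ofFn, nth_ofList _ _ (by simp)]
  simp

/-- In a list without repetitions a sublist is determined by its members. So the sublists of the
list of states are unique codes for sets of states. -/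
theorem List.Sublist.eq_filter_mem {α : Type} [DecidableEq α] {l L : List α} (h : l.Sublist L)
    (hL : L.Nodup) : l = L.filter fun x => decide (x ∈ l) := by
  induction h with
  | slnil => rfl
  | @cons l₁ l₂ a h ih =>
    have ha : a ∉ l₁ := fun h' => (List.nodup_cons.1 hL).1 (h.subset h')
    rw [List.filter_cons_of_neg (by simpa using ha)]
    exact ih (List.nodup_cons.1 hL).2
  | @cons_cons l₁ l₂ a h ih =>
    have ha : a ∉ l₂ := (List.nodup_cons.1 hL).1
    rw [List.filter_cons_of_pos (by simp)]
    conv_lhs => rw [ih (List.nodup_cons.1 hL).2]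
    congr 1
    refine List.filter_congr fun x hx => ?_
    have : x ≠ a := fun h' => ha (h' ▸ hx)
    simp [this]

namespace Automaton

variable (A : Automaton)

/-- The code of a set of states. -/
def setCode (C : Fin A.numStates → Bool) : SExp :=
  .ofList (((List.finRange A.numStates).filter C).map fun q : Fin A.numStates => .ofNat q)

/-- The set of states with a given code. -/
def decode (s : SExp) : Fin A.numStates → Bool := fun q => memb (.ofNat q) s.toList

variable {A} in
theorem mem_setCode {C : Fin A.numStates → Bool} {q : Fin A.numStates} :
    SExp.ofNat q ∈ (A.setCode C).toList ↔ C q = true := by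
  simp only [setCode, SExp.toList_ofList, List.mem_map, List.mem_filter, List.mem_finRange,
    true_and]
  constructor
  · rintro ⟨p, hp, h⟩
    rwa [← Fin.ext (SExp.ofNat_injective h)]
  · exact fun h => ⟨q, h, rfl⟩

@[simp]
theorem decode_setCode (C : Fin A.numStates → Bool) : A.decode (A.setCode C) = C := by
  funext q
  rw [Bool.eq_iff_iff, decode, memb_iff, mem_setCode]

/-- The data of an automaton as used by the algorithm. -/
def data : AutData where
  states := (List.finRange A.numStates).map fun q : Fin A.numStates => .ofNat q
  letters := (List.finRange A.numLetters).map fun a : Fin A.numLetters => .ofNat a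
  trans := .ofFn fun q => .ofFn fun a => .ofFn fun q' => .ofBool (A.trans q a q')
  final := A.setCode A.final

/-- The predecessors of a set of states. -/
def preSet (a : Fin A.numLetters) (C : Fin A.numStates → Bool) : Fin A.numStates → Bool :=
  fun p => (List.finRange A.numStates).any fun q => A.trans p a q && C q

theorem filter_states (p : SExp → Bool) :
    SExp.ofList (A.data.states.filter p) = A.setCode fun q => p (.ofNat q) := by
  rw [data, List.filter_map]
  rfl

theorem data_tr (p : Fin A.numStates) (a : Fin A.numLetters) (q : Fin A.numStates) :
    A.data.tr (.ofNat p) (.ofNat a) (.ofNat q) = A.trans p a q := by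
  rw [AutData.tr, data, nth_ofFn, nth_ofFn, nth_ofFn]
  cases A.trans p a q <;> rfl

theorem data_pre (a : Fin A.numLetters) (C : Fin A.numStates → Bool) :
    A.data.pre (.ofNat a) (A.setCode C) = A.setCode (A.preSet a C) := by
  rw [AutData.pre, filter_states]
  congr 1
  funext p
  rw [setCode, SExp.toList_ofList, preSet, List.any_map, List.any_filter]
  simp only [Function.comp_def, data_tr, Bool.and_comm]

theorem data_union (C C' : Fin A.numStates → Bool) :
    A.data.union (A.setCode C) (A.setCode C') = A.setCode fun q => C q || C' q := by
  rw [AutData.union, filter_states]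
  congr 1
  funext q
  rw [Bool.eq_iff_iff]
  simp [mem_setCode]

theorem mem_subsets {s : SExp} : s ∈ A.data.subsets ↔ ∃ C, s = A.setCode C := by
  simp only [AutData.subsets, List.mem_map, List.mem_sublists']
  constructor
  · rintro ⟨l, hl, rfl⟩
    obtain ⟨l', hl', rfl⟩ := List.sublist_map_iff.1 hl
    refine ⟨fun q => decide (q ∈ l'), ?_⟩
    rw [setCode, ← List.Sublist.eq_filter_mem hl' (List.nodup_finRange _)]
  · rintro ⟨C, rfl⟩
    exact ⟨_, List.Sublist.map _ List.filter_sublist, rfl⟩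

/-- The sets of states generated by the final states under predecessors and unions. -/
inductive Clause : (Fin A.numStates → Bool) → Prop
  | final : Clause A.final
  | pre (a : Fin A.numLetters) {C} : Clause C → Clause (A.preSet a C)
  | union {C C'} : Clause C → Clause C' → Clause fun q => C q || C' q

/-- The list consists of the codes of the generated sets. -/
def ListsClauses (U : List SExp) : Prop := ∀ s, s ∈ U ↔ ∃ C, A.Clause C ∧ s = A.setCode C

theorem mem_clauseStep {S L : List SExp} {d : AutData} {c : SExp} :
    c ∈ d.clauseStep S L ↔ c ∈ S ∧ (c = d.final ∨ ∃ x ∈ L, (∃ a ∈ d.letters, c = d.pre a x) ∨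
      ∃ y ∈ L, c = d.union x y) := by
  simp [AutData.clauseStep]

theorem clause_of_mem_iterate (i : ℕ) {s : SExp}
    (h : s ∈ (A.data.clauseStep A.data.subsets)^[i] []) : ∃ C, A.Clause C ∧ s = A.setCode C := by
  induction i generalizing s with
  | zero => simp at h
  | succ i ih =>
    rw [Function.iterate_succ_apply', mem_clauseStep] at h
    rcases h.2 with rfl | ⟨x, hx, ⟨a, ha, rfl⟩ | ⟨y, hy, rfl⟩⟩
    · exact ⟨_, .final, rfl⟩
    · obtain ⟨C, hC, rfl⟩ := ih hx
      obtain ⟨a, -, rfl⟩ := List.mem_map.1 ha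
      exact ⟨_, .pre a hC, A.data_pre a C⟩
    · obtain ⟨C, hC, rfl⟩ := ih hx
      obtain ⟨C', hC', rfl⟩ := ih hy
      exact ⟨_, .union hC hC', A.data_union C C'⟩

theorem listsClauses_of_stable {i : ℕ}
    (h : A.data.clauseStep A.data.subsets ((A.data.clauseStep A.data.subsets)^[i] []) =
      (A.data.clauseStep A.data.subsets)^[i] []) :
    A.ListsClauses ((A.data.clauseStep A.data.subsets)^[i] []) := by
  refine fun s => ⟨A.clause_of_mem_iterate i, ?_⟩
  rintro ⟨C, hC, rfl⟩
  induction hC with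
  | final => rw [← h, mem_clauseStep]; exact ⟨A.mem_subsets.2 ⟨_, rfl⟩, .inl rfl⟩
  | pre a hC ih =>
    rw [← h, mem_clauseStep]
    exact ⟨A.mem_subsets.2 ⟨_, rfl⟩, .inr ⟨_, ih, .inl ⟨_, List.mem_map.2 ⟨a, List.mem_finRange a,
      rfl⟩, (A.data_pre a _).symm⟩⟩⟩
  | union hC hC' ih ih' =>
    rw [← h, mem_clauseStep]
    exact ⟨A.mem_subsets.2 ⟨_, rfl⟩, .inr ⟨_, ih, .inr ⟨_, ih', (A.data_union _ _).symm⟩⟩⟩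

theorem clauseStep_mono (d : AutData) (S : List SExp) {L L' : List SExp} (h : L ⊆ L') :
    (d.clauseStep S L).Sublist (d.clauseStep S L') := by
  refine List.monotone_filter_right S fun c hc => ?_
  simp only [Bool.or_eq_true, List.any_eq_true, SExp.eqb_iff] at hc ⊢
  rcases hc with hc | ⟨x, hx, hc | ⟨y, hy, hc⟩⟩
  · exact .inl hc
  · exact .inr ⟨x, h hx, .inl hc⟩
  · exact .inr ⟨x, h hx, .inr ⟨y, h hy, hc⟩⟩

/-- The iterates form an increasing chain of sublists of `S`. Each proper step increases the length,
and equal lengths imply equality, so `S.length` steps suffice. -/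
theorem clauseStep_stable (d : AutData) (S : List SExp) :
    d.clauseStep S ((d.clauseStep S)^[S.length] []) = (d.clauseStep S)^[S.length] [] := by
  have h1 : ∀ i, ((d.clauseStep S)^[i] []).Sublist ((d.clauseStep S)^[i + 1] []) := by
    intro i
    induction i with
    | zero => exact List.nil_sublist _
    | succ i ih =>
      rw [Function.iterate_succ_apply' _ i, Function.iterate_succ_apply' _ (i + 1)]
      exact clauseStep_mono d S ih.subset
  have h2 : ∀ i, i ≤ ((d.clauseStep S)^[i] []).length ∨
      d.clauseStep S ((d.clauseStep S)^[i] []) = (d.clauseStep S)^[i] [] := by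
    intro i
    induction i with
    | zero => exact .inl (Nat.zero_le _)
    | succ i ih =>
      by_cases h : d.clauseStep S ((d.clauseStep S)^[i] []) = (d.clauseStep S)^[i] []
      · right
        rw [Function.iterate_succ_apply' _ i, h, h]
      · left
        have h3 := (h1 i).length_le
        have h4 : ((d.clauseStep S)^[i] []).length ≠ ((d.clauseStep S)^[i + 1] []).length :=
          fun h5 => h (by
            rw [← Function.iterate_succ_apply' (d.clauseStep S)]
            exact ((h1 i).eq_of_length h5).symm)
        have := ih.resolve_right h
        omega
  have h3 : ∀ i, ((d.clauseStep S)^[i] []).Sublist S := by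
    intro i
    cases i with
    | zero => exact List.nil_sublist _
    | succ i =>
      rw [Function.iterate_succ_apply']
      exact List.filter_sublist
  rcases h2 S.length with h | h
  · have h4 := (h3 S.length).eq_of_length_le h
    rw [h4]
    have h5 := (h1 S.length).length_le
    rw [Function.iterate_succ_apply', h4] at h5
    exact List.filter_sublist.eq_of_length_le h5
  · exact h

/-! ### The ground domain -/

/-- The formula `M` is the conjunction of the clauses with the given codes. -/
def IsConj (s : List SExp) (M : Set (Set (Fin A.numStates))) : Prop :=
  ∀ v, v ∈ M ↔ ∀ x ∈ s, ∃ q ∈ v, A.decode x q = true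

/-- The clause with the code `c` follows from `M`. -/
def Implied (M : Set (Set (Fin A.numStates))) (c : SExp) : Prop :=
  {q | A.decode c q = false} ∉ M

variable {A}

/-- The complement of `c` is the largest assignment that falsifies `c`. A clause `x` fails there
exactly if `x` is contained in `c`. Hence a conjunction of positive clauses implies `c` only through
a single one of them. -/
theorem IsConj.implied_iff {s : List SExp} {M : Set (Set (Fin A.numStates))} (h : A.IsConj s M)
    (c : SExp) : A.Implied M c ↔ ∃ x ∈ s, ∀ q, A.decode x q = true → A.decode c q = true := by
  rw [Implied, h]
  push Not
  simp only [Set.mem_ofPred_eq]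
  refine exists_congr fun x => and_congr_right fun _ => ⟨fun h q hq => ?_, fun h q hq hx => ?_⟩
  · by_contra hc
    exact h q (by simpa using hc) hq
  · simp [h q hx] at hq

theorem clause_acceptFrom (w : List (Fin A.numLetters)) :
    ∃ C, A.Clause C ∧ ∀ q, q ∈ A.acceptFrom w ↔ C q = true := by
  induction w with
  | nil =>
    refine ⟨_, .final, fun q => ⟨?_, fun h => ⟨q, h, rfl⟩⟩⟩
    rintro ⟨f, hf, rfl⟩
    exact hf
  | cons a w ih =>
    obtain ⟨C, hC, h⟩ := ih
    refine ⟨_, .pre a hC, fun q => ?_⟩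
    simp only [preSet, List.any_eq_true, List.mem_finRange, true_and, Bool.and_eq_true, ← h]
    constructor
    · rintro ⟨f, hf, p, hp, hr⟩
      exact ⟨p, hp, f, hf, hr⟩
    · rintro ⟨p, hp, f, hf, hr⟩
      exact ⟨f, hf, p, hp, hr⟩

/-- Conjunctive normal form. Distributing a disjunction over two conjunctions produces unions of
clauses, which is why the clauses have to be closed under union. -/
theorem exists_isConj (M : A.OptGround) :
    ∃ s : List SExp, (∀ x ∈ s, ∃ C, A.Clause C ∧ x = A.setCode C) ∧ A.IsConj s M.1 := by
  obtain ⟨_, φ, rfl⟩ := M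
  induction φ with
  | tru => exact ⟨[], by simp, fun v => by simp [resolve, Formula.Holds]⟩
  | atom Q =>
    obtain ⟨_, w, rfl⟩ := Q
    obtain ⟨C, hC, h⟩ := clause_acceptFrom w
    refine ⟨[A.setCode C], by simpa using ⟨C, hC, rfl⟩, fun v => ?_⟩
    simp only [List.mem_singleton, forall_eq, decode_setCode, ← h]
    exact exists_congr fun q => and_comm
  | and φ ψ ih₁ ih₂ =>
    obtain ⟨s, hs, h⟩ := ih₁
    obtain ⟨t, ht, h'⟩ := ih₂
    refine ⟨s ++ t, fun x hx => (List.mem_append.1 hx).elim (hs x) (ht x), fun v => ?_⟩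
    refine (and_congr (h v) (h' v)).trans ?_
    simp only [List.mem_append, or_imp, forall_and]
  | or φ ψ ih₁ ih₂ =>
    obtain ⟨s, hs, h⟩ := ih₁
    obtain ⟨t, ht, h'⟩ := ih₂
    refine ⟨s.flatMap fun x => t.map fun y => A.data.union x y, fun z hz => ?_, fun v => ?_⟩
    · simp only [List.mem_flatMap, List.mem_map] at hz
      obtain ⟨x, hx, y, hy, rfl⟩ := hz
      obtain ⟨C, hC, rfl⟩ := hs x hx
      obtain ⟨C', hC', rfl⟩ := ht y hy
      exact ⟨_, .union hC hC', A.data_union C C'⟩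
    · have hu : ∀ x ∈ s, ∀ y ∈ t, ∀ q, A.decode (A.data.union x y) q = true ↔
          A.decode x q = true ∨ A.decode y q = true := by
        intro x hx y hy q
        obtain ⟨C, hC, rfl⟩ := hs x hx
        obtain ⟨C', hC', rfl⟩ := ht y hy
        rw [data_union]
        simp
      refine (or_congr (h v) (h' v)).trans ?_
      simp only [List.mem_flatMap, List.mem_map]
      constructor
      · rintro (h1 | h1) _ ⟨x, hx, y, hy, rfl⟩
        · obtain ⟨q, hq, hc⟩ := h1 x hx
          exact ⟨q, hq, (hu x hx y hy q).2 (.inl hc)⟩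
        · obtain ⟨q, hq, hc⟩ := h1 y hy
          exact ⟨q, hq, (hu x hx y hy q).2 (.inr hc)⟩
      · intro h1
        by_contra! h2
        obtain ⟨⟨x, hx, hx'⟩, y, hy, hy'⟩ := h2
        obtain ⟨q, hq, hc⟩ := h1 _ ⟨x, hx, y, hy, rfl⟩
        rcases (hu x hx y hy q).1 hc with hc | hc
        · exact absurd hc (by simpa using hx' q hq)
        · exact absurd hc (by simpa using hy' q hq)

/-- The operations that generate clauses are the end marker, the letters and disjunction of the
model. So every conjunction of clauses belongs to the ground domain. -/
theorem exists_formula_clause {C : Fin A.numStates → Bool} (hC : A.Clause C) :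
    ∃ M : A.OptGround, ∀ v, v ∈ M.1 ↔ ∃ q ∈ v, C q = true := by
  induction hC with
  | final => exact ⟨A.optEnd, fun v => exists_congr fun q => and_comm⟩
  | pre a hC ih =>
    obtain ⟨M, hM⟩ := ih
    refine ⟨A.optPred a M, fun v => ?_⟩
    refine (hM _).trans ?_
    simp only [preSet, List.any_eq_true, List.mem_finRange, true_and, Bool.and_eq_true,
      Set.mem_ofPred_eq]
    constructor
    · rintro ⟨q, ⟨p, hp, hv⟩, hq⟩
      exact ⟨p, hv, q, hp, hq⟩
    · rintro ⟨p, hv, q, hp, hq⟩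
      exact ⟨q, ⟨p, hp, hv⟩, hq⟩
  | union hC hC' ih ih' =>
    obtain ⟨M, hM⟩ := ih
    obtain ⟨M', hM'⟩ := ih'
    refine ⟨A.disj M M', fun v => ?_⟩
    refine (or_congr (hM v) (hM' v)).trans ?_
    simp only [Bool.or_eq_true, and_or_left, exists_or]

theorem exists_formula {s : List SExp} (hs : ∀ x ∈ s, ∃ C, A.Clause C ∧ x = A.setCode C) :
    ∃ M : A.OptGround, A.IsConj s M.1 := by
  induction s with
  | nil => exact ⟨⊤, fun v => iff_of_true (Set.mem_univ v) (by simp)⟩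
  | cons x s ih =>
    obtain ⟨M, hM⟩ := ih fun y hy => hs y (by simp [hy])
    obtain ⟨C, hC, rfl⟩ := hs x (by simp)
    obtain ⟨M', hM'⟩ := exists_formula_clause hC
    refine ⟨A.conj M' M, fun v => ?_⟩
    refine (and_congr (hM' v) (hM v)).trans ?_
    simp

open Classical in
/-- The code of a ground element: the list of the clauses in `U` that follow from it. -/
noncomputable def groundCode (U : List SExp) (M : A.OptGround) : SExp :=
  .ofList (U.filter fun c => decide (A.Implied M.1 c))

variable {U : List SExp}

theorem mem_groundCode {M : A.OptGround} {c : SExp} :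
    c ∈ (groundCode U M).toList ↔ c ∈ U ∧ A.Implied M.1 c := by
  simp [groundCode]

open Classical in
theorem groundCode_eq (p : SExp → Bool) (M : A.OptGround)
    (h : ∀ c ∈ U, (p c = true ↔ A.Implied M.1 c)) : .ofList (U.filter p) = groundCode U M := by
  rw [groundCode]
  congr 1
  refine List.filter_congr fun c hc => ?_
  rw [Bool.eq_iff_iff, decide_eq_true_iff, h c hc]

theorem subb_iff {x c : SExp} (hx : ∃ C, x = A.setCode C) :
    subb x c = true ↔ ∀ q, A.decode x q = true → A.decode c q = true := by
  obtain ⟨C, rfl⟩ := hx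
  simp only [subb, List.all_eq_true, memb_iff, decode, mem_setCode]
  refine ⟨fun h q hq => h _ (mem_setCode.2 hq), fun h y hy => ?_⟩
  simp only [setCode, SExp.toList_ofList, List.mem_map, List.mem_filter] at hy
  obtain ⟨q, hq, rfl⟩ := hy
  exact h q hq.2

theorem ofList_normalize {s : List SExp} {M : A.OptGround} (h : A.IsConj s M.1)
    (hs : ∀ x ∈ s, ∃ C, x = A.setCode C) : .ofList (normalize U s) = groundCode U M := by
  refine groundCode_eq _ M fun c _ => ?_
  rw [h.implied_iff]
  simp only [List.any_eq_true]
  exact exists_congr fun x => and_congr_right fun hx => subb_iff (hs x hx)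

/-- All clauses in the code follow from `M`. Conversely, the clauses of some normal form of `M` are
among them, so together they imply `M`. -/
theorem isConj_groundCode (hU : A.ListsClauses U) (M : A.OptGround) : A.IsConj (groundCode U M).toList M.1 := by
  obtain ⟨s, hs, h⟩ := exists_isConj M
  intro v
  constructor
  · intro hv c hc
    obtain ⟨x, hx, hxc⟩ := (h.implied_iff c).1 (mem_groundCode.1 hc).2
    obtain ⟨q, hq, hq'⟩ := (h v).1 hv x hx
    exact ⟨q, hq, hxc q hq'⟩
  · intro hv
    rw [h]
    intro x hx
    exact hv x (mem_groundCode.2 ⟨(hU x).2 (hs x hx), (h.implied_iff x).2 ⟨x, hx, fun _ => id⟩⟩)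

theorem exists_setCode_of_mem (hU : A.ListsClauses U) {M : A.OptGround} {x : SExp} (hx : x ∈ (groundCode U M).toList) :
    ∃ C, x = A.setCode C :=
  ((hU x).1 (mem_groundCode.1 hx).1).imp fun _ h => h.2

theorem groundCode_le_iff (hU : A.ListsClauses U) (M M' : A.OptGround) :
    subb (groundCode U M') (groundCode U M) = true ↔ M ≤ M' := by
  simp only [subb, List.all_eq_true, memb_iff]
  constructor
  · intro h v hv
    rw [isConj_groundCode hU M']
    exact fun x hx => (isConj_groundCode hU M v).1 hv x (h x hx)
  · intro h c hc
    rw [mem_groundCode] at hc ⊢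
    exact ⟨hc.1, fun h' => hc.2 (h h')⟩

theorem groundCode_injective (hU : A.ListsClauses U) : Function.Injective (groundCode (A := A) U) := by
  intro M M' h
  refine le_antisymm ?_ ?_ <;> rw [← groundCode_le_iff hU, h, subb] <;> simp

theorem mem_groundElems (hU : A.ListsClauses U) {s : SExp} :
    s ∈ groundElems U ↔ ∃ M : A.OptGround, s = groundCode U M := by
  simp only [groundElems, List.mem_map, List.mem_sublists']
  constructor
  · rintro ⟨l, hl, rfl⟩
    have h1 : ∀ x ∈ l, ∃ C, A.Clause C ∧ x = A.setCode C := fun x hx => (hU x).1 (hl.subset hx)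
    obtain ⟨M, hM⟩ := exists_formula h1
    exact ⟨M, ofList_normalize hM fun x hx => (h1 x hx).imp fun _ h => h.2⟩
  · rintro ⟨M, rfl⟩
    refine ⟨_, ?_, ofList_normalize (isConj_groundCode hU M) fun x => exists_setCode_of_mem hU⟩
    rw [groundCode, SExp.toList_ofList]
    exact List.filter_sublist

theorem predVal_groundCode (hU : A.ListsClauses U) (a : Fin A.numLetters) (M : A.OptGround) :
    predVal A.data U (.ofNat a) (groundCode U M) = groundCode U (A.optPred a M) := by
  have h1 : ∀ x ∈ (groundCode U M).toList, A.data.pre (.ofNat a) x =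
      A.setCode (A.preSet a (A.decode x)) := fun x hx => by
    obtain ⟨C, rfl⟩ := exists_setCode_of_mem hU hx
    rw [data_pre, decode_setCode]
  refine ofList_normalize (fun v => ?_) fun y hy => ?_
  · refine (isConj_groundCode hU M _).trans ?_
    simp only [List.mem_map, forall_exists_index, and_imp, forall_apply_eq_imp_iff₂]
    refine forall₂_congr fun x hx => ?_
    rw [h1 x hx, decode_setCode]
    simp only [preSet, List.any_eq_true, List.mem_finRange, true_and, Bool.and_eq_true,
      Set.mem_ofPred_eq]
    constructor
    · rintro ⟨q, ⟨p, hp, hv⟩, hq⟩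
      exact ⟨p, hv, q, hp, hq⟩
    · rintro ⟨p, hv, q, hp, hq⟩
      exact ⟨q, ⟨p, hp, hv⟩, hq⟩
  · obtain ⟨x, hx, rfl⟩ := List.mem_map.1 hy
    exact ⟨_, h1 x hx⟩

theorem endVal_eq : endVal A.data U = groundCode U A.optEnd := by
  refine ofList_normalize (fun v => ?_) fun y hy => ⟨_, List.mem_singleton.1 hy⟩
  simp only [List.mem_singleton, forall_eq]
  rw [data, decode_setCode]
  exact exists_congr fun q => and_comm

open Classical in
theorem groundCode_top : groundCode U (⊤ : A.OptGround) = .nil := by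
  rw [groundCode, List.filter_eq_nil_iff.2]
  · rfl
  · intro c _ h
    exact of_decide_eq_true h (Set.mem_univ _)

end Automaton

end HOGame

namespace HOGame
open _root_.HOGame.Enc (enc)

/-! ### Codes of domain elements -/

/-- In a finite order a descending chain is eventually constant, so its meet is one of its members.
-/
theorem MeetContinuous.of_monotone {X Y : Type} [PartialOrder X] [PartialOrder Y] [Finite X]
    {f : X → Y} (hf : Monotone f) : MeetContinuous f :=
  have hid : MeetContinuous (id : X → X) := fun _ _ _ h => h
  MeetContinuous.comp₂ (op := fun a _ => f a) hid hid fun _ _ _ _ h _ => hf h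

namespace Automaton

variable {A : Automaton} (U : List SExp)

/-- The code of an element of the optimized domain: the code of a function is the list of the
pairs of codes of arguments and values, in the order in which the arguments are listed. -/
noncomputable def domCode : (κ : Kind) → Dom A.optGround κ → SExp
  | .ground, M => groundCode (A := A) U M
  | .arrow a b, f => .ofList ((domData U a.code).1.map fun k =>
      .cons k (domCode b (f.1 (Function.invFun (domCode a) k))))

/-- The element with a given code. -/
noncomputable def domElem (κ : Kind) : SExp → Dom A.optGround κ :=
  Function.invFun (domCode U κ)

theorem domCode_arrow {a b : Kind} (f : Dom A.optGround (.arrow a b)) :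
    domCode U (.arrow a b) f = .ofList ((domData U a.code).1.map fun k =>
      .cons k (domCode U b (f.1 (domElem U a k)))) := rfl

theorem mem_allTables {Ea Eb : List SExp} {f : SExp} : f ∈ allTables Ea Eb ↔
    ∃ l : List (SExp × SExp), f = .ofList (l.map fun p => .cons p.1 p.2) ∧ l.map Prod.fst = Ea ∧
      ∀ p ∈ l, p.2 ∈ Eb := by
  induction Ea generalizing f with
  | nil =>
    have : f ∈ allTables [] Eb ↔ f = .nil := List.mem_singleton
    rw [this]
    constructor
    · rintro rfl
      exact ⟨[], rfl, rfl, by simp⟩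
    · rintro ⟨l, rfl, hl, -⟩
      rw [List.map_eq_nil_iff.1 hl]
      rfl
  | cons k Ea ih =>
    have : f ∈ allTables (k :: Ea) Eb ↔
        ∃ v ∈ Eb, ∃ t ∈ allTables Ea Eb, .cons (.cons k v) t = f := by
      rw [show allTables (k :: Ea) Eb =
        Eb.flatMap fun v => (allTables Ea Eb).map fun t => .cons (.cons k v) t from rfl]
      simp only [List.mem_flatMap, List.mem_map]
    rw [this]
    constructor
    · rintro ⟨v, hv, t, ht, rfl⟩
      obtain ⟨l, rfl, hl, hb⟩ := ih.1 ht
      refine ⟨(k, v) :: l, rfl, by simp [hl], fun p hp => ?_⟩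
      rcases List.mem_cons.1 hp with rfl | hp
      exacts [hv, hb p hp]
    · rintro ⟨_ | ⟨⟨k', v⟩, l⟩, rfl, hl, hb⟩
      · simp at hl
      · simp only [List.map_cons, List.cons.injEq] at hl
        obtain ⟨rfl, hl⟩ := hl
        exact ⟨v, hb (k', v) (by simp), _, ih.2 ⟨l, rfl, hl, fun p hp => hb p (by simp [hp])⟩, rfl⟩

/-- The lists of codes that are computed for a domain are correct. -/
structure DomSpec (A : Automaton) (κ : Kind) : Prop where
  inj : Function.Injective (domCode (A := A) U κ)
  mem : ∀ s, s ∈ (domData U κ.code).1 ↔ ∃ d : Dom A.optGround κ, s = domCode U κ d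
  le : ∀ d d' : Dom A.optGround κ,
    .cons (domCode U κ d) (domCode U κ d') ∈ (domData U κ.code).2 ↔ d ≤ d'

variable {U}

theorem DomSpec.domElem {κ : Kind} (h : DomSpec U A κ) (d : Dom A.optGround κ) :
    domElem U κ (domCode U κ d) = d :=
  Function.leftInverse_invFun h.inj d

theorem mem_arrowElems {B C : DomData} {f : SExp} : f ∈ arrowElems B C ↔ f ∈ allTables B.1 C.1 ∧
    ∀ p ∈ f.toList, ∀ q ∈ f.toList, .cons p.hd q.hd ∈ B.2 → .cons p.tl q.tl ∈ C.2 := by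
  simp only [arrowElems, List.mem_filter, monoTable, List.all_eq_true, Bool.or_eq_true,
    Bool.not_eq_true', memb_iff]
  refine and_congr_right fun _ => forall₂_congr fun p _ => forall₂_congr fun q _ => ?_
  rw [Bool.eq_false_iff, ne_eq, memb_iff]
  tauto

theorem mem_arrowPairs {C : DomData} {E : List SExp} {f g : SExp} :
    .cons f g ∈ arrowPairs C E ↔ f ∈ E ∧ g ∈ E ∧
      ∀ p ∈ f.toList, ∀ q ∈ g.toList, p.hd = q.hd → .cons p.tl q.tl ∈ C.2 := by
  simp only [arrowPairs, List.mem_flatMap, List.mem_map, List.mem_filter, leTable,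
    List.all_eq_true, Bool.or_eq_true, Bool.not_eq_true', memb_iff, SExp.cons.injEq]
  have h : ∀ (x y : SExp) (P : Prop), x.eqb y = false ∨ P ↔ (x = y → P) := fun x y P => by
    rw [Bool.eq_false_iff, ne_eq, SExp.eqb_iff, imp_iff_not_or]
  simp only [h]
  constructor
  · rintro ⟨_, h1, _, h2, rfl, rfl⟩
    exact ⟨h1, h2⟩
  · rintro ⟨h1, h2⟩
    exact ⟨_, h1, _, h2, rfl, rfl⟩

/-- The three properties are proved together: injectivity and the list of arguments make tables
determine functions, and the order on the components is what the monotonicity test reads. -/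
theorem domSpec (hU : A.ListsClauses U) (κ : Kind) : DomSpec U A κ := by
  induction κ with
  | ground =>
    refine ⟨groundCode_injective hU, fun s => mem_groundElems hU, fun M M' => ?_⟩
    have : ∀ s t, SExp.cons s t ∈ groundPairs (groundElems U) ↔
        s ∈ groundElems U ∧ t ∈ groundElems U ∧ subb t s = true := by
      intro s t
      simp only [groundPairs, List.mem_flatMap, List.mem_map, List.mem_filter, SExp.cons.injEq]
      constructor
      · rintro ⟨_, h1, _, h2, rfl, rfl⟩
        exact ⟨h1, h2⟩
      · rintro ⟨h1, h2⟩
        exact ⟨_, h1, _, h2, rfl, rfl⟩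
    refine (this _ _).trans (Iff.trans ?_ (groundCode_le_iff hU M M'))
    exact ⟨fun h => h.2.2, fun h => ⟨(mem_groundElems hU).2 ⟨M, rfl⟩,
      (mem_groundElems hU).2 ⟨M', rfl⟩, h⟩⟩
  | arrow a b iha ihb =>
    have hmem : ∀ s, s ∈ (domData U (Kind.arrow a b).code).1 ↔
        ∃ d : Dom A.optGround (.arrow a b), s = domCode U (.arrow a b) d := by
      intro s
      refine mem_arrowElems.trans ?_
      constructor
      · rintro ⟨h1, h2⟩
        obtain ⟨l, rfl, hl, hb⟩ := mem_allTables.1 h1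
        rw [SExp.toList_ofList] at h2
        have h3 : ∀ p ∈ l, ∃ (d : Dom A.optGround a) (e : Dom A.optGround b),
            p = (domCode U a d, domCode U b e) := by
          intro p hp
          obtain ⟨d, hd⟩ := (iha.mem p.1).1 (hl ▸ List.mem_map_of_mem hp)
          obtain ⟨e, he⟩ := (ihb.mem p.2).1 (hb p hp)
          exact ⟨d, e, Prod.ext hd he⟩
        -- With `d = d'` this yields `e ≤ e'` and `e' ≤ e`. So the table is single-valued although
        -- keys may be repeated.
        have h4 : ∀ {d d' : Dom A.optGround a} {e e' : Dom A.optGround b},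
            (domCode U a d, domCode U b e) ∈ l → (domCode U a d', domCode U b e') ∈ l → d ≤ d' →
            e ≤ e' := by
          intro d d' e e' h h' hle
          exact (ihb.le e e').1 (h2 _ (List.mem_map_of_mem h) _ (List.mem_map_of_mem h')
            ((iha.le d d').2 hle))
        have h5 : ∀ d : Dom A.optGround a, ∃ e : Dom A.optGround b,
            (domCode U a d, domCode U b e) ∈ l := by
          intro d
          have h6 : domCode U a d ∈ l.map Prod.fst := hl ▸ (iha.mem _).2 ⟨d, rfl⟩
          obtain ⟨p, hp, hpd⟩ := List.mem_map.1 h6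
          obtain ⟨d', e, rfl⟩ := h3 p hp
          exact ⟨e, hpd ▸ hp⟩
        choose f hf using h5
        have hmono : Monotone f := fun d d' h => h4 (hf d) (hf d') h
        refine ⟨⟨f, MeetContinuous.of_monotone hmono⟩, ?_⟩
        refine Eq.trans ?_ (domCode_arrow U _).symm
        rw [← hl, List.map_map]
        refine congrArg SExp.ofList (List.map_congr_left fun p hp => ?_)
        obtain ⟨d, e, rfl⟩ := h3 p hp
        simp only [Function.comp, iha.domElem]
        rw [le_antisymm (h4 hp (hf d) le_rfl) (h4 (hf d) hp le_rfl)]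
      · rintro ⟨f, rfl⟩
        rw [domCode_arrow]
        constructor
        · refine mem_allTables.2 ⟨(domData U a.code).1.map fun k =>
            (k, domCode U b (f.1 (domElem U a k))), ?_, ?_, ?_⟩
          · rw [List.map_map]; rfl
          · rw [List.map_map]; exact List.map_id _
          · simp only [List.mem_map]
            rintro _ ⟨k, -, rfl⟩
            exact (ihb.mem _).2 ⟨_, rfl⟩
        · simp only [SExp.toList_ofList, List.mem_map]
          rintro _ ⟨k, hk, rfl⟩ _ ⟨k', hk', rfl⟩
          obtain ⟨d, rfl⟩ := (iha.mem k).1 hk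
          obtain ⟨d', rfl⟩ := (iha.mem k').1 hk'
          rw [iha.domElem, iha.domElem]
          intro h
          exact (ihb.le _ _).2 (f.2.monotone ((iha.le _ _).1 h))
    refine ⟨fun f g h => ?_, hmem, fun f g => ?_⟩
    · rw [domCode_arrow, domCode_arrow] at h
      have h1 := List.map_inj_left.1 (SExp.ofList_injective h)
      refine Subtype.ext (funext fun d => ?_)
      have h2 := h1 _ ((iha.mem _).2 ⟨d, rfl⟩)
      rw [iha.domElem, SExp.cons.injEq] at h2
      exact ihb.inj h2.2
    · refine mem_arrowPairs.trans ?_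
      rw [domCode_arrow, domCode_arrow, SExp.toList_ofList, SExp.toList_ofList,
        ← domCode_arrow, ← domCode_arrow]
      constructor
      · rintro ⟨-, -, h⟩ d
        have hd := (iha.mem _).2 ⟨d, rfl⟩
        have h1 := h _ (List.mem_map_of_mem hd) _ (List.mem_map_of_mem hd) rfl
        simp only [SExp.tl_cons, iha.domElem] at h1
        exact (ihb.le _ _).1 h1
      · intro h
        refine ⟨(hmem _).2 ⟨f, rfl⟩, (hmem _).2 ⟨g, rfl⟩, ?_⟩
        simp only [List.mem_map]
        rintro _ ⟨k, hk, rfl⟩ _ ⟨k', hk', rfl⟩ (rfl : k = k')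
        exact (ihb.le _ _).2 (h _)

/-! ### Evaluation of terms -/

/-- The first matching entry is used. It exists because all arguments are listed, and any other
entry with the same key has the same value. -/
theorem applyTable_domCode (hU : A.ListsClauses U) {a b : Kind} (f : Dom A.optGround (.arrow a b))
    (d : Dom A.optGround a) :
    applyTable (domCode U (.arrow a b) f) (domCode U a d) = domCode U b (f.1 d) := by
  have h := domSpec hU a
  rw [applyTable, domCode_arrow, SExp.toList_ofList]
  rcases hl : ((domData U a.code).1.map fun k =>
      SExp.cons k (domCode U b (f.1 (domElem U a k)))).filter
      (fun p => p.hd.eqb (domCode U a d)) with _ | ⟨y, l⟩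
  · rw [List.filter_eq_nil_iff] at hl
    exact absurd ((SExp.eqb_iff _ _).2 rfl)
      (hl _ (List.mem_map_of_mem ((h.mem _).2 ⟨d, rfl⟩)))
  · have hy : y ∈ y :: l := List.mem_cons_self
    rw [← hl, List.mem_filter, List.mem_map] at hy
    obtain ⟨⟨k, -, rfl⟩, hk⟩ := hy
    rw [SExp.hd_cons, SExp.eqb_iff] at hk
    subst hk
    rw [h.domElem] at hl
    rw [hl]
    rfl

/-- The codes of the values of the variables. -/
noncomputable def envCodes (U : List SExp) : (Γ : List Kind) → Env A.optGround Γ → List SExp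
  | [], _ => []
  | κ :: Γ, e => domCode U κ e.1 :: envCodes U Γ e.2

theorem getElem?_envCodes {Γ : List Kind} {κ : Kind} (x : Var Γ κ) (e : Env A.optGround Γ) :
    (envCodes U Γ e)[x.index]? = some (domCode U κ (lookup x e)) := by
  induction x with
  | zero => rfl
  | succ x ih => exact ih e.2

theorem nth_envCodes {Γ : List Kind} {κ : Kind} (x : Var Γ κ) (e : Env A.optGround Γ) :
    nth (.ofList (envCodes U Γ e)) (.ofNat x.index) = domCode U κ (lookup x e) := by
  obtain ⟨h, h1⟩ := List.getElem?_eq_some_iff.1 (getElem?_envCodes (U := U) x e)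
  rw [nth_ofList _ _ h, h1]

/-- The interpretation of the end marker and the letters. -/
def wordInterp (A : Automaton) : ∀ t : Option (Fin A.numLetters), Dom A.optGround (wordKind t)
  | none => A.optEnd
  | some a => ⟨A.optPred a, A.optPred_continuous a⟩

/-- The function on ground elements with the code of the letter `c` is `d`. -/
def IsLetter (U : List SExp) (c : SExp) : (κ : Kind) → Dom A.optGround κ → Prop
  | .arrow .ground .ground, d => ∀ M : A.OptGround,
      predVal A.data U c (groundCode U M) = groundCode (A := A) U (d.1 M)
  | _, _ => False

section Terms
variable {n : ℕ} {nk : Fin n → Kind} {Γ : List Kind}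

theorem hasTag_cons (m k : ℕ) (s : SExp) : hasTag m (.cons (.ofNat k) s) = decide (m = k) := by
  rw [Bool.eq_iff_iff, hasTag, SExp.hd_cons, SExp.eqb_iff, decide_eq_true_iff]
  exact ⟨fun h => (SExp.ofNat_injective h).symm, fun h => by rw [h]⟩

/-- As `IsLetter` is false except for the kind `o → o`, this carries two facts without an equation
between kinds: a term tagged as a letter is not ground, and its value is computed by `predVal`. -/
theorem isLetter_of_hasTag (hU : A.ListsClauses U) {κ : Kind}
    (t : Term (wordKind (L := Fin A.numLetters)) nk Γ κ) (ν : ∀ F, Dom A.optGround (nk F))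
    (η : Env A.optGround Γ) (h : hasTag 1 t.code = true) :
    IsLetter U t.code.tl κ (t.sem A.wordInterp ν η) := by
  cases t with
  | terminal t =>
    cases t with
    | none => simp [Term.code, hasTag_cons] at h
    | some a => exact fun M => predVal_groundCode hU a M
  | nonterminal F => simp [Term.code, hasTag_cons] at h
  | var x => simp [Term.code, hasTag_cons] at h
  | app s t => simp [Term.code, hasTag_cons] at h

/-- Without variables and with ground non-terminals only, the letters are the only functions. Hence
every argument in an application is ground and cannot be a bare letter. -/
theorem kind_of_ground {κ : Kind} (t : Term (wordKind (L := Fin A.numLetters)) nk Γ κ)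
    (hn : ∀ F, nk F = .ground) (hΓ : Γ = []) : κ = .ground ∨ κ = .arrow .ground .ground := by
  induction t with
  | terminal t => cases t <;> simp [wordKind]
  | nonterminal F => exact .inl (hn F)
  | var x => subst hΓ; cases x
  | app s t ihs _ =>
    rcases ihs with h | h
    · simp at h
    · simp only [Kind.arrow.injEq] at h
      exact .inl h.2

/-- The list `ground` is read only to build the table of a letter that is not in head position. The
alternatives in `hg` and `ht` say that either the list is right, or no such letter occurs in a
proper subterm and the term itself is none. -/
theorem evalVal_eq (hU : A.ListsClauses U) {ground : List SExp} {κ : Kind}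
    (hg : ground = groundElems U ∨ (∀ F, nk F = .ground) ∧ Γ = [])
    (t : Term (wordKind (L := Fin A.numLetters)) nk Γ κ) (ν : ∀ F, Dom A.optGround (nk F))
    (η : Env A.optGround Γ) (ht : ground = groundElems U ∨ hasTag 1 t.code = false) :
    evalVal ⟨A.data, U, ground⟩ (.ofFn fun F => domCode U (nk F) (ν F)) (envCodes U Γ η) t.code =
      domCode U κ (t.sem A.wordInterp ν η) := by
  induction t with
  | terminal t =>
    rw [evalVal]
    cases t with
    | none =>
      simp only [Term.code, leafVal, hasTag_cons]
      exact endVal_eq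
    | some a =>
      have hg' : ground = groundElems U := by
        rcases ht with h | h
        · exact h
        · simp [Term.code, hasTag_cons] at h
      subst hg'
      simp only [Term.code, leafVal, hasTag_cons]
      refine congrArg SExp.ofList (List.map_congr_left fun x hx => ?_)
      obtain ⟨M, rfl⟩ := (mem_groundElems hU).1 hx
      have h1 : domElem U .ground (groundCode U M) = M := (domSpec hU .ground).domElem M
      rw [SExp.tl_cons]
      refine (congrArg (SExp.cons _) (predVal_groundCode hU a M)).trans ?_
      exact congrArg (SExp.cons _) (congrArg (fun M => groundCode U (A.optPred a M)) h1.symm)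
  | nonterminal F =>
    rw [evalVal]
    simp only [Term.code, leafVal, hasTag_cons]
    exact nth_ofFn _ F
  | var x =>
    rw [evalVal]
    simp only [Term.code, leafVal, hasTag_cons]
    exact nth_envCodes x η
  | @app a b s t ihs iht =>
    -- In the second case `kind_of_ground`, applied to the head `s`, shows that the argument `t` is
    -- ground, so it is not a letter.
    have htag : ground = groundElems U ∨ hasTag 1 t.code = false := by
      rcases hg with h | h
      · exact .inl h
      · right
        by_contra h1
        have h2 := isLetter_of_hasTag hU t ν η (by simpa using h1)
        rcases kind_of_ground s h.1 h.2 with h3 | h3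
        · simp at h3
        · simp only [Kind.arrow.injEq] at h3
          obtain ⟨rfl, rfl⟩ := h3
          exact h2
    have iht := iht htag
    rw [evalVal, dif_pos (by simp [Term.code, hasTag_cons])]
    simp only [Term.code, SExp.tl_cons, SExp.hd_cons]
    rw [iht]
    by_cases hs : hasTag 1 s.code = true
    · rw [hs, cond_true]
      have h1 := isLetter_of_hasTag hU s ν η hs
      cases a with
      | arrow a a' => exact h1.elim
      | ground =>
        cases b with
        | arrow b b' => exact h1.elim
        | ground => exact h1 _
    · rw [Bool.not_eq_true] at hs
      rw [hs, cond_false, ihs (.inr hs)]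
      exact applyTable_domCode hU _ _

end Terms

end Automaton

end HOGame

namespace HOGame
open _root_.HOGame.Enc (enc)

/-! ### Right-hand sides -/

section Apply
variable {D : Cppo}

/-- The value of a function at a tuple of arguments. -/
def applyEnv : (κ : Kind) → Dom D κ → Env D κ.args → D
  | .ground, d, _ => d
  | .arrow _ b, f, e => applyEnv b (f.1 e.1) e.2

theorem applyEnv_curry (κ : Kind) (f : (Env D κ.args).arrow D) (e : Env D κ.args) :
    applyEnv κ ((curry κ).1 f) e = f.1 e := by
  induction κ with
  | ground => rfl
  | arrow a b _ ihb => exact ihb _ e.2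

/-- This identifies the tables obtained from the valuation `nil`, where every body is true, with the
codes of the greatest elements. -/
theorem curry_top (κ : Kind) : (curry κ).1 (⊤ : (Env D κ.args).arrow D) = ⊤ := by
  induction κ with
  | ground => rfl
  | arrow a b _ ihb => exact Subtype.ext (funext fun d => ihb)

end Apply

section Lift
variable {T N : Type} {tk : T → Kind} {D : Cppo} (G : Scheme tk N) {Γ : List Kind}
  (I : ∀ t, Dom D (G.detKind t)) (ν : ∀ F, Dom D (G.nkind F)) (η : Env D Γ)

theorem sem_liftTerm {κ : Kind} (t : Term tk G.nkind Γ κ) :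
    (G.liftTerm t).sem I ν η = t.sem (fun t => I (.inl t)) ν η := by
  induction t with
  | terminal t => rfl
  | nonterminal F => rfl
  | var x => rfl
  | app s t ihs iht =>
    refine Eq.trans (b := ((G.liftTerm s).sem I ν η).1 ((G.liftTerm t).sem I ν η)) rfl ?_
    rw [ihs, iht]
    rfl

/-- The values of ground terms as a tuple. -/
def valueEnv : (l : List (Term tk G.nkind Γ Kind.ground)) →
    Env D (Kind.firstOrder l.length).args
  | [] => ()
  | t :: l => (t.sem (fun t => I (.inl t)) ν η, valueEnv l)

theorem sem_liftApps (l : List (Term tk G.nkind Γ Kind.ground))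
    (s : Term G.detKind G.nkind Γ (Kind.firstOrder l.length)) :
    (G.liftApps l s).sem I ν η =
      applyEnv (Kind.firstOrder l.length) (s.sem I ν η) (valueEnv G I ν η l) := by
  induction l with
  | nil => rfl
  | cons t l ih =>
    rw [Scheme.liftApps, ih]
    refine Eq.trans (b := applyEnv (Kind.firstOrder l.length)
      ((s.sem I ν η).1 ((G.liftTerm t).sem I ν η)) (valueEnv G I ν η l)) rfl ?_
    rw [sem_liftTerm]
    rfl

end Lift

namespace Game

variable (G : Game) (U : List SExp)

theorem sem_rule (F : Fin G.numNonterminals) (ν : G.OptVal)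
    (η : Env G.aut.optGround (G.scheme.nkind F).args) :
    (G.scheme.det.rule F).sem G.optInterp ν η = G.choices (G.owner F) (G.scheme.rules F).length
      (valueEnv G.scheme G.optInterp ν η (G.scheme.rules F)) := by
  refine (sem_liftApps G.scheme G.optInterp ν η _ _).trans ?_
  exact applyEnv_curry _ _ _

def universal : Player → Bool
  | .existential => false
  | .universal => true

variable {G U}

/-- Implication of `c` is the failure of membership of a single assignment. So it turns a union into
a conjunction and an intersection into a disjunction: the existential player's choice is tested with
`all`, the universal player's with `any`. -/
theorem implied_choices {F : Fin G.numNonterminals} (P : Player) (ν : G.OptVal)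
    (η : Env G.aut.optGround (G.scheme.nkind F).args)
    (l : List (Term (wordKind (L := Fin G.aut.numLetters)) G.scheme.nkind
      (G.scheme.nkind F).args Kind.ground)) (hl : l ≠ []) (c : SExp) :
    (bif universal P then (l.any fun t => memb c (Automaton.groundCode U
        (A := G.aut) (t.sem G.aut.wordInterp ν η)).toList)
      else l.all fun t => memb c (Automaton.groundCode U
        (A := G.aut) (t.sem G.aut.wordInterp ν η)).toList) = true ↔
    c ∈ (Automaton.groundCode U (G.choices P l.length
      (valueEnv G.scheme G.optInterp ν η l))).toList := by
  have hI : (fun t => G.optInterp (.inl t)) = G.aut.wordInterp := by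
    funext t
    cases t <;> rfl
  induction l with
  | nil => exact absurd rfl hl
  | cons t l ih =>
    cases l with
    | nil =>
      have : G.choices P [t].length (valueEnv G.scheme G.optInterp ν η [t]) =
          t.sem G.aut.wordInterp ν η := by rw [← hI]; rfl
      rw [this]
      cases P <;> simp [universal]
    | cons t' l =>
      have h1 : G.choices P (t :: t' :: l).length
          (valueEnv G.scheme G.optInterp ν η (t :: t' :: l)) =
          G.choice P (t.sem G.aut.wordInterp ν η) (G.choices P (t' :: l).length
          (valueEnv G.scheme G.optInterp ν η (t' :: l))) := by rw [← hI]; rfl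
      have ih := ih (by simp)
      rw [h1, Automaton.mem_groundCode]
      rw [Automaton.mem_groundCode] at ih
      generalize G.choices P (t' :: l).length (valueEnv G.scheme G.optInterp ν η (t' :: l)) = M'
        at ih
      cases P with
      | existential =>
        rw [universal, cond_false] at ih ⊢
        rw [List.all_cons, Bool.and_eq_true]
        refine (and_congr (memb_iff.trans Automaton.mem_groundCode) ih).trans ?_
        have : G.aut.Implied (G.choice .existential (t.sem G.aut.wordInterp ν η) M').1 c ↔
            G.aut.Implied (Subtype.val (p := fun M => ∃ φ, M = G.aut.resolve φ)
              (t.sem G.aut.wordInterp ν η)) c ∧ G.aut.Implied M'.1 c := not_or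
        rw [this]
        tauto
      | universal =>
        rw [universal, cond_true] at ih ⊢
        rw [List.any_cons, Bool.or_eq_true]
        refine (or_congr (memb_iff.trans Automaton.mem_groundCode) ih).trans ?_
        have : G.aut.Implied (G.choice .universal (t.sem G.aut.wordInterp ν η) M').1 c ↔
            G.aut.Implied (Subtype.val (p := fun M => ∃ φ, M = G.aut.resolve φ)
              (t.sem G.aut.wordInterp ν η)) c ∨ G.aut.Implied M'.1 c := not_and_or
        rw [this]
        tauto

variable (G U)

/-- The ground elements if some non-terminal is not ground; otherwise they are not needed. -/
def groundList : List SExp := groundElems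
  (bif (List.finRange G.numNonterminals).all fun F => !(G.scheme.nkind F).code.isCons then []
    else U)

theorem groundList_spec (F : Fin G.numNonterminals) : G.groundList U = groundElems U ∨
    (∀ F, G.scheme.nkind F = .ground) ∧ (G.scheme.nkind F).args = [] := by
  rw [groundList]
  cases h : (List.finRange G.numNonterminals).all fun F => !(G.scheme.nkind F).code.isCons with
  | false => exact .inl rfl
  | true =>
    right
    have h1 : ∀ F, G.scheme.nkind F = .ground := by
      intro F
      have := List.all_eq_true.1 h F (List.mem_finRange F)
      cases h2 : G.scheme.nkind F with
      | ground => rfl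
      | arrow a b => simp [h2, Kind.code] at this
    refine ⟨h1, ?_⟩
    rw [h1 F, Kind.args]

/-- The data for the evaluation of terms. -/
def base : Base := ⟨G.aut.data, U, G.groundList U⟩

/-- The data of a non-terminal. -/
def ntData (F : Fin G.numNonterminals) : NTData :=
  ((G.scheme.nkind F).args.map fun κ => (domData U κ.code).1,
    (G.scheme.rules F).map Term.code, universal (G.owner F))

/-- The codes of a valuation. -/
noncomputable def valCodes (ν : G.OptVal) : List SExp :=
  List.ofFn fun F => Automaton.domCode U (G.scheme.nkind F) (ν F)

variable {G U}

/-- The prefix `η` of arguments already chosen is arbitrary, since it grows by one code at each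
argument; the table mirrors currying. -/
theorem table_eq (hU : G.aut.ListsClauses U) (D : RuleData) (κ : Kind)
    (f : (Env G.aut.optGround κ.args).arrow G.aut.optGround) (η : List SExp)
    (h : ∀ e, D.body (η ++ Automaton.envCodes U κ.args e) =
      Automaton.groundCode (A := G.aut) U (f.1 e)) :
    D.table (κ.args.map fun κ => (domData U κ.code).1) η =
      Automaton.domCode U κ ((curry κ).1 f) := by
  induction κ generalizing η with
  | ground =>
    have h1 := h ()
    rw [show η ++ Automaton.envCodes U Kind.ground.args () = η from List.append_nil η] at h1
    exact h1
  | arrow a b _ ihb =>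
    refine Eq.trans ?_ (Automaton.domCode_arrow U _).symm
    refine congrArg SExp.ofList (List.map_congr_left fun k hk => congrArg (SExp.cons k) ?_)
    obtain ⟨d, rfl⟩ := ((Automaton.domSpec hU a).mem k).1 hk
    rw [(Automaton.domSpec hU a).domElem]
    refine ihb _ _ fun e => ?_
    rw [List.append_assoc]
    exact h (d, e)

theorem numNonterminals_pos : 0 < G.numNonterminals :=
  (Nat.zero_le _).trans_lt G.scheme.start.2

theorem rhsVal_valCodes (hU : G.aut.ListsClauses U) (ν : G.OptVal) :
    rhsVal (G.base U, List.ofFn (G.ntData U)) (G.valCodes U ν) = G.valCodes U (G.optRhs ν) := by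
  rw [rhsVal, valCodes, List.map_ofFn]
  refine congrArg List.ofFn (funext fun F => ?_)
  refine table_eq hU _ _ _ _ fun e => ?_
  -- The code `nil` stands for the greatest valuation. No proper valuation has this code, because
  -- the initial non-terminal exists.
  have hcons : (SExp.ofList (G.valCodes U ν)).isCons = true := by
    rw [valCodes]
    obtain ⟨n, hn⟩ := Nat.exists_eq_succ_of_ne_zero (numNonterminals_pos (G := G)).ne'
    cases h : List.ofFn fun F => Automaton.domCode U (G.scheme.nkind F) (ν F) with
    | nil => simp [List.ofFn_eq_nil_iff, numNonterminals_pos.ne'] at h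
    | cons x l => rfl
  have h1 := implied_choices (U := U) (G.owner F) ν e (G.scheme.rules F)
    (G.scheme.rules_ne_nil F)
  have h2 : (G.scheme.rules F).map (fun t => evalVal (G.base U) (.ofList (G.valCodes U ν))
      (Automaton.envCodes U (G.scheme.nkind F).args e) t.code) =
      (G.scheme.rules F).map fun t => Automaton.groundCode (A := G.aut) U
        (t.sem G.aut.wordInterp ν e) := by
    refine List.map_congr_left fun t _ => ?_
    refine Automaton.evalVal_eq hU (G.groundList_spec U F) t ν e ?_
    -- The bodies of rules are ground, so none of them is a bare letter.
    by_contra! h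
    exact Automaton.isLetter_of_hasTag hU t ν e (by simpa using h.2)
  refine Eq.trans (b := choiceVal U (universal (G.owner F)) ((G.scheme.rules F).map fun t =>
    Automaton.groundCode (A := G.aut) U (t.sem G.aut.wordInterp ν e))) ?_ ?_
  · rw [RuleData.body, ← h2]
    refine (congrArg (fun b => bif b then _ else _) hcons).trans ?_
    rw [cond_true, ntData, List.map_map]
    rfl
  · refine (Automaton.groundCode_eq _ _ fun c hc => ?_).trans
      (congrArg (Automaton.groundCode U) (G.sem_rule F ν e).symm)
    refine Iff.trans ?_ ((h1 c).trans (Automaton.mem_groundCode.trans (and_iff_right hc)))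
    rw [List.any_map, List.all_map]
    rfl

theorem rhsVal_nil (hU : G.aut.ListsClauses U) :
    rhsVal (G.base U, List.ofFn (G.ntData U)) [] = G.valCodes U ⊤ := by
  rw [rhsVal, valCodes, List.map_ofFn]
  refine congrArg List.ofFn (funext fun F => ?_)
  refine (table_eq (G := G) hU _ _ ⊤ _ fun e => ?_).trans ?_
  · exact Automaton.groundCode_top.symm
  · rw [curry_top]
    rfl

/-- The first round turns the empty list into the codes of the greatest valuation, hence the shift
by one. -/
theorem iterate_rhsVal (hU : G.aut.ListsClauses U) (i : ℕ) :
    (rhsVal (G.base U, List.ofFn (G.ntData U)))^[i + 1] [] = G.valCodes U (G.optRhs^[i] ⊤) := by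
  induction i with
  | zero => exact rhsVal_nil hU
  | succ i ih =>
    rw [Function.iterate_succ_apply', ih, rhsVal_valCodes hU, Function.iterate_succ_apply' G.optRhs]

end Game

/-! ### Tables -/

/-- The computed code is literally the code of a representation: clauses are coded as lists of
states, and functions as lists of pairs that cover all arguments. -/
theorem exists_table {A : Automaton} {U : List SExp} (hU : A.ListsClauses U) (κ : Kind)
    (d : Dom A.optGround κ) : ∃ τ : Table A.numStates κ, Table.code κ τ = Automaton.domCode U κ d ∧
      Represents A κ τ d := by
  induction κ with
  | ground =>
    refine ⟨((Automaton.groundCode (A := A) U d).toList.map fun x =>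
      (List.finRange A.numStates).filter (A.decode x) : List (List (Fin A.numStates))), ?_, ?_⟩
    · have : ∀ x ∈ (Automaton.groundCode (A := A) U d).toList,
          SExp.ofList (((List.finRange A.numStates).filter (A.decode x)).map fun q : Fin A.numStates =>
            .ofNat q) = x := by
        intro x hx
        obtain ⟨C, rfl⟩ := Automaton.exists_setCode_of_mem hU hx
        rw [Automaton.decode_setCode]
        rfl
      refine Eq.trans ?_ (SExp.ofList_toList (Automaton.groundCode (A := A) U d))
      refine congrArg SExp.ofList ((List.map_map).trans ?_)
      refine Eq.trans (List.map_congr_left fun x hx => ?_) (List.map_id _)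
      refine Eq.trans ?_ (this x hx)
      rw [Function.comp, bind_pure_comp]
      exact congrArg SExp.ofList List.map_map
    · intro v
      refine (Automaton.isConj_groundCode hU d v).trans ?_
      simp only [List.mem_map, forall_exists_index, and_imp, forall_apply_eq_imp_iff₂,
        List.mem_filter, List.mem_finRange, true_and]
      exact forall₂_congr fun x _ => exists_congr fun q => and_comm
  | arrow a b iha ihb =>
    choose ta hta hta' using iha
    choose tb htb htb' using ihb
    have hs := Automaton.domSpec hU a
    refine ⟨((domData U a.code).1.map fun k => (ta (Automaton.domElem U a k),
      tb (d.1 (Automaton.domElem U a k))) : List (Table A.numStates a × Table A.numStates b)),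
      ?_, ?_, ?_⟩
    · refine Eq.trans ?_ (Automaton.domCode_arrow U d).symm
      refine congrArg SExp.ofList ((List.map_map).trans (List.map_congr_left fun k hk => ?_))
      obtain ⟨e, rfl⟩ := (hs.mem k).1 hk
      simp only [Function.comp, hs.domElem, hta, htb]
    · intro p hp
      obtain ⟨k, -, rfl⟩ := List.mem_map.1 hp
      exact ⟨_, hta' _, htb' _⟩
    · intro e
      refine ⟨_, List.mem_map_of_mem ((hs.mem _).2 ⟨e, rfl⟩), ?_⟩
      simp only [hs.domElem]
      exact hta' e

end HOGame

namespace HOGame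
open _root_.HOGame.Enc (enc)

/-! ### Sizes of the computed data -/

theorem esz_le_of_mem_allTables {Ea Eb : List SExp} {x y : ℕ} (hx : ∀ s ∈ Ea, esz s + 5 ≤ x)
    (hy : ∀ s ∈ Eb, esz s + 5 ≤ y) {f : SExp} (hf : f ∈ allTables Ea Eb) :
    esz f ≤ 1 + Ea.length * (x + y) := by
  induction Ea generalizing f with
  | nil =>
    rw [List.mem_singleton.1 (show f ∈ [SExp.nil] from hf)]
    simp
  | cons k Ea ih =>
    have e : allTables (k :: Ea) Eb =
      Eb.flatMap fun v => (allTables Ea Eb).map fun t => .cons (.cons k v) t := rfl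
    simp only [e, List.mem_flatMap, List.mem_map] at hf
    obtain ⟨v, hv, t, ht, rfl⟩ := hf
    have h1 := ih (fun s hs => hx s (by simp [hs])) ht
    have h2 := hx k (by simp)
    have h3 := hy v hv
    rw [List.length_cons, add_one_mul]
    simp only [esz_sexp, SExp.len_cons] at *
    omega

theorem esz_pairs_le {E : List SExp} {m : ℕ} (h : ∀ s ∈ E, esz s ≤ m) (q : SExp → SExp → Bool) :
    esz (E.flatMap fun s => (E.filter (q s)).map fun t => SExp.cons s t) ≤
      1 + E.length * E.length * (2 * m + 2) := by
  refine (esz_le_of_forall (m := 2 * m + 1) fun x hx => ?_).trans ?_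
  · simp only [List.mem_flatMap, List.mem_map, List.mem_filter] at hx
    obtain ⟨s, hs, t, ⟨ht, -⟩, rfl⟩ := hx
    have h1 := h s hs
    have h2 := h t ht
    simp only [esz_sexp, SExp.len_cons] at *
    omega
  · gcongr
    rw [List.length_flatMap]
    refine (List.sum_le_card_nsmul _ E.length fun n hn => ?_).trans (by simp)
    obtain ⟨s, -, rfl⟩ := List.mem_map.1 hn
    rw [List.length_map]
    exact List.length_filter_le _ _

theorem esz_domPair_le {E P : List SExp} {m : ℕ} (h : ∀ s ∈ E, esz s ≤ m)
    (hP : esz P ≤ 1 + E.length * E.length * (2 * m + 2)) :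
    esz (E, P) ≤ ((E.length + 2) * (m + 5)) ^ 2 := by
  have h1 := esz_le_of_forall h
  rw [esz_pair]
  generalize E.length = l at *
  have h2 : l * (m + 1) ≤ (l + 2) ^ 2 * (m + 5) := by nlinarith
  have h3 : l * l * (2 * m + 2) ≤ 2 * ((l + 2) ^ 2 * (m + 5)) := by nlinarith
  have h4 : 5 ≤ m + 5 := by omega
  have h5 : 4 ≤ (l + 2) ^ 2 := by nlinarith
  have h6 : 5 * ((l + 2) ^ 2 * (m + 5)) ≤ ((l + 2) * (m + 5)) ^ 2 := by
    rw [mul_pow, sq (m + 5)]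
    nlinarith [Nat.mul_le_mul_left ((l + 2) ^ 2 * (m + 5)) h4]
  have h7 : 4 * 5 ≤ (l + 2) ^ 2 * (m + 5) := Nat.mul_le_mul h5 h4
  omega

section Bounds
variable {U : List SExp} {X : ℕ} (hX : esz U + 5 ≤ 2 ^ X)
include hX

theorem pos_of_esz_le : 0 < X := by
  rcases Nat.eq_zero_or_pos X with rfl | h
  · simp at hX
  · exact h

theorem esz_le_tower (j : ℕ) {Y : ℕ} (hY : X ≤ Y) : esz U + 5 ≤ tower (j + 1) Y :=
  hX.trans (tower_le_tower (i := 1) (by omega) hY)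

theorem two_pow_length_le (j : ℕ) {Y : ℕ} (hY : X ≤ Y) : 2 ^ U.length + 2 ≤ tower (j + 2) Y := by
  have h1 := length_lt_esz U
  have h2 : 0 < 2 ^ U.length := by positivity
  calc _ ≤ 2 ^ (U.length + 2) := by rw [pow_add]; omega
    _ ≤ 2 ^ 2 ^ X := Nat.pow_le_pow_right two_pos (by omega)
    _ ≤ _ := tower_le_tower (i := 2) (by omega) hY

/-- The computation behind `card_dom_le`, for lists with repetitions. The slack of 2 in base and
exponent leaves room for lower-order summands later. -/
theorem pow_length_le {a b : Kind}
    (ha : (domData U a.code).1.length + 2 ≤ tower (a.order + 2) (X * a.size))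
    (hb : (domData U b.code).1.length + 2 ≤ tower (b.order + 2) (X * b.size)) :
    ((domData U b.code).1.length + 2) ^ ((domData U a.code).1.length + 2) ≤
      tower ((Kind.arrow a b).order + 2) (X * (Kind.arrow a b).size) := by
  refine (Nat.pow_le_pow_left hb _).trans ?_
  rw [tower, ← pow_mul]
  refine Nat.pow_le_pow_right two_pos ?_
  rw [mul_comm]
  exact (Nat.mul_le_mul_right _ ha).trans (tower_arrow_le (pos_of_esz_le hX) 0)

theorem length_domData_le (κ : Kind) :
    (domData U κ.code).1.length + 2 ≤ tower (κ.order + 2) (X * κ.size) := by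
  induction κ with
  | ground =>
    rw [show (domData U Kind.ground.code).1 = groundElems U from rfl, groundElems,
      List.length_map, List.length_sublists']
    exact two_pow_length_le hX _ (by simp [Kind.size])
  | arrow a b iha ihb =>
    refine le_trans ?_ (pow_length_le hX iha ihb)
    have h1 : (domData U (Kind.arrow a b).code).1.length ≤
        (domData U b.code).1.length ^ (domData U a.code).1.length :=
      (List.length_filter_le _ _).trans (allTables_bound _ _).1.le
    generalize (domData U (Kind.arrow a b).code).1.length = l at h1 ⊢
    generalize (domData U a.code).1.length = la at h1 ⊢
    generalize (domData U b.code).1.length = lb at h1 ⊢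
    have h2 : lb ^ la ≤ (lb + 2) ^ la := Nat.pow_le_pow_left (by omega) la
    have h3 : 0 < (lb + 2) ^ la := by positivity
    have h4 : 2 ^ 2 ≤ (lb + 2) ^ 2 := Nat.pow_le_pow_left (by omega) 2
    rw [pow_add]
    nlinarith [Nat.mul_le_mul_left ((lb + 2) ^ la) h4]

theorem esz_le_of_mem_domData (κ : Kind) : ∀ s ∈ (domData U κ.code).1,
    esz s + 5 ≤ tower (κ.order + 2) (X * κ.size ^ 2) := by
  induction κ with
  | ground =>
    intro s hs
    obtain ⟨t, -, rfl⟩ := List.mem_map.1 (show s ∈ groundElems U from hs)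
    have h1 := len_ofList_filter_le U fun c => t.any fun x => subb x c
    have h2 := esz_le_tower hX (Kind.ground.order + 1) (Y := X * Kind.ground.size ^ 2)
      (by simp [Kind.size])
    rw [normalize, esz_sexp]
    exact (Nat.add_le_add_right h1 5).trans h2
  | arrow a b iha ihb =>
    intro f hf
    have hX0 := pos_of_esz_le hX
    have h0 := esz_le_of_mem_allTables iha ihb (Automaton.mem_arrowElems.1 hf).1
    have hsa := a.size_pos
    have hsb := b.size_pos
    have h1 : a.order + 1 ≤ (Kind.arrow a b).order := le_max_left _ _
    have h2 : b.order ≤ (Kind.arrow a b).order := le_max_right _ _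
    have ha := length_domData_le hX a
    set k := (Kind.arrow a b).order
    have h3 : tower (a.order + 2) (X * a.size ^ 2) ≤ tower (k + 2) (X * a.size ^ 2) :=
      tower_le_tower (by omega) le_rfl
    have h4 : tower (b.order + 2) (X * b.size ^ 2) ≤ tower (k + 2) (X * b.size ^ 2) :=
      tower_le_tower (by omega) le_rfl
    have h5 : tower (a.order + 2) (X * a.size) ≤ tower (k + 2) (X * a.size) :=
      tower_le_tower (by omega) le_rfl
    have h6 : 4 ≤ tower (k + 2) (X * a.size ^ 2) :=
      (tower_le_tower (i := 2) (j := k + 2) (a := 1) (by omega)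
        (Nat.mul_pos hX0 (pow_pos hsa 2)) :)
    have h7 := tower_add_le (k + 2) (a := X * a.size ^ 2) (b := X * b.size ^ 2) (by positivity)
      (by positivity)
    have h8 := tower_mul_le (k + 1) (a := X * a.size) (b := X * a.size ^ 2 + X * b.size ^ 2)
      (by positivity) (by positivity)
    -- A table has one entry per key, so its size is a product of a length and an entry size. The
    -- square of the size of the kind pays for the additional factor.
    have h9 : tower (k + 2) (X * a.size + (X * a.size ^ 2 + X * b.size ^ 2)) ≤
        tower (k + 2) (X * (Kind.arrow a b).size ^ 2) := by
      refine tower_mono _ ?_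
      rw [Kind.size, ← mul_add, ← mul_add]
      exact Nat.mul_le_mul_left X (by nlinarith)
    refine le_trans ?_ h9
    refine le_trans ?_ h8
    refine le_trans ?_ (Nat.mul_le_mul (ha.trans h5) ((Nat.add_le_add h3 h4).trans h7))
    generalize (domData U a.code).1.length = la at *
    have h10 : 0 < tower (b.order + 2) (X * b.size ^ 2) := tower_pos _ (by positivity)
    have h11 : 4 ≤ tower (a.order + 2) (X * a.size ^ 2) :=
      (tower_le_tower (i := 2) (j := a.order + 2) (a := 1) (by omega)
        (Nat.mul_pos hX0 (pow_pos hsa 2)) :)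
    nlinarith

theorem esz_domData_le (κ : Kind) :
    esz (domData U κ.code) ≤ tower (κ.order + 2) (4 * (X * κ.size ^ 2)) := by
  have hX0 := pos_of_esz_le hX
  have hs := κ.size_pos
  have hl := length_domData_le hX κ
  have he := esz_le_of_mem_domData hX κ
  obtain ⟨m, hm⟩ : ∃ m, tower (κ.order + 2) (X * κ.size ^ 2) = m + 5 := by
    have h6 : 5 ≤ tower (κ.order + 2) (X * κ.size ^ 2) := by
      exact le_trans (Nat.le_add_left _ _) (esz_le_tower hX (κ.order + 1)
        (Nat.le_mul_of_pos_right _ (by positivity)))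
    exact ⟨_, (Nat.sub_add_cancel h6).symm⟩
  have he' : ∀ s ∈ (domData U κ.code).1, esz s ≤ m := fun s hs => by have := he s hs; omega
  have h1 : esz (domData U κ.code).2 ≤ 1 + (domData U κ.code).1.length *
      (domData U κ.code).1.length * (2 * m + 2) := by
    cases κ with
    | ground => exact esz_pairs_le he' fun s t => subb t s
    | arrow a b => exact esz_pairs_le he' fun s t => leTable (domData U b.code).2 s t
  refine (esz_domPair_le he' h1).trans ?_
  rw [← hm]
  have h2 : tower (κ.order + 2) (X * κ.size) ≤ tower (κ.order + 2) (X * κ.size ^ 2) :=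
    tower_mono _ (Nat.mul_le_mul_left _ (by nlinarith))
  have h3 := tower_pow_le (κ.order + 1) 3 (a := X * κ.size ^ 2) (by positivity)
  refine le_trans ?_ h3
  calc _ ≤ (tower (κ.order + 2) (X * κ.size ^ 2) * tower (κ.order + 2) (X * κ.size ^ 2)) ^ 2 := by
        gcongr; exact hl.trans h2
    _ = _ := by ring

theorem domScale_le (κ : Kind) :
    domScale U κ.code ≤ tower (κ.order + 2) (7 * (X * κ.size ^ 3)) := by
  have hX0 := pos_of_esz_le hX
  have h2 : ∀ κ : Kind, X ≤ X * κ.size ^ 2 := fun κ =>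
    Nat.le_mul_of_pos_right _ (pow_pos κ.size_pos 2)
  induction κ with
  | ground =>
    have h3 := esz_domData_le hX .ground
    have h4 : esz U + 5 ≤ tower 2 X := esz_le_tower hX 1 le_rfl
    have h5 : 2 ^ U.length + 2 ≤ tower 2 X := two_pow_length_le hX 0 le_rfl
    simp only [Kind.size, Kind.order, one_pow, mul_one, zero_add] at h3 ⊢
    rw [Kind.code, domScale]
    rw [Kind.code] at h3
    have h6 := tower_add_le 2 (a := X) (b := X) hX0 hX0
    have h7 := tower_add_le 2 (a := X + X) (b := 4 * X) (by positivity) (by positivity)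
    have h8 := tower_mono 2 (show X + X + 4 * X ≤ 7 * X by omega)
    omega
  | arrow a b iha ihb =>
    have h1 := a.size_pos
    have h1' := b.size_pos
    set κ := Kind.arrow a b with hκ
    have hκs : κ.size = a.size + b.size + 1 := rfl
    have h3 := esz_domData_le hX κ
    have h4 : esz U + 5 ≤ tower (κ.order + 2) (X * κ.size ^ 2) :=
      esz_le_tower hX (κ.order + 1) (h2 κ)
    have h5 : _ ≤ tower (κ.order + 2) (X * κ.size) :=
      pow_length_le hX (length_domData_le hX a) (length_domData_le hX b)
    have h6 : ((domData U b.code).1.length + 1) ^ (domData U a.code).1.length ≤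
        ((domData U b.code).1.length + 2) ^ ((domData U a.code).1.length + 2) :=
      (Nat.pow_le_pow_left (by omega) _).trans (Nat.pow_le_pow_right (by omega) (by omega))
    have h7 : tower (κ.order + 2) (X * κ.size) ≤ tower (κ.order + 2) (X * κ.size ^ 2) :=
      tower_mono _ (Nat.mul_le_mul_left _ (by nlinarith))
    have h8 : κ.size ≤ tower (κ.order + 2) (X * κ.size ^ 2) := by
      refine le_trans ?_ (le_tower _ _)
      nlinarith [Nat.mul_le_mul hX0 (Nat.le_refl (κ.size ^ 2))]
    have oa : a.order + 1 ≤ κ.order := le_max_left _ _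
    have ob : b.order ≤ κ.order := le_max_right _ _
    have iha' := iha.trans (tower_le_tower (show a.order + 2 ≤ κ.order + 2 by omega) le_rfl)
    have ihb' := ihb.trans (tower_le_tower (show b.order + 2 ≤ κ.order + 2 by omega) le_rfl)
    have hp : 0 < X * κ.size ^ 2 := Nat.mul_pos hX0 (pow_pos κ.size_pos 2)
    have t1 := tower_add_le (κ.order + 2) hp hp
    have t2 := tower_add_le (κ.order + 2) (Nat.add_pos_left hp (X * κ.size ^ 2)) hp
    have t3 := tower_add_le (κ.order + 2) (a := X * κ.size ^ 2 + X * κ.size ^ 2 + X * κ.size ^ 2)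
      (b := 4 * (X * κ.size ^ 2)) (by omega) (by omega)
    have t4 := tower_add_le (κ.order + 2) (a := 7 * (X * a.size ^ 3)) (b := 7 * (X * b.size ^ 3))
      (by positivity) (by positivity)
    have t5 := tower_add_le (κ.order + 2)
      (a := X * κ.size ^ 2 + X * κ.size ^ 2 + X * κ.size ^ 2 + 4 * (X * κ.size ^ 2))
      (b := 7 * (X * a.size ^ 3) + 7 * (X * b.size ^ 3)) (by omega) (by positivity)
    have t6 : tower (κ.order + 2)
        (X * κ.size ^ 2 + X * κ.size ^ 2 + X * κ.size ^ 2 + 4 * (X * κ.size ^ 2) +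
          (7 * (X * a.size ^ 3) + 7 * (X * b.size ^ 3))) ≤
        tower (κ.order + 2) (7 * (X * κ.size ^ 3)) := by
      refine tower_mono _ ?_
      -- The local cost is quadratic in the size of the kind and the two recursive costs are cubic;
      -- the factor 7 is made up of three summands and the 4 from `esz_domData_le`.
      have : κ.size ^ 2 + a.size ^ 3 + b.size ^ 3 ≤ κ.size ^ 3 := by
        rw [hκs]
        generalize a.size = x
        generalize b.size = y
        calc (x + y + 1) ^ 2 + x ^ 3 + y ^ 3
            = (x + y + 1) ^ 2 + x * x ^ 2 + y * y ^ 2 := by ring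
          _ ≤ (x + y + 1) ^ 2 + x * (x + y + 1) ^ 2 + y * (x + y + 1) ^ 2 := by gcongr <;> omega
          _ = _ := by ring
      calc _ = 7 * (X * (κ.size ^ 2 + a.size ^ 3 + b.size ^ 3)) := by ring
        _ ≤ _ := by gcongr
    have hl : (SExp.cons a.code b.code).len = κ.size := κ.len_code
    rw [hκ, Kind.code, domScale, ← hκ, hl]
    rw [hκ, Kind.code, ← hκ] at h3
    omega

/-- The argument kinds have order at most `κ.order - 1`, so their domains are towers of height at
most `κ.order + 1`, and so is the number of argument tuples. This is one exponential less than the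
domain of `κ` itself. -/
theorem nodes_le (κ : Kind) {m : ℕ} (hm : κ.order + 1 ≤ m) :
    nodes (κ.args.map fun κ => (domData U κ.code).1) ≤ tower m (X * κ.size) := by
  have hX0 := pos_of_esz_le hX
  induction κ with
  | ground => exact tower_pos _ (Nat.mul_pos hX0 Kind.ground.size_pos)
  | arrow a b _ ihb =>
    have oa : a.order + 1 ≤ (Kind.arrow a b).order := le_max_left _ _
    have ob : b.order ≤ (Kind.arrow a b).order := le_max_right _ _
    have h1 := ihb (by omega)
    have h2 := length_domData_le hX a
    have h3 : tower (a.order + 2) (X * a.size) ≤ tower m (X * a.size) :=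
      tower_le_tower (by omega) le_rfl
    have h4 := nodes_pos (b.args.map fun κ => (domData U κ.code).1)
    refine le_trans (b := ((domData U a.code).1.length + 2) *
      nodes (b.args.map fun κ => (domData U κ.code).1)) ?_ ?_
    · rw [Kind.args, List.map_cons, nodes]
      nlinarith
    · obtain ⟨j, rfl⟩ : ∃ j, m = j + 1 := ⟨m - 1, by omega⟩
      refine (Nat.mul_le_mul (h2.trans h3) h1).trans ((tower_mul_le _ (Nat.mul_pos hX0 a.size_pos)
        (Nat.mul_pos hX0 b.size_pos)).trans (tower_mono _ ?_))
      rw [← mul_add, Kind.size]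
      exact Nat.mul_le_mul_left _ (by omega)

end Bounds

end HOGame

namespace HOGame
open _root_.HOGame.Enc (enc)

attribute [local irreducible] TC

/-! ### The algorithm on games -/

instance : Enc Game := ⟨Game.code⟩

/-- The function is computable in time that is bounded by a tower of height `k + 1`. -/
def TowerTime (k : Game → ℕ) {β : Type} [Enc β] (f : Game → β) : Prop :=
  ∃ S, TC f S ∧ TB k esz S

section TowerTime
variable {k : Game → ℕ} {β γ : Type} [Enc β] [Enc γ]

theorem PT.towerTime {f : Game → β} (h : PT f) : TowerTime k f := ⟨_, h, .const 0⟩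

theorem TowerTime.comp {f : Game → β} {g : β → γ} {S : β → ℕ} (hg : TC g S) (hf : TowerTime k f)
    (hS : TB k esz fun G => S (f G)) : TowerTime k fun G => g (f G) := by
  obtain ⟨S', h, hS'⟩ := hf
  exact ⟨_, hg.comp h, hS'.add hS⟩

theorem TowerTime.pt_comp {f : Game → β} {g : β → γ} (hg : PT g) (hf : TowerTime k f) :
    TowerTime k fun G => g (f G) := hf.comp hg (.const 0)

theorem TowerTime.pair {f : Game → β} {g : Game → γ} (hf : TowerTime k f) (hg : TowerTime k g) :
    TowerTime k fun G => (f G, g G) := by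
  obtain ⟨S, h, hS⟩ := hf
  obtain ⟨S', h', hS'⟩ := hg
  exact ⟨_, h.pair h', hS.add hS'⟩

theorem TowerTime.size {f : Game → β} (hf : TowerTime k f) : TB k esz fun G => esz (f G) := by
  obtain ⟨S, h, hS⟩ := hf
  exact (hS.add (.of_PB (PB.of_le fun _ => le_rfl))).trans h.size

theorem TowerTime.congr {f g : Game → β} (hf : TowerTime k f) (h : ∀ G, f G = g G) :
    TowerTime k g := funext h ▸ hf

end TowerTime

theorem upto_eq (l : List SExp) : upto l = (List.range l.length).map SExp.ofNat := by
  induction l with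
  | nil => rfl
  | cons x l ih =>
    rw [show upto (x :: l) = .nil :: (upto l).map fun x => .cons .nil x from rfl, ih,
      List.length_cons, List.range_succ_eq_map, List.map_cons, List.map_map, List.map_map]
    rfl

theorem upto_ofNat (n : ℕ) :
    upto (SExp.ofNat n).toList = (List.finRange n).map fun q : Fin n => .ofNat q := by
  rw [upto_eq, length_toList_ofNat, ← List.map_coe_finRange_eq_range, List.map_map]
  rfl

namespace Game

theorem pt_code : PT fun G : Game => G.code := PT.of_enc_eq fun _ => rfl

theorem pt_hd (i : ℕ) : PT fun G : Game => (SExp.tl^[i] G.code).hd := by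
  have : ∀ i, PT fun G : Game => SExp.tl^[i] G.code := fun i => by
    induction i with
    | zero => exact pt_code
    | succ i ih => exact (PT.tl ih).congr fun G => (Function.iterate_succ_apply' _ _ _).symm
  exact PT.hd (this i)

theorem pt_aut : PT fun G : Game => G.aut.code := pt_hd 0
theorem pt_num : PT fun G : Game => SExp.ofNat G.numNonterminals := pt_hd 1
theorem pt_kinds : PT fun G : Game => SExp.ofFn fun F => (G.scheme.nkind F).code := pt_hd 2
theorem pt_rules : PT fun G : Game =>
    SExp.ofFn fun F => SExp.ofList ((G.scheme.rules F).map Term.code) := pt_hd 4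
theorem pt_owners : PT fun G : Game => SExp.ofFn fun F => (G.owner F).code := pt_hd 5

theorem pt_data : PT fun G : Game => G.aut.data := by
  have h : PT fun G : Game => AutData.mk (upto G.aut.code.hd.toList)
      (upto G.aut.code.tl.hd.toList) G.aut.code.tl.tl.hd
      (.ofList ((upto G.aut.code.hd.toList).filter fun q =>
        (nth G.aut.code.tl.tl.tl.tl.hd q).isCons)) :=
    PT.comp (g := fun c : SExp => AutData.mk (upto c.hd.toList) (upto c.tl.hd.toList) c.tl.tl.hd
      (.ofList ((upto c.hd.toList).filter fun q => (nth c.tl.tl.tl.tl.hd q).isCons)))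
      (by fun_prop) pt_aut
  refine h.congr fun G => ?_
  have e1 : G.aut.code.hd = SExp.ofNat G.aut.numStates := rfl
  have e2 : G.aut.code.tl.hd = SExp.ofNat G.aut.numLetters := rfl
  have e3 : G.aut.code.tl.tl.tl.tl.hd = SExp.ofFn fun q => SExp.ofBool (G.aut.final q) := rfl
  have e4 : G.aut.data.final = .ofList ((upto G.aut.code.hd.toList).filter fun q =>
        (nth G.aut.code.tl.tl.tl.tl.hd q).isCons) := by
    rw [e1, upto_ofNat, e3, List.filter_map, Automaton.data, Automaton.setCode]
    refine congrArg (fun l => SExp.ofList (List.map _ l)) (List.filter_congr fun q _ => ?_)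
    rw [Function.comp, nth_ofFn]
    cases G.aut.final q <;> rfl
  rw [← e4, e1, e2, upto_ofNat, upto_ofNat]
  rfl

theorem length_subsets (G : Game) : G.aut.data.subsets.length = 2 ^ G.aut.numStates := by
  simp [AutData.subsets, Automaton.data]

theorem tb_two_pow {k : Game → ℕ} : TB k esz fun G => 2 ^ G.aut.numStates :=
  .of_tower (e := esz) (PB.of_le fun _ => le_rfl) fun G =>
    (tower_le_tower (i := 1) (j := k G + 1) (by omega) ((Nat.le_succ _).trans G.numStates_le_input) :)

theorem towerTime_subsets {k : Game → ℕ} : TowerTime k fun G => G.aut.data.subsets :=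
  TowerTime.comp TC.subsets pt_data.towerTime (tb_two_pow.mono fun G => by simp [Automaton.data])

/-- The codes of the generated clauses. -/
def clauses (G : Game) : List SExp :=
  (G.aut.data.clauseStep G.aut.data.subsets)^[2 ^ G.aut.numStates] []

theorem listsClauses (G : Game) : G.aut.ListsClauses G.clauses :=
  G.aut.listsClauses_of_stable (by
    rw [← length_subsets]; exact Automaton.clauseStep_stable G.aut.data G.aut.data.subsets)

theorem esz_filter_le (l : List SExp) (p : SExp → Bool) : esz (l.filter p) ≤ esz l := by
  rw [← len_ofList]
  exact len_ofList_filter_le l p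

/-- All iterates are filtered from the `2 ^ |Q|` sets of states, and there are at most that many
rounds. A tower of height one suffices, whatever `k` is. -/
theorem towerTime_clauses {k : Game → ℕ} : TowerTime k clauses := by
  have he : TowerTime k fun G => (G.aut.data, G.aut.data.subsets) :=
    pt_data.towerTime.pair towerTime_subsets
  have hs := he.size
  have hs' := (towerTime_subsets (k := k)).size
  obtain ⟨S, h, hS⟩ := he
  have hg : PT fun p : (AutData × List SExp) × List SExp => p.1.1.clauseStep p.1.2 p.2 := by
    fun_prop
  refine ⟨_, TC.fix (g := fun (e : AutData × List SExp) L => e.1.clauseStep e.2 L) (Sg := fun _ => 0)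
    (hg.tc _) h
    (x := fun _ => []) (Sx := fun _ => 0) (PT.const _) (fun G => 2 ^ G.aut.numStates)
    (fun G => ?_) (fun G => 2 ^ G.aut.numStates + esz (G.aut.data, G.aut.data.subsets) +
      esz G.aut.data.subsets + 1) (fun G i _ => ?_), (hS.add (.const 0)).add
      (((tb_two_pow.add hs).add hs').add (.const 1))⟩
  · rw [← length_subsets]
    exact Automaton.clauseStep_stable G.aut.data G.aut.data.subsets
  · have : esz ((G.aut.data.clauseStep G.aut.data.subsets)^[i] []) ≤ esz G.aut.data.subsets := by
      cases i with
      | zero => simpa [Nat.succ_le_iff] using esz_pos G.aut.data.subsets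
      | succ i =>
        rw [Function.iterate_succ_apply']
        exact esz_filter_le _ _
    change _ + 0 + _ + esz ((G.aut.data.clauseStep G.aut.data.subsets)^[i] []) + 1 ≤ _
    omega

theorem exists_esz_clauses_le : ∃ X : Game → ℕ, PB esz X ∧ ∀ G, esz G.clauses + 5 ≤ 2 ^ X G := by
  obtain ⟨c, hc⟩ := (towerTime_clauses (k := fun _ => 0)).size.add (.const 5)
  exact ⟨fun G => (esz G + 2) ^ c, ⟨c, fun _ => le_rfl⟩, hc⟩

theorem size_le_esz (G : Game) (F) : (G.scheme.nkind F).size ≤ esz G :=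
  (Nat.le_succ _).trans ((Finset.single_le_sum
    (f := fun F => (G.scheme.nkind F).size + 1) (fun _ _ => Nat.zero_le _)
    (Finset.mem_univ F)).trans G.sum_size_le_input)

theorem num_le_esz (G : Game) : G.numNonterminals ≤ esz G := by
  refine le_trans ?_ G.sum_size_le_input
  refine le_trans (by simp) (Finset.card_nsmul_le_sum Finset.univ
    (fun F => (G.scheme.nkind F).size + 1) 1 fun F _ => Nat.le_add_left _ _)

end Game

theorem Kind.toList_code (κ : Kind) : κ.code.toList = κ.args.map Kind.code := by
  induction κ with
  | ground => rfl
  | arrow a b _ ihb => exact congrArg (List.cons a.code) ihb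

theorem Kind.length_args_le (κ : Kind) : κ.args.length ≤ κ.size := by
  induction κ with
  | ground => exact Nat.zero_le _
  | arrow a b _ ihb => simp only [Kind.args, Kind.size, List.length_cons]; omega

theorem Kind.of_mem_args {κ a : Kind} (h : a ∈ κ.args) : a.order + 1 ≤ κ.order ∧ a.size ≤ κ.size := by
  induction κ with
  | ground => simp [Kind.args] at h
  | arrow a' b _ ihb =>
    simp only [Kind.args, List.mem_cons] at h
    simp only [Kind.order, Kind.size]
    rcases h with rfl | h
    · omega
    · have := ihb h
      omega

namespace Game

/-- Only domains of argument kinds are computed. Their order is below that of the game, so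
`domScale_le` yields towers of height at most `G.order + 1`; clauses and domains are simply
recomputed for every argument of every non-terminal. -/
theorem towerTime_ntData :
    TowerTime Game.order fun G => List.ofFn (G.ntData G.clauses) := by
  obtain ⟨S, hS, hSB⟩ := towerTime_clauses (k := Game.order)
  obtain ⟨X, hX, hXU⟩ := exists_esz_clauses_le
  have hk := pt_kinds
  have hr := pt_rules
  have ho := pt_owners
  have hn := pt_num
  let args (p : Game × SExp) : List SExp :=
    (nth (SExp.ofFn fun F => (p.1.scheme.nkind F).code) p.2).toList
  have hargs : PT args := by
    have : PT fun p : Game × SExp => SExp.ofFn fun F => (p.1.scheme.nkind F).code :=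
      PT.comp (g := fun G : Game => SExp.ofFn fun F => (G.scheme.nkind F).code)
        (f := fun p : Game × SExp => p.1) hk PT.fst
    change PT fun p : Game × SExp =>
      (nth (SExp.ofFn fun F => (p.1.scheme.nkind F).code) p.2).toList
    fun_prop
  have h1 : TC (fun q : (Game × SExp) × SExp => (domData q.1.1.clauses q.2).1)
      fun q => S q.1.1 + domScale q.1.1.clauses q.2 := by
    have e1 : TC (fun q : (Game × SExp) × SExp => q.1.1.clauses) fun q => 0 + S q.1.1 :=
      hS.comp (f := fun q : (Game × SExp) × SExp => q.1.1) (S := fun _ => 0)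
        (by change PT _; fun_prop)
    have e2 : PT fun q : (Game × SExp) × SExp => q.2 := by fun_prop
    have e3 : PT fun x : DomData => x.1 := PT.fst
    exact ((e3.tc fun _ => 0).comp (TC.domData.comp ((e2.tc fun _ => 0).pair e1))).of_le
      fun q => by simp
  have h2 := h1.list_map (f := fun p a => (domData p.1.clauses a).1) (l := args)
    (Sl := fun _ => 0) hargs
    (fun p => S p.1 + ((args p).map fun a => domScale p.1.clauses a).sum) fun p a ha => by
      have := List.le_sum_of_mem (List.mem_map_of_mem (f := fun a => domScale p.1.clauses a) ha)
      dsimp only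
      omega
  have h3 : PT fun p : Game × SExp =>
      ((nth (SExp.ofFn fun F => SExp.ofList ((p.1.scheme.rules F).map Term.code)) p.2).toList,
        (nth (SExp.ofFn fun F => (p.1.owner F).code) p.2).isCons) := by
    have e1 : PT fun p : Game × SExp =>
        SExp.ofFn fun F => SExp.ofList ((p.1.scheme.rules F).map Term.code) :=
      PT.comp (g := fun G : Game => SExp.ofFn fun F => SExp.ofList ((G.scheme.rules F).map Term.code))
        (f := fun p : Game × SExp => p.1) hr PT.fst
    have e2 : PT fun p : Game × SExp => SExp.ofFn fun F => (p.1.owner F).code :=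
      PT.comp (g := fun G : Game => SExp.ofFn fun F => (G.owner F).code)
        (f := fun p : Game × SExp => p.1) ho PT.fst
    fun_prop
  have h4 := (h2.pair (h3.tc fun _ => 0)).list_map
    (f := fun (G : Game) (i : SExp) => (((args (G, i)).map fun a => (domData G.clauses a).1,
      (nth (SExp.ofFn fun F => SExp.ofList ((G.scheme.rules F).map Term.code)) i).toList,
        (nth (SExp.ofFn fun F => (G.owner F).code) i).isCons) : NTData))
    (l := fun G => upto (SExp.ofNat G.numNonterminals).toList) (Sl := fun _ => 0)
    (by change PT _; fun_prop)
    (fun G => S G + tower (G.order + 1) (7 * (X G * esz G ^ 3)) * esz G) fun G i hi => by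
      rw [upto_ofNat] at hi
      obtain ⟨F, -, rfl⟩ := List.mem_map.1 hi
      simp only [args, nth_ofFn, Kind.toList_code, List.map_map]
      have e1 : (((G.scheme.nkind F).args.map (fun a => domScale G.clauses a.code))).sum ≤
          esz G * tower (G.order + 1) (7 * (X G * esz G ^ 3)) := by
        refine (List.sum_le_card_nsmul _ (tower (G.order + 1) (7 * (X G * esz G ^ 3)))
          fun x hx => ?_).trans ?_
        · obtain ⟨a, ha, rfl⟩ := List.mem_map.1 hx
          refine (domScale_le (hXU G) a).trans ?_
          have e2 := Kind.of_mem_args ha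
          have e3 := G.size_le_esz F
          have e4 := G.nkind_order_le F
          refine tower_le_tower (by omega) ?_
          gcongr
          omega
        · rw [List.length_map, smul_eq_mul]
          exact Nat.mul_le_mul_right _
            ((Kind.length_args_le _).trans (G.size_le_esz F))
      have e2 : ((fun a => domScale G.clauses a) ∘ Kind.code) =
        fun a : Kind => domScale G.clauses a.code := rfl
      rw [e2]
      rw [mul_comm (esz G)] at e1
      omega
  refine TowerTime.congr ⟨_, h4, ?_⟩ fun G => ?_
  · refine (TB.const 0).add (hSB.add (TB.mul ?_ (.of_PB (PB.of_le fun _ => le_rfl))))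
    exact .of_tower ((PB.const 7).mul (hX.mul ((PB.of_le fun _ => le_rfl).pow 3))) fun _ => le_rfl
  · rw [upto_ofNat, List.map_map, List.ofFn_eq_map]
    refine List.map_congr_left fun F _ => ?_
    simp only [Function.comp, args, nth_ofFn, Kind.toList_code, List.map_map, ntData,
      SExp.toList_ofList]
    refine congrArg (Prod.mk _) (congrArg (Prod.mk _) ?_)
    cases G.owner F <;> rfl

/-- If some non-terminal is not ground, the order is at least 1 and two exponentials are available.
Otherwise the enumeration is run on the empty list of clauses. -/
theorem towerTime_groundList : TowerTime Game.order fun G => G.groundList G.clauses := by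
  obtain ⟨X, hX, hXU⟩ := exists_esz_clauses_le
  have hk := pt_kinds
  have h1 : TowerTime Game.order fun G => bif (SExp.ofFn fun F =>
      (G.scheme.nkind F).code).toList.all fun x => !x.isCons then [] else G.clauses := by
    refine TowerTime.pt_comp (f := fun G => (G.clauses, SExp.ofFn fun F =>
      (G.scheme.nkind F).code)) (g := fun p : List SExp × SExp =>
        bif p.2.toList.all fun x => !x.isCons then [] else p.1) (by fun_prop)
      (towerTime_clauses.pair hk.towerTime)
  have h2 : ∀ G : Game, (SExp.ofFn fun F => (G.scheme.nkind F).code).toList.all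
      (fun x => !x.isCons) =
      (List.finRange G.numNonterminals).all fun F => !(G.scheme.nkind F).code.isCons := by
    intro G
    rw [SExp.ofFn, SExp.toList_ofList, List.ofFn_eq_map, List.all_map]
    rfl
  simp only [h2] at h1
  refine TowerTime.comp TC.groundElems h1 (.of_tower hX fun G => ?_)
  cases h : (List.finRange G.numNonterminals).all fun F => !(G.scheme.nkind F).code.isCons with
  | true =>
    have : 0 < X G := pos_of_esz_le (hXU G)
    exact tower_pos _ this
  | false =>
    rw [List.all_eq_false] at h
    obtain ⟨F, -, hF⟩ := h
    have h3 := G.nkind_order_le F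
    have h4 : 1 ≤ (G.scheme.nkind F).order := by
      cases hκ : G.scheme.nkind F with
      | ground => simp [hκ, Kind.code] at hF
      | arrow a b => exact (Nat.le_add_left _ _).trans (le_max_left _ _)
    have h5 := two_pow_length_le (hXU G) 0 le_rfl
    refine ((Nat.le_add_right _ _).trans h5).trans (tower_le_tower (by omega) le_rfl)

theorem towerTime_rhsData :
    TowerTime Game.order fun G => (G.base G.clauses, List.ofFn (G.ntData G.clauses)) := by
  refine TowerTime.pair ?_ towerTime_ntData
  exact TowerTime.pt_comp (f := fun G => (G.aut.data, G.clauses, G.groundList G.clauses))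
    (g := fun p : AutData × List SExp × List SExp => Base.mk p.1 p.2.1 p.2.2)
    (PT.of_enc_eq fun _ => rfl)
    (pt_data.towerTime.pair (towerTime_clauses.pair towerTime_groundList))

theorem tb_nodes : TB Game.order esz fun G =>
    ((List.ofFn (G.ntData G.clauses)).map fun F => nodes F.1).sum := by
  obtain ⟨X, hX, hXU⟩ := exists_esz_clauses_le
  refine TB.mono (g := fun G => esz G * tower (G.order + 1) (X G * esz G))
    ((TB.of_PB (PB.of_le fun _ => le_rfl)).mul (.of_tower (hX.mul (PB.of_le fun _ => le_rfl))
      fun _ => le_rfl)) fun G => ?_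
  refine (List.sum_le_card_nsmul _ (tower (G.order + 1) (X G * esz G)) fun x hx => ?_).trans ?_
  · obtain ⟨f, hf, rfl⟩ := List.mem_map.1 hx
    obtain ⟨F, rfl⟩ := List.mem_ofFn.1 hf
    refine (nodes_le (hXU G) (G.scheme.nkind F) (m := G.order + 1) ?_).trans (tower_mono _ ?_)
    · exact Nat.succ_le_succ (G.nkind_order_le F)
    · exact Nat.mul_le_mul_left _ (G.size_le_esz F)
  · rw [List.length_map, List.length_ofFn, smul_eq_mul]
    exact Nat.mul_le_mul_right _ G.num_le_esz

theorem esz_rhsVal_le (e : Base × List NTData) (ν : List SExp) :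
    esz (rhsVal e ν) ≤ 1 + esz e * ((e.2.map fun F => nodes F.1).sum * esz e + 1) := by
  refine (esz_le_of_forall (m := (e.2.map fun F => nodes F.1).sum * esz e) fun x hx => ?_).trans ?_
  · obtain ⟨F, hF, rfl⟩ := List.mem_map.1 hx
    have h1 := List.le_sum_of_mem (List.mem_map_of_mem (f := fun F : NTData => nodes F.1) hF)
    have h2 := esz_le_of_mem hF
    have h3 := esz_prod e
    have h4 := esz_prod F
    exact (len_table_le _ _ _).trans (Nat.mul_le_mul h1 (by dsimp only; omega))
  · have h1 := length_lt_esz e.2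
    have h2 := esz_prod e
    rw [rhsVal, List.length_map]
    gcongr
    omega

/-- The number of rounds, the size of every iterate and the scale of one round are all bounded by
towers of height `G.order + 1`. The additional round in `G.height + 1` is the one that produces the
greatest valuation. -/
theorem towerTime_optSol : TowerTime Game.order fun G => G.valCodes G.clauses G.optSol := by
  have he := towerTime_rhsData
  have hs := he.size
  obtain ⟨S, h, hS⟩ := he
  have hit : ∀ G : Game, (rhsVal (G.base G.clauses, List.ofFn (G.ntData G.clauses)))^[G.height + 1]
      [] = G.valCodes G.clauses G.optSol := by
    intro G
    obtain ⟨i, hi, h1, h2⟩ := G.exists_iterate_eq_optSol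
    rw [iterate_rhsVal G.listsClauses, G.iterate_eq_of_stable h2 hi, h1]
  have hheight : TB Game.order esz fun G => G.height + 1 :=
    (TB.of_tower (e := fun G => esz G ^ 2) ((PB.of_le fun _ => le_rfl).pow 2) height_le).add
      (.const 1)
  refine TowerTime.congr ⟨_, TC.fix (g := rhsVal) TC.rhsVal h (x := fun _ => [])
    (Sx := fun _ => 0) (PT.const _) (fun G => G.height + 1) (fun G => ?_)
    (fun G => G.height + 1 +
      ((List.ofFn (G.ntData G.clauses)).map fun F => nodes F.1).sum +
      esz (G.base G.clauses, List.ofFn (G.ntData G.clauses)) +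
      (1 + esz (G.base G.clauses, List.ofFn (G.ntData G.clauses)) *
        (((List.ofFn (G.ntData G.clauses)).map fun F => nodes F.1).sum *
        esz (G.base G.clauses, List.ofFn (G.ntData G.clauses)) + 1)) + 1) (fun G i _ => ?_),
    (hS.add (.const 0)).add ((((hheight.add tb_nodes).add hs).add
      ((TB.const 1).add (hs.mul ((tb_nodes.mul hs).add (.const 1))))).add (.const 1))⟩ hit
  · rw [hit, rhsVal_valCodes G.listsClauses, G.isGreatest_optSol.1]
  · have : esz ((rhsVal (G.base G.clauses, List.ofFn (G.ntData G.clauses)))^[i] []) ≤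
        1 + esz (G.base G.clauses, List.ofFn (G.ntData G.clauses)) *
        (((List.ofFn (G.ntData G.clauses)).map fun F => nodes F.1).sum *
        esz (G.base G.clauses, List.ofFn (G.ntData G.clauses)) + 1) := by
      cases i with
      | zero => simp
      | succ i =>
        rw [Function.iterate_succ_apply']
        exact esz_rhsVal_le _ _
    dsimp only
    omega

/-- The fragment is started with nothing but the code of the game on its stack, and the codes it
leaves are those of the tables from `exists_table`. -/
theorem exists_machine : ∃ (M : Turing.TM2ComputableAux Bool Bool) (c : ℕ),
    (∀ k, Finite (M.tm.Γ k)) ∧ ∀ G : Game, ∃ τ : ∀ F, Table G.aut.numStates (G.scheme.nkind F),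
      (∀ F, Represents G.aut (G.scheme.nkind F) (τ F) (G.optSol F)) ∧
      OutputsWithin M G.input (G.output τ) (tower (G.order + 1) ((G.input.length + 2) ^ c)) := by
  obtain ⟨S, h, hS⟩ := towerTime_optSol
  obtain ⟨M, T, hM, hT, -⟩ : ∃ M T, _ := by unfold TC at h; exact h
  obtain ⟨c, hc⟩ := ((hS.add (.of_PB (PB.of_le fun _ => le_rfl))).trans hT).add (.const 1)
  refine ⟨M.machine, c, fun k => inferInstanceAs (Finite Bool), fun G => ?_⟩
  choose τ hτ hτ' using fun F => exists_table G.listsClauses (G.scheme.nkind F) (G.optSol F)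
  refine ⟨τ, hτ', ?_⟩
  have h1 := Frag.machine_outputs (x := G.input) (y := G.output τ) (M := M) (t := T G) (by
    have h2 := hM G []
    have h3 : bits (G.valCodes G.clauses G.optSol) = G.output τ := by
      rw [bits, enc_list_sexp, output]
      simp only [hτ]
      rfl
    rw [h3] at h2
    rw [List.append_nil, List.append_nil] at h2
    exact h2)
  obtain ⟨h2⟩ := h1
  exact ⟨{ h2 with steps_le_m := h2.steps_le_m.trans (hc G) }⟩

end Game

end HOGame


/-! ### Combination of the bounds under one polynomial -/

theorem mainTheorem6 :
    ∃ p : Polynomial ℕ,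
      (∀ (G : Game) (κ : Kind),
        Finite (G.optDom κ) ∧
        Nat.card (G.optDom κ) ≤ tower (κ.order + 2) (p.eval (G.aut.numStates + κ.size)) ∧
        ∀ (m : ℕ) (x : Fin (m + 1) → G.optDom κ), StrictAnti x →
          m + 1 ≤ tower (κ.order + 1) (p.eval (G.aut.numStates + κ.size))) ∧
      (∀ G : Game, IsGreatest {ν : G.OptVal | G.optRhs ν = ν} G.optSol ∧
        ∃ i ≤ tower (G.order + 1) (p.eval G.input.length), G.optRhs^[i] ⊤ = G.optSol) ∧
      ∃ M : Turing.TM2ComputableAux Bool Bool, (∀ k, Finite (M.tm.Γ k)) ∧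
        ∀ G : Game, ∃ τ : ∀ F, Table G.aut.numStates (G.scheme.nkind F),
          (∀ F, Represents G.aut (G.scheme.nkind F) (τ F) (G.optSol F)) ∧
          OutputsWithin M G.input (G.output τ)
            (tower (G.order + 1) (p.eval G.input.length)) := by
  obtain ⟨M, c, hM, hout⟩ := Game.exists_machine
  have hp : ∀ n : ℕ, ((Polynomial.X + 2) ^ c + (Polynomial.X + 1) ^ 2 : Polynomial ℕ).eval n =
      (n + 2) ^ c + (n + 1) ^ 2 := fun n => by simp
  -- The first summand bounds the running time. The second dominates `(|Q| + 1) * |κ| + 1` from the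
  -- size bounds and the square of the input length from `Game.height_le`.
  refine ⟨(Polynomial.X + 2) ^ c + (Polynomial.X + 1) ^ 2, fun G κ => ?_, fun G => ?_, M, hM,
    fun G => ?_⟩
  · have h1 : (G.aut.numStates + 1) * κ.size + 1 ≤ (G.aut.numStates + κ.size + 2) ^ c +
        (G.aut.numStates + κ.size + 1) ^ 2 := by
      have := κ.size_pos
      have h2 : (G.aut.numStates + 1) * κ.size + 1 ≤ (G.aut.numStates + κ.size + 1) ^ 2 := by
        nlinarith
      omega
    rw [hp]
    refine ⟨finite_dom κ, (card_dom_le G.aut κ).trans (tower_mono _ ((Nat.le_succ _).trans h1)),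
      fun m x hx => (chain_length_le G.aut κ m x hx).trans (tower_mono _ h1)⟩
  · obtain ⟨i, hi, h, -⟩ := G.exists_iterate_eq_optSol
    refine ⟨G.isGreatest_optSol, i, hi.trans (G.height_le.trans (tower_mono _ ?_)), h⟩
    rw [hp]
    exact (Nat.pow_le_pow_left (Nat.le_succ _) 2).trans (Nat.le_add_left _ _)
  · obtain ⟨τ, hτ, ⟨h⟩⟩ := hout G
    refine ⟨τ, hτ, ⟨{ h with steps_le_m := h.steps_le_m.trans (tower_mono _ ?_) }⟩⟩
    rw [hp]
    exact Nat.le_add_right _ _
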